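/- Write $\mathbb R_+=(0,\infty)$ and let $0<\sigma<1$, $\lambda>0$. Let $J_\nu$, $I_\nu$ denote the Bessel function and the modified Bessel function of the first kind, and let $$h_\lambda f(x)=\int_0^\infty\sqrt{xy}\,J_{\lambda-1/2}(xy)f(y)\,dy,\qquad W_t^\lambda(x,y)=\frac{\sqrt{xy}}{2t}\,I_{\lambda-1/2}\Big(\frac{xy}{2t}\Big)e^{-(x^2+y^2)/(4t)},\qquad W_t^\lambda u(x)=\int_0^\infty W_t^\lambda(x,y)u(y)\,dy.$$ Let $\mathcal S_\lambda$ be the space of smooth $\phi$ on $\mathbb R_+$ with $\sup_{x>0}(1+x)^m\big|(\tfrac1x\tfrac{d}{dx})^k(x^{-\lambda}\phi(x))\big|<\infty$ for all integers $m,k\ge0$. For $\phi\in\mathcal S_\lambda$ put $\Delta_\lambda^\sigma\phi=h_\lambda(y^{2\sigma}h_\lambda\phi)$. Let $L_\sigma$ be the space of $u:\mathbb R_+\to\mathbb R$ with $\int_0^\infty |u(x)|(1+x)^{-1-2\sigma}dx<\infty$; for $u\in L_\sigma$ the functional $\Delta_\lambda^\sigma u$ on $\mathcal S_\lambda$ is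 defined by $\langle\Delta_\lambda^\sigma u,\phi\rangle=\int_0^\infty u\,\Delta_\lambda^\sigma\phi\,dx$, and a continuous function $g$ on $\mathbb R_+$ is identified with the functional $\phi\mapsto\int_0^\infty g\phi\,dx$ (whenever these integrals converge absolutely for all $\phi\in\mathcal S_\lambda$). For $0<\alpha\le1$ let $C^\alpha_+$ (called $\mathrm{Lip}_+$ when $\alpha=1$) be the space of continuous $f$ on $\mathbb R_+$ with $\sup_{x\ne y}\frac{|f(x)-f(y)|}{|x-y|^\alpha}+\sup_{x>0}x^{-\alpha}|f(x)|<\infty$. Let $u\in L_\sigma$, and suppose that one of the following holds: (1) $0<\sigma<1/2$, $\lambda\ge1$, and $u\in C^\alpha_+$ for some $\alpha$ with $2\sigma<\alpha\le1$; (2) $1/2\le\sigma<1$, $\lambda\ge2$, $u$ is continuous on $[0,\infty)$ and differentiable on $\mathbb R_+$, and $u'\in C^\alpha_+$ for some $\alpha$ with $2\sigma-1<\alpha\le1$. Then $\Delta_\lambda^\sigma u$ is a (unique) continuous function on $\mathbb R_+$, and $$\Delta_\lambda^\sigma u(x)=\frac1{\Gamma(-\sigma)}\int_0^\infty\big(W_t^\lambda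 u(x)-u(x)\big)\frac{dt}{t^{1+\sigma}},\qquad x\in\mathbb R_+,$$ where the integrals defining $W_t^\lambda u(x)$, $t>0$, and the integral in $t$ converge absolutely. -/

import Mathlib

open Set MeasureTheory

noncomputable section

/-- Bessel function of the first kind `J_ν(z)`, `z > 0`, by its power series. -/
def besselJ (ν z : ℝ) : ℝ :=
  ∑' k : ℕ, (-1) ^ k / ((k.factorial : ℝ) * Real.Gamma (k + ν + 1)) * (z / 2) ^ (2 * (k : ℝ) + ν)

/-- Modified Bessel function of the first kind `I_ν(z)`, `z > 0`, by its power series. -/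
def besselI (ν z : ℝ) : ℝ :=
  ∑' k : ℕ, 1 / ((k.factorial : ℝ) * Real.Gamma (k + ν + 1)) * (z / 2) ^ (2 * (k : ℝ) + ν)

/-- The Hankel transform on `(0,∞)`:
`h_lam f (x) = ∫_0^∞ √(x y) J_{lam - 1/2}(x y) f(y) dy`. -/
def hankel (lam : ℝ) (f : ℝ → ℝ) (x : ℝ) : ℝ :=
  ∫ y in Ioi (0 : ℝ), Real.sqrt (x * y) * besselJ (lam - 1 / 2) (x * y) * f y

/-- The operator `(1/x) d/dx`. -/
def invDeriv (f : ℝ → ℝ) (x : ℝ) : ℝ := x⁻¹ * deriv f x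

/-- The space `S_lam` of test functions: smooth `φ` on `(0,∞)` all of whose seminorms
`sup_{x>0} (1+x)^m |((1/x) d/dx)^k (x^{-lam} φ(x))|` are finite. Functions on `(0,∞)` are
represented by functions on `ℝ` whose values outside `(0,∞)` are irrelevant. -/
structure IsBesselTest (lam : ℝ) (φ : ℝ → ℝ) : Prop where
  smooth : ContDiffOn ℝ (⊤ : ℕ∞) φ (Ioi 0)
  decay : ∀ m k : ℕ, ∃ C : ℝ, ∀ x : ℝ, 0 < x →
    (1 + x) ^ m * |(invDeriv^[k] (fun y => y ^ (-lam) * φ y)) x| ≤ C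

/-- `Δ_lam^σ φ = h_lam (y^{2σ} h_lam φ)` for test functions `φ`. -/
def fracBesselTest (lam σ : ℝ) (φ : ℝ → ℝ) : ℝ → ℝ :=
  hankel lam (fun y => y ^ (2 * σ) * hankel lam φ y)

/-- The weighted space `L_ρ`: `∫_0^∞ |u(x)| / (1+x)^{1+2ρ} dx < ∞`. -/
def MemLWeight (ρ : ℝ) (u : ℝ → ℝ) : Prop :=
  IntegrableOn (fun x => u x / (1 + x) ^ (1 + 2 * ρ)) (Ioi 0)

/-- The Hölder space `C^α_+` for `0 < α < 1`, and the space `Lip_+` for `α = 1`. -/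
structure IsHolderPlus (α : ℝ) (f : ℝ → ℝ) : Prop where
  cont : ContinuousOn f (Ioi 0)
  holder : ∃ C : ℝ, ∀ x y : ℝ, 0 < x → 0 < y → x ≠ y → |f x - f y| / |x - y| ^ α ≤ C
  growth : ∃ C : ℝ, ∀ x : ℝ, 0 < x → x ^ (-α) * |f x| ≤ C

/-- The Bessel heat kernel `W_t^lam(x,y)`. -/
def besselHeatKernel (lam t x y : ℝ) : ℝ :=
  Real.sqrt (x * y) / (2 * t) * besselI (lam - 1 / 2) (x * y / (2 * t))
    * Real.exp (-(x ^ 2 + y ^ 2) / (4 * t))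

/-- The Bessel heat semigroup `W_t^lam u(x) = ∫_0^∞ W_t^lam(x,y) u(y) dy`. -/
def besselHeat (lam t : ℝ) (u : ℝ → ℝ) (x : ℝ) : ℝ :=
  ∫ y in Ioi (0 : ℝ), besselHeatKernel lam t x y * u y

/-- The functional `Δ_lam^σ u` on test functions, defined by transposition:
`⟨Δ_lam^σ u, φ⟩ = ∫_0^∞ u(x) Δ_lam^σ φ(x) dx`. -/
def fracBesselFunctional (lam σ : ℝ) (u φ : ℝ → ℝ) : ℝ :=
  ∫ x in Ioi (0 : ℝ), u x * fracBesselTest lam σ φ x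

/-- `Δ_lam^σ u` is (well defined on all test functions and is) the continuous function `g`
on `(0,∞)`, under the identification `g ≡ (φ ↦ ∫_0^∞ g φ)`. -/
structure IsFracBessel (lam σ : ℝ) (u g : ℝ → ℝ) : Prop where
  cont : ContinuousOn g (Ioi 0)
  wellDefined : ∀ φ : ℝ → ℝ, IsBesselTest lam φ →
    IntegrableOn (fun x => u x * fracBesselTest lam σ φ x) (Ioi 0)
  integrable : ∀ φ : ℝ → ℝ, IsBesselTest lam φ → IntegrableOn (fun x => g x * φ x) (Ioi 0)
  eq : ∀ φ : ℝ → ℝ, IsBesselTest lam φ →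
    fracBesselFunctional lam σ u φ = ∫ x in Ioi (0 : ℝ), g x * φ x

end

/-! The Hankel transform turns the Bessel heat semigroup into multiplication by e^{-ty²}. Since s^σ
= Γ(-σ)⁻¹ ∫ (e^{-ts} - 1) t^{-1-σ} dt (`integral_exp_neg_sub_one_mul`), taking s = y² yields the
heat formula on test functions (`IsBesselTest.fracBesselTest_eq`). The diagonalization rests on
Weber's second exponential integral (`integral_weber`) and on Hankel inversion, obtained by letting
t → 0 in the semigroup.

The formula passes to u by duality. The kernel is symmetric, so ∫ u (W_t φ - φ) = ∫ (W_t u - u) φ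
for every t (`HeatRegular.integral_symm`). Integrating against t^{-1-σ} and applying Fubini on both
sides identifies the functional with the heat formula (`HeatRegular.isFracBessel`). What remains is
absolute joint integrability on both sides.

For small t, Poisson's integral compares the Bessel kernel with the Gauss–Weierstrass kernel
(`besselClifford_asymp`, `besselHeatKernel_bounds`). Hence the Bessel kernel has mass 1 up to
O(t/x²) and is centered up to O(t/x). An expansion of u with remainder |x-y|^β then makes W_t u - u
of size t^{β/2} + t, with a coefficient depending on x (`exists_besselHeat_sub_le`), and this is
integrable against t^{-1-σ} when β > 2σ. In case (1) the expansion is of order zero with β = α; in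
case (2) it is of first order with β = 1 + α. The singular factors 1/x and 1/x² are absorbed by the
factor x^λ in test functions.

For large t, the Gaussian is replaced by the polynomial tail t^{1+σ} (t + r²)^{-(3/2+σ)}. Divided by
t^{1+σ} and integrated over t > 1, this tail is controlled by the weight of L_σ
(`MemLWeight.integrable_parabolic_prod`).

Uniqueness holds because smooth functions compactly supported in (0,∞) are test functions
(`IsFracBessel.eqOn`). -/

noncomputable section

open Filter Topology

/-! ### Bessel–Clifford functions: the entire factor of J and I -/

/-- The coefficients of the Bessel–Clifford function `C_ν`. -/
def cliffordCoeff (ν : ℝ) (k : ℕ) : ℝ := 1 / ((k.factorial : ℝ) * Real.Gamma (k + ν + 1))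

/-- The Bessel–Clifford function `C_ν(w) = ∑ w^k / (k! Γ(k+ν+1))`. -/
def besselClifford (ν w : ℝ) : ℝ := ∑' k : ℕ, cliffordCoeff ν k * w ^ k

/-- Each step multiplies by k + ν + 1 ≥ 1; this is where ν ≥ 0 enters, Γ not being monotone near 0.
-/
lemma gamma_le_gamma_nat_add {ν : ℝ} (hν : 0 ≤ ν) (k : ℕ) :
    Real.Gamma (ν + 1) ≤ Real.Gamma (k + ν + 1) := by
  induction k with
  | zero => simp
  | succ k ih =>
    have h : Real.Gamma ((k + 1 : ℕ) + ν + 1) = (k + ν + 1) * Real.Gamma (k + ν + 1) := by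
      rw [← Real.Gamma_add_one (by positivity)]; push_cast; ring_nf
    rw [h]
    have h0 : 0 < Real.Gamma (k + ν + 1) := Real.Gamma_pos_of_pos (by positivity)
    have hk : (0 : ℝ) ≤ k := Nat.cast_nonneg k
    nlinarith

lemma gamma_nat_add_pos {ν : ℝ} (hν : 0 ≤ ν) (k : ℕ) : 0 < Real.Gamma (k + ν + 1) :=
  Real.Gamma_pos_of_pos (by positivity)

lemma cliffordCoeff_pos {ν : ℝ} (hν : 0 ≤ ν) (k : ℕ) : 0 < cliffordCoeff ν k := by
  have := gamma_nat_add_pos hν k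
  unfold cliffordCoeff; positivity

lemma cliffordCoeff_le {ν : ℝ} (hν : 0 ≤ ν) (k : ℕ) :
    cliffordCoeff ν k ≤ (Real.Gamma (ν + 1))⁻¹ * (1 / (k.factorial : ℝ)) := by
  have h1 := gamma_le_gamma_nat_add hν k
  have h0 : 0 < Real.Gamma (ν + 1) := Real.Gamma_pos_of_pos (by positivity)
  unfold cliffordCoeff
  rw [← one_div, ← one_div_mul_one_div, mul_comm]
  gcongr

lemma cliffordCoeff_succ {ν : ℝ} (k : ℕ) :
    (k + 1) * cliffordCoeff ν (k + 1) = cliffordCoeff (ν + 1) k := by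
  have h : (k : ℝ) + 1 ≠ 0 := by positivity
  have h2 : ((k + 1 : ℕ) : ℝ) + ν + 1 = k + (ν + 1) + 1 := by push_cast; ring
  unfold cliffordCoeff
  rw [h2, Nat.factorial_succ]
  push_cast
  rw [← div_eq_mul_one_div, mul_assoc, div_mul_cancel_left₀ h, one_div]

lemma cliffordCoeff_add_one {ν : ℝ} (hν : 0 ≤ ν) (k : ℕ) :
    (k + ν + 1) * cliffordCoeff (ν + 1) k = cliffordCoeff ν k := by
  have h : (k : ℝ) + ν + 1 ≠ 0 := by positivity
  have h2 : (k : ℝ) + (ν + 1) + 1 = (k + ν + 1) + 1 := by ring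
  unfold cliffordCoeff
  rw [h2, Real.Gamma_add_one h, ← div_eq_mul_one_div, mul_left_comm, div_mul_cancel_left₀ h, one_div]

lemma summable_cliffordCoeff_mul_pow {ν : ℝ} (hν : 0 ≤ ν) (w : ℝ) :
    Summable fun k : ℕ => cliffordCoeff ν k * w ^ k := by
  refine Summable.of_norm_bounded
    (g := fun k : ℕ => (Real.Gamma (ν + 1))⁻¹ * (|w| ^ k / (k.factorial : ℝ))) ?_ ?_
  · exact (Real.summable_pow_div_factorial _).mul_left _
  · intro k
    rw [norm_mul, Real.norm_of_nonneg (cliffordCoeff_pos hν k).le, norm_pow, Real.norm_eq_abs]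
    calc _ ≤ (Real.Gamma (ν + 1))⁻¹ * (1 / (k.factorial : ℝ)) * |w| ^ k := by
          gcongr; exact cliffordCoeff_le hν k
      _ = _ := by ring

/-- Termwise differentiation on a ball of radius |w| + 1; by `cliffordCoeff_succ` the differentiated
series is, after an index shift, the series of order ν + 1. -/
lemma hasDerivAt_besselClifford {ν : ℝ} (hν : 0 ≤ ν) (w : ℝ) :
    HasDerivAt (besselClifford ν) (besselClifford (ν + 1) w) w := by
  set R := |w| + 1
  have hsum : Summable fun k : ℕ => ((k : ℝ) * cliffordCoeff ν k) * R ^ (k - 1) := by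
    rw [← summable_nat_add_iff 1]
    refine (summable_cliffordCoeff_mul_pow (ν := ν + 1) (by linarith) R).congr fun k => ?_
    rw [← cliffordCoeff_succ]; simp
  have key := hasDerivAt_tsum_of_isPreconnected (g := fun (k : ℕ) (w : ℝ) => cliffordCoeff ν k * w ^ k)
    (g' := fun (k : ℕ) (w : ℝ) => cliffordCoeff ν k * ((k : ℝ) * w ^ (k - 1)))
    (t := Metric.ball 0 R) (y₀ := 0) (y := w) hsum Metric.isOpen_ball
    (convex_ball (0 : ℝ) R).isPreconnected
    (fun k y _ => (hasDerivAt_pow k y).const_mul _) ?_ (by simp [R]; positivity)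
    (summable_cliffordCoeff_mul_pow hν 0) (by simp [R])
  · have h2 : ∑' k : ℕ, cliffordCoeff ν k * ((k : ℝ) * w ^ (k - 1)) = besselClifford (ν + 1) w := by
      rw [← Summable.sum_add_tsum_nat_add' (k := 1)]
      · simp only [Finset.range_one, Finset.sum_singleton, Nat.cast_zero, zero_mul, mul_zero,
          zero_add, Nat.add_sub_cancel, besselClifford]
        refine tsum_congr fun k => ?_
        rw [← cliffordCoeff_succ]; push_cast; ring
      · refine (summable_cliffordCoeff_mul_pow (ν := ν + 1) (by linarith) w).congr fun k => ?_
        rw [← cliffordCoeff_succ]; simp only [Nat.add_sub_cancel]; push_cast; ring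
    rw [← h2]; exact key
  · intro k y hy
    have hy' : |y| ≤ R := by simpa using (Metric.mem_ball.1 hy).le
    have := cliffordCoeff_pos hν k
    rw [norm_mul, norm_mul, norm_pow, Real.norm_of_nonneg this.le, Real.norm_natCast,
      Real.norm_eq_abs, ← mul_assoc, mul_comm (cliffordCoeff ν k)]
    gcongr

lemma continuous_besselClifford {ν : ℝ} (hν : 0 ≤ ν) : Continuous (besselClifford ν) :=
  continuous_iff_continuousAt.2 fun w => (hasDerivAt_besselClifford hν w).continuousAt

/-- Write k + ν + 1 = (ν + 1) + k in `cliffordCoeff_add_one`: the factor k, after an index shift,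
produces w times the function two orders up. Combined with C_ν' = C_{ν+1}, this is Bessel's equation
in disguise. -/
lemma besselClifford_recurrence {ν : ℝ} (hν : 0 ≤ ν) (w : ℝ) :
    besselClifford ν w = (ν + 1) * besselClifford (ν + 1) w + w * besselClifford (ν + 1 + 1) w := by
  have h1 := summable_cliffordCoeff_mul_pow (ν := ν + 1) (by linarith) w
  have h2 := summable_cliffordCoeff_mul_pow (ν := ν + 1 + 1) (by linarith) w
  have h3 : w * besselClifford (ν + 1 + 1) w
      = ∑' k : ℕ, (k : ℝ) * cliffordCoeff (ν + 1) k * w ^ k := by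
    rw [← Summable.sum_add_tsum_nat_add' (k := 1)]
    · simp only [Finset.range_one, Finset.sum_singleton, Nat.cast_zero, zero_mul, zero_add,
        besselClifford, ← tsum_mul_left]
      refine tsum_congr fun k => ?_
      rw [← cliffordCoeff_succ]; push_cast; ring
    · refine (h2.mul_left w).congr fun k => ?_
      rw [← cliffordCoeff_succ]; push_cast; ring
  have h4 : Summable fun k : ℕ => (k : ℝ) * cliffordCoeff (ν + 1) k * w ^ k := by
    rw [← summable_nat_add_iff 1]
    refine (h2.mul_left w).congr fun k => ?_
    rw [← cliffordCoeff_succ]; push_cast; ring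
  rw [h3, besselClifford, besselClifford, ← tsum_mul_left, ← Summable.tsum_add (h1.mul_left _) h4]
  refine tsum_congr fun k => ?_
  rw [← cliffordCoeff_add_one hν]; ring

lemma besselClifford_nonneg {ν : ℝ} (hν : 0 ≤ ν) {w : ℝ} (hw : 0 ≤ w) : 0 ≤ besselClifford ν w :=
  tsum_nonneg fun k => by have := cliffordCoeff_pos hν k; positivity

/-- Chain rule for `y ↦ C_ν(-(a y)²/4)`. -/
lemma hasDerivAt_besselClifford_neg_sq {ν : ℝ} (hν : 0 ≤ ν) (a y : ℝ) :
    HasDerivAt (fun y => besselClifford ν (-((a * y) ^ 2 / 4)))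
      (-(a ^ 2 * y / 2) * besselClifford (ν + 1) (-((a * y) ^ 2 / 4))) y := by
  have h : HasDerivAt (fun y : ℝ => -((a * y) ^ 2 / 4)) (-(a ^ 2 * y / 2)) y := by
    have := (((hasDerivAt_id y).const_mul a).pow 2).div_const 4 |>.neg
    convert! this using 1
    simp; ring
  have := (hasDerivAt_besselClifford hν (-((a * y) ^ 2 / 4))).comp y h
  rw [mul_comm] at this
  exact this

/-- The oscillatory Bessel–Clifford function is bounded by its value at the origin: the energy
`c² + c'²` of `c(z) = C_ν(-z²/4)` decreases. -/
lemma abs_besselClifford_neg_le {ν : ℝ} (hν : 0 ≤ ν) {w : ℝ} (hw : 0 ≤ w) :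
    |besselClifford ν (-w)| ≤ besselClifford ν 0 := by
  -- The factor `1 * z` is kept so that `hasDerivAt_besselClifford_neg_sq` applies verbatim with a =
  -- 1.
  set E : ℝ → ℝ := fun z => besselClifford ν (-((1 * z) ^ 2 / 4)) ^ 2
    + (-(z / 2) * besselClifford (ν + 1) (-((1 * z) ^ 2 / 4))) ^ 2 with hE
  -- Bessel's equation c'' + (2ν+1)/z · c' + c = 0 gives E' = -2(2ν+1)/z · c'², and c' = -(z/2)
  -- C_{ν+1}.
  have hder : ∀ z, HasDerivAt E
      (-(2 * ν + 1) / 2 * z * besselClifford (ν + 1) (-((1 * z) ^ 2 / 4)) ^ 2) z := by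
    intro z
    have h0 := hasDerivAt_besselClifford_neg_sq hν 1 z
    have h1 := hasDerivAt_besselClifford_neg_sq (ν := ν + 1) (by linarith) 1 z
    have h2 := (h0.pow 2).add ((((hasDerivAt_id z).div_const 2).neg.mul h1).pow 2)
    refine h2.congr_deriv ?_
    have hr := besselClifford_recurrence hν (-((1 * z) ^ 2 / 4))
    simp only [Nat.cast_ofNat, id_eq, Nat.add_one_sub_one, pow_one, Pi.mul_apply, Pi.neg_apply]
    rw [hr]; ring
  have hanti : AntitoneOn E (Ici 0) := by
    refine antitoneOn_of_deriv_nonpos (convex_Ici 0)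
      (fun z _ => (hder z).continuousAt.continuousWithinAt)
      (fun z _ => (hder z).differentiableAt.differentiableWithinAt) ?_
    intro z hz
    rw [interior_Ici] at hz
    have hz' : 0 < z := hz
    rw [(hder z).deriv]
    have : 0 ≤ (2 * ν + 1) / 2 * z * besselClifford (ν + 1) (-((1 * z) ^ 2 / 4)) ^ 2 := by
      positivity
    have e : -(2 * ν + 1) / 2 * z * besselClifford (ν + 1) (-((1 * z) ^ 2 / 4)) ^ 2 =
      -((2 * ν + 1) / 2 * z * besselClifford (ν + 1) (-((1 * z) ^ 2 / 4)) ^ 2) := by ring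
    linarith
  -- The point z = 2√w satisfies z²/4 = w.
  have h := hanti (mem_Ici.2 le_rfl) (mem_Ici.2 (by positivity : 0 ≤ 2 * √w)) (by positivity)
  have hw' : (1 * (2 * √w)) ^ 2 / 4 = w := by
    rw [one_mul, mul_pow, Real.sq_sqrt hw]; ring
  simp only [hE, hw'] at h
  have h2 : besselClifford ν (-w) ^ 2 ≤ besselClifford ν 0 ^ 2 := by
    simp only [mul_zero, zero_div, neg_zero, zero_mul, ne_eq, OfNat.ofNat_ne_zero,
      not_false_eq_true, zero_pow, add_zero] at h
    nlinarith [sq_nonneg (-(2 * √w / 2) * besselClifford (ν + 1) (-w))]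
  exact abs_le_of_sq_le_sq h2 (besselClifford_nonneg hν le_rfl)

lemma besselJ_eq {ν z : ℝ} (hz : 0 < z) :
    besselJ ν z = (z / 2) ^ ν * besselClifford ν (-(z ^ 2 / 4)) := by
  rw [besselJ, besselClifford, ← tsum_mul_left]
  refine tsum_congr fun k => ?_
  have h2 : 0 < z / 2 := by positivity
  have e : (z / 2) ^ (2 * (k : ℝ) + ν) = (z / 2) ^ ν * (z ^ 2 / 4) ^ k := by
    rw [Real.rpow_add h2, mul_comm, Real.rpow_mul h2.le, Real.rpow_natCast]
    norm_num; left; congr 1; ring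
  rw [e, neg_pow (z ^ 2 / 4), cliffordCoeff]; ring

lemma besselI_eq {ν z : ℝ} (hz : 0 < z) :
    besselI ν z = (z / 2) ^ ν * besselClifford ν (z ^ 2 / 4) := by
  rw [besselI, besselClifford, ← tsum_mul_left]
  refine tsum_congr fun k => ?_
  have h2 : 0 < z / 2 := by positivity
  have e : (z / 2) ^ (2 * (k : ℝ) + ν) = (z / 2) ^ ν * (z ^ 2 / 4) ^ k := by
    rw [Real.rpow_add h2, mul_comm, Real.rpow_mul h2.le, Real.rpow_natCast]
    norm_num; left; congr 1; ring
  rw [e, cliffordCoeff]; ring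

/-! ### Poisson's integral and the asymptotics of I -/

lemma integral_beta_real {a b : ℝ} (ha : 0 < a) (hb : 0 < b) :
    ∫ x in (0 : ℝ)..1, x ^ (a - 1) * (1 - x) ^ (b - 1)
      = Real.Gamma a * Real.Gamma b / Real.Gamma (a + b) := by
  have h := ProbabilityTheory.beta_eq_betaIntegralReal a b ha hb
  rw [ProbabilityTheory.beta] at h
  rw [h, Complex.betaIntegral]
  have e : ∫ x in (0 : ℝ)..1, (x : ℂ) ^ ((a : ℂ) - 1) * (1 - (x : ℂ)) ^ ((b : ℂ) - 1)
      = ((∫ x in (0 : ℝ)..1, x ^ (a - 1) * (1 - x) ^ (b - 1) : ℝ) : ℂ) := by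
    rw [← intervalIntegral.integral_ofReal]
    refine intervalIntegral.integral_congr fun x hx => ?_
    rw [uIcc_of_le zero_le_one] at hx
    have h1 : 0 ≤ 1 - x := by linarith [hx.2]
    push_cast
    rw [Complex.ofReal_cpow hx.1, Complex.ofReal_cpow h1]
    push_cast; rfl
  rw [e, Complex.ofReal_re]

/-- The substitution x = s² leads to a Beta integral at (k + 1/2, λ). The indicator of (0,1] is
carried along because the change of variables is made on the half-line. -/
lemma integral_even_moment {lam : ℝ} (hlam : 0 < lam) (k : ℕ) :
    ∫ s in (0 : ℝ)..1, s ^ (2 * k) * (1 - s ^ 2) ^ (lam - 1)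
      = Real.Gamma (k + 1 / 2) * Real.Gamma lam / Real.Gamma (k + 1 / 2 + lam) / 2 := by
  have hk : (0 : ℝ) < k + 1 / 2 := by positivity
  have hI : Ioi (0 : ℝ) ∩ Ioc 0 1 = Ioc 0 1 := inter_eq_right.2 Ioc_subset_Ioi_self
  rw [← integral_beta_real hk hlam, intervalIntegral.integral_of_le zero_le_one,
    intervalIntegral.integral_of_le zero_le_one]
  have h := integral_comp_rpow_Ioi_of_pos (p := 2) (by norm_num)
    (g := (Ioc (0 : ℝ) 1).indicator fun x : ℝ => x ^ ((k : ℝ) + 1 / 2 - 1) * (1 - x) ^ (lam - 1))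
  rw [setIntegral_indicator measurableSet_Ioc,
    hI] at h
  rw [← h, ← integral_div]
  have h3 : ∀ s : ℝ, s ∈ Ioi (0 : ℝ) →
      ((2 * s ^ ((2 : ℝ) - 1)) • (Ioc (0 : ℝ) 1).indicator
        (fun x : ℝ => x ^ ((k : ℝ) + 1 / 2 - 1) * (1 - x) ^ (lam - 1)) (s ^ (2 : ℝ))) / 2
      = (Ioc (0 : ℝ) 1).indicator (fun s => s ^ (2 * k) * (1 - s ^ 2) ^ (lam - 1)) s := by
    intro s hs
    have hs0 : 0 < s := hs
    by_cases h1 : s ≤ 1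
    · have m1 : s ∈ Ioc (0 : ℝ) 1 := ⟨hs0, h1⟩
      have m2 : s ^ (2 : ℝ) ∈ Ioc (0 : ℝ) 1 := ⟨by positivity, Real.rpow_le_one hs0.le h1 (by norm_num)⟩
      rw [indicator_of_mem m1, indicator_of_mem m2, smul_eq_mul, ← Real.rpow_mul hs0.le]
      have e1 : s ^ (2 * k) = s ^ ((2 : ℝ) - 1) * s ^ (2 * ((k : ℝ) + 1 / 2 - 1)) := by
        rw [← Real.rpow_add hs0, ← Real.rpow_natCast]; push_cast; congr 1; ring
      rw [e1, Real.rpow_two]; ring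
    · have m1 : s ∉ Ioc (0 : ℝ) 1 := fun h => h1 h.2
      have m2 : s ^ (2 : ℝ) ∉ Ioc (0 : ℝ) 1 := fun h =>
        absurd h.2 (not_le.2 (Real.one_lt_rpow (not_le.1 h1) (by norm_num)))
      rw [indicator_of_notMem m1, indicator_of_notMem m2]; simp
  rw [setIntegral_congr_fun measurableSet_Ioi h3, setIntegral_indicator measurableSet_Ioc,
    hI]

/-- The duplication formula in the form needed to turn the (2k)! of the cosh series into the k! of
the Bessel series. -/
lemma gamma_nat_add_half_div (k : ℕ) :
    Real.Gamma (k + 1 / 2) / ((2 * k).factorial : ℝ) = √Real.pi / (4 ^ k * k.factorial) := by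
  induction k with
  | zero => simp [-one_div, Real.Gamma_one_half_eq]
  | succ k ih =>
    have h1 : Real.Gamma ((k + 1 : ℕ) + 1 / 2) = (k + 1 / 2) * Real.Gamma (k + 1 / 2) := by
      rw [← Real.Gamma_add_one (by positivity)]; push_cast; ring_nf
    have h2 : ((2 * (k + 1)).factorial : ℝ) = (2 * k + 2) * (2 * k + 1) * (2 * k).factorial := by
      rw [show 2 * (k + 1) = 2 * k + 1 + 1 by ring, Nat.factorial_succ, Nat.factorial_succ]
      push_cast; ring
    have h4 : (k : ℝ) + 1 / 2 ≠ 0 := by positivity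
    have h5 : ((2 * k).factorial : ℝ) ≠ 0 := by positivity
    have h6 : (k.factorial : ℝ) ≠ 0 := by positivity
    rw [h1, h2, Nat.factorial_succ]
    rw [div_eq_div_iff (by positivity) (by positivity)] at ih ⊢
    push_cast
    rw [pow_succ]
    linear_combination (4 * (k + 1) * (k + 1 / 2)) * ih

lemma continuous_one_sub_sq_rpow {lam : ℝ} (hlam : 1 ≤ lam) :
    Continuous fun s : ℝ => (1 - s ^ 2) ^ (lam - 1) :=
  (by fun_prop : Continuous fun s : ℝ => 1 - s ^ 2).rpow_const fun _ => Or.inr (by linarith)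

/-- Poisson's integral for the Bessel–Clifford function. -/
lemma integral_cosh_mul {lam : ℝ} (hlam : 1 ≤ lam) (z : ℝ) :
    ∫ s in (0 : ℝ)..1, Real.cosh (z * s) * (1 - s ^ 2) ^ (lam - 1)
      = √Real.pi * Real.Gamma lam / 2 * besselClifford (lam - 1 / 2) (z ^ 2 / 4) := by
  have hl : 0 < lam := by linarith
  have hc := continuous_one_sub_sq_rpow hlam
  have key := intervalIntegral.hasSum_integral_of_dominated_convergence (μ := volume)
    (a := 0) (b := 1)
    (F := fun (k : ℕ) (s : ℝ) => (z * s) ^ (2 * k) / ((2 * k).factorial : ℝ) * (1 - s ^ 2) ^ (lam - 1))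
    (f := fun s => Real.cosh (z * s) * (1 - s ^ 2) ^ (lam - 1))
    (fun k _ => z ^ (2 * k) / ((2 * k).factorial : ℝ))
    (fun k => (by fun_prop : Continuous _).aestronglyMeasurable) ?_ ?_ ?_ ?_
  · rw [besselClifford, ← tsum_mul_left, ← key.tsum_eq]
    refine tsum_congr fun k => ?_
    have : ∀ s : ℝ, (z * s) ^ (2 * k) / ((2 * k).factorial : ℝ) * (1 - s ^ 2) ^ (lam - 1)
        = z ^ (2 * k) / ((2 * k).factorial : ℝ) * (s ^ (2 * k) * (1 - s ^ 2) ^ (lam - 1)) := by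
      intro s; rw [mul_pow]; ring
    simp only [this]
    rw [intervalIntegral.integral_const_mul, integral_even_moment hl]
    have h1 := gamma_nat_add_half_div k
    have e : (k : ℝ) + (lam - 1 / 2) + 1 = k + 1 / 2 + lam := by ring
    have hg : Real.Gamma (k + 1 / 2 + lam) ≠ 0 := (Real.Gamma_pos_of_pos (by positivity)).ne'
    rw [cliffordCoeff, e]
    calc _ = (Real.Gamma (k + 1 / 2) / ((2 * k).factorial : ℝ)) * z ^ (2 * k) * Real.Gamma lam
          / Real.Gamma (k + 1 / 2 + lam) / 2 := by ring
      _ = _ := by rw [h1, div_pow, ← pow_mul]; ring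
  -- Because λ ≥ 1 the weight is at most 1 on [0,1], so the cosh series at s = 1 dominates.
  · refine fun k => Eventually.of_forall fun s hs => ?_
    rw [uIoc_of_le zero_le_one] at hs
    have hs1 : s ^ 2 ≤ 1 := pow_le_one₀ hs.1.le hs.2
    have hs2 : (1 - s ^ 2) ^ (lam - 1) ≤ 1 :=
      Real.rpow_le_one (by linarith) (by nlinarith [sq_nonneg s]) (by linarith)
    have hs3 : 0 ≤ (1 - s ^ 2) ^ (lam - 1) := Real.rpow_nonneg (by linarith) _
    have hs4 : s ^ (2 * k) ≤ 1 := pow_le_one₀ hs.1.le hs.2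
    have hz : 0 ≤ z ^ (2 * k) := (even_two_mul k).pow_nonneg z
    have hs5 : 0 ≤ s ^ (2 * k) := (even_two_mul k).pow_nonneg s
    rw [mul_pow, Real.norm_of_nonneg (by positivity)]
    calc _ ≤ z ^ (2 * k) * 1 / ((2 * k).factorial : ℝ) * 1 := by gcongr
      _ = _ := by ring
  · exact Eventually.of_forall fun s _ => (Real.hasSum_cosh z).summable
  · simp
  · exact Eventually.of_forall fun s _ => (Real.hasSum_cosh (z * s)).mul_right _

/-- Splitting cosh into exponentials unfolds Poisson's integral to [-1,1]; the shift r = 1 - s then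
extracts e^z. What is left is a truncated Laplace transform, whose size for large z is read off near
r = 0. -/
lemma besselClifford_eq_integral {lam : ℝ} (hlam : 1 ≤ lam) (z : ℝ) :
    √Real.pi * Real.Gamma lam * besselClifford (lam - 1 / 2) (z ^ 2 / 4)
      = Real.exp z * ∫ r in (0 : ℝ)..2, Real.exp (-(z * r)) * (r * (2 - r)) ^ (lam - 1) := by
  have hc : Continuous fun r : ℝ => (r * (2 - r)) ^ (lam - 1) :=
    (by fun_prop : Continuous fun r : ℝ => r * (2 - r)).rpow_const fun _ => Or.inr (by linarith)
  have hs := continuous_one_sub_sq_rpow hlam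
  set F : ℝ → ℝ := fun r => Real.exp (z * (1 - r)) * (r * (2 - r)) ^ (lam - 1) with hF
  have hFc : Continuous F := by fun_prop
  have h1 : ∫ s in (0 : ℝ)..1, Real.exp (z * s) * (1 - s ^ 2) ^ (lam - 1)
      = ∫ r in (0 : ℝ)..1, F r := by
    have := intervalIntegral.integral_comp_sub_left (a := 0) (b := 1)
      (fun s : ℝ => Real.exp (z * s) * (1 - s ^ 2) ^ (lam - 1)) 1
    simp only [sub_self, sub_zero] at this
    rw [← this]
    refine intervalIntegral.integral_congr fun r _ => ?_
    simp only [hF]; congr 2; ring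
  have h2 : ∫ s in (0 : ℝ)..1, Real.exp (-(z * s)) * (1 - s ^ 2) ^ (lam - 1)
      = ∫ r in (1 : ℝ)..2, F r := by
    have := intervalIntegral.integral_comp_sub_right (a := 1) (b := 2)
      (fun s : ℝ => Real.exp (-(z * s)) * (1 - s ^ 2) ^ (lam - 1)) 1
    norm_num at this
    rw [← this]
    refine intervalIntegral.integral_congr fun r _ => ?_
    simp only [hF]; congr 2 <;> ring
  have h3 := integral_cosh_mul hlam z
  have h4 : ∫ s in (0 : ℝ)..1, Real.cosh (z * s) * (1 - s ^ 2) ^ (lam - 1)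
      = (∫ r in (0 : ℝ)..2, F r) / 2 := by
    rw [← intervalIntegral.integral_add_adjacent_intervals (hFc.intervalIntegrable 0 1)
      (hFc.intervalIntegrable 1 2), ← h1, ← h2, ← intervalIntegral.integral_add
      ((by fun_prop : Continuous _).intervalIntegrable _ _)
      ((by fun_prop : Continuous _).intervalIntegrable _ _), ← intervalIntegral.integral_div]
    refine intervalIntegral.integral_congr fun s _ => ?_
    simp only [Real.cosh_eq]; ring
  have h5 : ∫ r in (0 : ℝ)..2, F r
      = Real.exp z * ∫ r in (0 : ℝ)..2, Real.exp (-(z * r)) * (r * (2 - r)) ^ (lam - 1) := by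
    rw [← intervalIntegral.integral_const_mul]
    refine intervalIntegral.integral_congr fun r _ => ?_
    simp only [hF]
    rw [← mul_assoc, ← Real.exp_add]; congr 2; ring
  rw [← h5]; linarith

lemma integral_rpow_mul_exp_neg_eq {lam z : ℝ} (hlam : 0 < lam) (hz : 0 < z) :
    ∫ r in Ioi (0 : ℝ), r ^ (lam - 1) * Real.exp (-(z * r)) = Real.Gamma lam * z ^ (-lam) := by
  rw [Real.integral_rpow_mul_exp_neg_mul_Ioi hlam hz, one_div, Real.inv_rpow hz.le,
    Real.rpow_neg hz.le, mul_comm]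

lemma integrableOn_rpow_mul_exp_neg {lam z : ℝ} (hlam : 0 < lam) (hz : 0 < z) :
    IntegrableOn (fun r : ℝ => r ^ (lam - 1) * Real.exp (-(z * r))) (Ioi 0) := by
  have := integrableOn_rpow_mul_exp_neg_mul_rpow (p := 1) (s := lam - 1) (b := z) (by linarith)
    one_pos hz
  simpa using this

/-- Two-sided bound of the Bessel–Clifford function by its leading asymptotics. -/
lemma besselClifford_asymp {lam z : ℝ} (hlam : 1 ≤ lam) (hz : 0 < z) :
    √Real.pi * besselClifford (lam - 1 / 2) (z ^ 2 / 4)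
        ≤ Real.exp z * 2 ^ (lam - 1) * z ^ (-lam) ∧
    Real.exp z * 2 ^ (lam - 1) * z ^ (-lam) * (1 - lam ^ 2 / (2 * z))
        ≤ √Real.pi * besselClifford (lam - 1 / 2) (z ^ 2 / 4) := by
  have hl : 0 < lam := by linarith
  have hG : 0 < Real.Gamma lam := Real.Gamma_pos_of_pos hl
  have heq := besselClifford_eq_integral hlam z
  rw [intervalIntegral.integral_of_le zero_le_two] at heq
  have hc : Continuous fun r : ℝ => (r * (2 - r)) ^ (lam - 1) :=
    (by fun_prop : Continuous fun r : ℝ => r * (2 - r)).rpow_const fun _ => Or.inr (by linarith)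
  have hi0 : IntegrableOn (fun r : ℝ => Real.exp (-(z * r)) * (r * (2 - r)) ^ (lam - 1))
      (Ioc 0 2) := (by fun_prop : Continuous fun r : ℝ =>
        Real.exp (-(z * r)) * (r * (2 - r)) ^ (lam - 1)).integrableOn_Ioc
  have hi1 := integrableOn_rpow_mul_exp_neg hl hz
  have hi2 := integrableOn_rpow_mul_exp_neg (lam := lam + 1) (by linarith) hz
  have hv1 := integral_rpow_mul_exp_neg_eq hl hz
  have hv2 := integral_rpow_mul_exp_neg_eq (lam := lam + 1) (by linarith) hz
  -- Upper bound: 2 - r ≤ 2, and then the domain is enlarged to the half-line.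
  have hup : ∫ r in Ioc (0 : ℝ) 2, Real.exp (-(z * r)) * (r * (2 - r)) ^ (lam - 1)
      ≤ 2 ^ (lam - 1) * (Real.Gamma lam * z ^ (-lam)) := by
    rw [← hv1, ← integral_const_mul]
    refine (setIntegral_mono_on hi0 ((hi1.mono_set Ioc_subset_Ioi_self).const_mul _)
      measurableSet_Ioc fun r hr => ?_).trans (setIntegral_mono_set (hi1.const_mul _)
        ((ae_restrict_iff' measurableSet_Ioi).2 (Eventually.of_forall fun r hr => ?_))
        Ioc_subset_Ioi_self.eventuallyLE)
    · have h1 : (r * (2 - r)) ^ (lam - 1) ≤ (2 * r) ^ (lam - 1) :=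
        Real.rpow_le_rpow (mul_nonneg hr.1.le (by linarith [hr.2])) (by nlinarith [hr.1])
          (by linarith)
      rw [Real.mul_rpow zero_le_two hr.1.le] at h1
      nlinarith [Real.exp_pos (-(z * r))]
    · have hr' : 0 < r := hr
      simp only [Pi.zero_apply]; positivity
  -- Lower bound: (1 - r/2)^{λ-1} ≥ (1 - r/2)^λ ≥ 1 - λr/2 by Bernoulli. For r > 2 the right side is
  -- nonpositive, so extending its integral to the half-line only lowers it. The constant λ²/(2z) is
  -- (λ/2) Γ(λ+1) / (Γ(λ) z).
  have hlow : 2 ^ (lam - 1) * (Real.Gamma lam * z ^ (-lam)) * (1 - lam ^ 2 / (2 * z))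
      ≤ ∫ r in Ioc (0 : ℝ) 2, Real.exp (-(z * r)) * (r * (2 - r)) ^ (lam - 1) := by
    have e : 2 ^ (lam - 1) * (Real.Gamma lam * z ^ (-lam)) * (1 - lam ^ 2 / (2 * z))
        = ∫ r in Ioi (0 : ℝ), 2 ^ (lam - 1) * (r ^ (lam - 1) * Real.exp (-(z * r))
          - lam / 2 * (r ^ (lam + 1 - 1) * Real.exp (-(z * r)))) := by
      rw [integral_const_mul, integral_sub hi1 (hi2.const_mul _), integral_const_mul, hv1, hv2,
        Real.Gamma_add_one hl.ne', neg_add, Real.rpow_add hz, Real.rpow_neg_one]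
      field_simp
    rw [e, ← integral_indicator measurableSet_Ioi, ← integral_indicator measurableSet_Ioc]
    refine integral_mono ((integrable_indicator_iff measurableSet_Ioi).2
      ((hi1.sub (hi2.const_mul _)).const_mul _)) ((integrable_indicator_iff measurableSet_Ioc).2 hi0)
      fun r => ?_
    by_cases hr : 0 < r
    · have hr1 : r ∈ Ioi (0 : ℝ) := hr
      rw [indicator_of_mem hr1, add_sub_cancel_right]
      have hrr : r ^ lam = r ^ (lam - 1) * r := by
        rw [← Real.rpow_add_one hr.ne']; ring_nf
      have hp : 0 < r ^ (lam - 1) := by positivity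
      have hE := Real.exp_pos (-(z * r))
      have hfac : 2 ^ (lam - 1) * (r ^ (lam - 1) * Real.exp (-(z * r))
          - lam / 2 * (r ^ lam * Real.exp (-(z * r))))
          = 2 ^ (lam - 1) * r ^ (lam - 1) * Real.exp (-(z * r)) * (1 - lam * (r / 2)) := by
        rw [hrr]; ring
      rw [hfac]
      by_cases hr2 : r ≤ 2
      · have hr3 : r ∈ Ioc (0 : ℝ) 2 := ⟨hr, hr2⟩
        rw [indicator_of_mem hr3]
        have hb : 1 - lam * (r / 2) ≤ (1 - r / 2) ^ (lam - 1) := by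
          rcases hr2.eq_or_lt with rfl | hlt
          · have : (0 : ℝ) ≤ (1 - 2 / 2) ^ (lam - 1) := Real.rpow_nonneg (by norm_num) _
            linarith
          · have h1 := one_add_mul_self_le_rpow_one_add (s := -(r / 2)) (by linarith) hlam
            have h2 : (1 - r / 2) ^ lam ≤ (1 - r / 2) ^ (lam - 1) :=
              Real.rpow_le_rpow_of_exponent_ge (by linarith) (by linarith) (by linarith)
            rw [← sub_eq_add_neg] at h1
            linarith
        have h2 : (r * (2 - r)) ^ (lam - 1)
            = 2 ^ (lam - 1) * r ^ (lam - 1) * (1 - r / 2) ^ (lam - 1) := by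
          rw [← Real.mul_rpow zero_le_two hr.le, ← Real.mul_rpow (by positivity) (by linarith)]
          congr 1; ring
        rw [h2]
        calc _ ≤ 2 ^ (lam - 1) * r ^ (lam - 1) * Real.exp (-(z * r)) * (1 - r / 2) ^ (lam - 1) := by
              gcongr
          _ = _ := by ring
      · have hr3 : r ∉ Ioc (0 : ℝ) 2 := fun h => hr2 h.2
        rw [indicator_of_notMem hr3]
        refine mul_nonpos_of_nonneg_of_nonpos (by positivity) ?_
        nlinarith [not_le.1 hr2]
    · have hr1 : r ∉ Ioi (0 : ℝ) := hr
      have hr3 : r ∉ Ioc (0 : ℝ) 2 := fun h => hr h.1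
      rw [indicator_of_notMem hr1, indicator_of_notMem hr3]
  have hez := Real.exp_pos z
  constructor
  · have := mul_le_mul_of_nonneg_left hup hez.le
    rw [← heq] at this
    refine le_of_mul_le_mul_left ?_ hG
    calc _ = √Real.pi * Real.Gamma lam * besselClifford (lam - 1 / 2) (z ^ 2 / 4) := by ring
      _ ≤ _ := this
      _ = _ := by ring
  · have := mul_le_mul_of_nonneg_left hlow hez.le
    rw [← heq] at this
    refine le_of_mul_le_mul_left ?_ hG
    calc _ = Real.exp z * (2 ^ (lam - 1) * (Real.Gamma lam * z ^ (-lam)) * (1 - lam ^ 2 / (2 * z))) := by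
          ring
      _ ≤ _ := this
      _ = _ := by ring

/-! ### Comparison with the Gauss–Weierstrass kernel -/

/-- The Gauss–Weierstrass kernel. -/
def gaussKernel (t r : ℝ) : ℝ := (√(4 * Real.pi * t))⁻¹ * Real.exp (-r ^ 2 / (4 * t))

lemma gaussKernel_nonneg (t r : ℝ) : 0 ≤ gaussKernel t r := by unfold gaussKernel; positivity

lemma besselHeatKernel_eq {lam t x y : ℝ} (ht : 0 < t) (hx : 0 < x) (hy : 0 < y) :
    besselHeatKernel lam t x y = √(x * y) / (2 * t) * ((x * y / (4 * t)) ^ (lam - 1 / 2) *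
      besselClifford (lam - 1 / 2) ((x * y / (4 * t)) ^ 2)) * Real.exp (-(x ^ 2 + y ^ 2) / (4 * t)) := by
  have e1 : x * y / (2 * t) / 2 = x * y / (4 * t) := by field_simp; norm_num
  have e2 : (x * y / (2 * t)) ^ 2 / 4 = (x * y / (4 * t)) ^ 2 := by field_simp; norm_num
  rw [besselHeatKernel, besselI_eq (by positivity), e1, e2]

lemma besselHeatKernel_nonneg {lam t x y : ℝ} (hlam : 1 ≤ lam) (ht : 0 < t) (hx : 0 < x)
    (hy : 0 < y) : 0 ≤ besselHeatKernel lam t x y := by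
  rw [besselHeatKernel_eq ht hx hy]
  have := besselClifford_nonneg (ν := lam - 1 / 2) (by linarith)
    (sq_nonneg (x * y / (4 * t)))
  positivity

/-- The Bessel heat kernel compared with the Gauss–Weierstrass kernel. -/
lemma besselHeatKernel_bounds {lam t x y : ℝ} (hlam : 1 ≤ lam) (ht : 0 < t) (hx : 0 < x)
    (hy : 0 < y) :
    besselHeatKernel lam t x y ≤ gaussKernel t (x - y) ∧
    gaussKernel t (x - y) * (1 - lam ^ 2 * t / (x * y)) ≤ besselHeatKernel lam t x y := by
  set z := x * y / (2 * t) with hz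
  have hz0 : 0 < z := by positivity
  have e2 : z ^ 2 / 4 = (x * y / (4 * t)) ^ 2 := by rw [hz]; field_simp; norm_num
  have e3 : x * y / (4 * t) = z / 2 := by rw [hz]; field_simp; norm_num
  have e4 : lam ^ 2 * t / (x * y) = lam ^ 2 / (2 * z) := by rw [hz]; field_simp
  obtain ⟨h1, h2⟩ := besselClifford_asymp hlam hz0
  -- P is the factor common to both kernels: the Bessel kernel is P times √π C_{λ-1/2}(z²/4), and
  -- the Gauss kernel is P times the leading asymptotics of that quantity.
  set P := √(x * y) / (2 * t) * (z / 2) ^ (lam - 1 / 2) * Real.exp (-(x ^ 2 + y ^ 2) / (4 * t))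
    / √Real.pi with hP
  have hpi : √Real.pi ≠ 0 := by positivity
  have hP0 : 0 < P := by positivity
  have hW : besselHeatKernel lam t x y
      = P * (√Real.pi * besselClifford (lam - 1 / 2) (z ^ 2 / 4)) := by
    rw [besselHeatKernel_eq ht hx hy, ← e2, e3, hP]; field_simp
  have hg : gaussKernel t (x - y) = P * (Real.exp z * 2 ^ (lam - 1) * z ^ (-lam)) := by
    have a1 : Real.exp (-(x - y) ^ 2 / (4 * t))
        = Real.exp (-(x ^ 2 + y ^ 2) / (4 * t)) * Real.exp z := by
      rw [← Real.exp_add, hz]; congr 1; field_simp; ring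
    have a2 : (z / 2) ^ (lam - 1 / 2) * 2 ^ (lam - 1) * z ^ (-lam) = (√(2 * z))⁻¹ := by
      rw [Real.div_rpow hz0.le zero_le_two, div_eq_mul_inv, ← Real.rpow_neg zero_le_two]
      calc _ = (z ^ (lam - 1 / 2) * z ^ (-lam)) * (2 ^ (-(lam - 1 / 2)) * 2 ^ (lam - 1)) := by ring
        _ = z ^ (-(1 / 2) : ℝ) * 2 ^ (-(1 / 2) : ℝ) := by
          rw [← Real.rpow_add hz0, ← Real.rpow_add zero_lt_two]; congr 2 <;> ring
        _ = _ := by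
          rw [← Real.mul_rpow hz0.le zero_le_two, Real.sqrt_eq_rpow, ← Real.rpow_neg (by positivity),
            mul_comm]
    have a3 : (√(4 * Real.pi * t))⁻¹ = √(x * y) / (2 * t) * (√(2 * z))⁻¹ / √Real.pi := by
      have : 2 * z = x * y / t := by rw [hz]; field_simp
      rw [this, Real.sqrt_div (by positivity), Real.sqrt_mul (by positivity),
        Real.sqrt_mul (by positivity), show √(4 : ℝ) = 2 by
          rw [show (4 : ℝ) = 2 ^ 2 by norm_num]; exact Real.sqrt_sq zero_le_two]
      have h5 : √t * √t = t := Real.mul_self_sqrt ht.le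
      have h6 : 0 < √t := by positivity
      have h7 : 0 < √(x * y) := by positivity
      field_simp
      rw [sq, h5]
    rw [gaussKernel, a1, a3, ← a2, hP]; ring
  rw [hW, hg, e4]
  refine ⟨mul_le_mul_of_nonneg_left h1 hP0.le, ?_⟩
  rw [mul_assoc]
  exact mul_le_mul_of_nonneg_left h2 hP0.le

/-! ### Weber's second exponential integral -/

lemma sum_choose_mul_descFactorial_div_gamma (j : ℕ) : ∀ {ν : ℝ}, 0 ≤ ν → ∀ k : ℕ,
    ∑ m ∈ Finset.range (j + 1), (j.choose m : ℝ) * ((k.descFactorial m : ℝ) / Real.Gamma (m + ν + 1))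
      = Real.Gamma (j + k + ν + 1) / (Real.Gamma (j + ν + 1) * Real.Gamma (k + ν + 1)) := by
  -- A Chu–Vandermonde identity. Pascal's rule splits the sum in two; in the second half a factor k
  -- comes out of the falling factorial and leaves the case (k - 1, ν + 1), so both ν and k must
  -- vary in the induction.
  induction j with
  | zero =>
    intro ν hν k
    have h1 := (gamma_nat_add_pos hν k).ne'
    have h2 := (gamma_nat_add_pos hν 0).ne'
    simp only [Nat.cast_zero, zero_add] at h2
    simp only [zero_add, Finset.range_one, Finset.sum_singleton, Nat.choose_zero_right, Nat.cast_one,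
      Nat.descFactorial_zero, Nat.cast_zero, one_mul]
    field_simp
  | succ j ih =>
    intro ν hν k
    have h := Finset.sum_choose_succ_mul (R := ℝ)
      (fun m _ => (k.descFactorial m : ℝ) / Real.Gamma (m + ν + 1)) j
    rw [h, add_comm, ih hν k]
    have hstep : ∑ m ∈ Finset.range (j + 1), (j.choose m : ℝ) *
        ((k.descFactorial (m + 1) : ℝ) / Real.Gamma ((m + 1 : ℕ) + ν + 1))
        = k * (Real.Gamma (j + k + ν + 1) /
          (Real.Gamma (j + (ν + 1) + 1) * Real.Gamma (k + ν + 1))) := by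
      cases k with
      | zero => simp
      | succ k =>
        have := ih (ν := ν + 1) (by linarith) k
        have e1 : (j : ℝ) + (k + 1 : ℕ) + ν + 1 = j + k + (ν + 1) + 1 := by push_cast; ring
        have e2 : ((k + 1 : ℕ) : ℝ) + ν + 1 = k + (ν + 1) + 1 := by push_cast; ring
        rw [e1, e2, ← this, Finset.mul_sum]
        refine Finset.sum_congr rfl fun m _ => ?_
        have e3 : ((m + 1 : ℕ) : ℝ) + ν + 1 = m + (ν + 1) + 1 := by push_cast; ring
        rw [e3, Nat.succ_descFactorial_succ]; push_cast; ring
    rw [hstep]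
    have hj : (j : ℝ) + ν + 1 ≠ 0 := by positivity
    have hjk : (j : ℝ) + k + ν + 1 ≠ 0 := by positivity
    have g1 : Real.Gamma (j + (ν + 1) + 1) = (j + ν + 1) * Real.Gamma (j + ν + 1) := by
      rw [← Real.Gamma_add_one hj]; ring_nf
    have g2 : Real.Gamma ((j + 1 : ℕ) + ν + 1) = (j + ν + 1) * Real.Gamma (j + ν + 1) := by
      rw [← g1]; push_cast; ring_nf
    have g3 : Real.Gamma ((j + 1 : ℕ) + k + ν + 1) = (j + k + ν + 1) * Real.Gamma (j + k + ν + 1) := by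
      rw [← Real.Gamma_add_one hjk]; push_cast; ring_nf
    have h1 := (gamma_nat_add_pos hν k).ne'
    have h2 := (gamma_nat_add_pos hν j).ne'
    rw [g1, g2, g3]
    field_simp
    ring

lemma summable_norm_cliffordCoeff_mul_pow {ν : ℝ} (hν : 0 ≤ ν) (w : ℝ) :
    Summable fun k : ℕ => ‖cliffordCoeff ν k * w ^ k‖ :=
  summable_norm_iff.2 (summable_cliffordCoeff_mul_pow hν w)

lemma besselClifford_mul_besselClifford {ν : ℝ} (hν : 0 ≤ ν) (a b : ℝ) :
    besselClifford ν a * besselClifford ν b = ∑' p : ℕ × ℕ,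
      cliffordCoeff ν p.1 * a ^ p.1 * (cliffordCoeff ν p.2 * b ^ p.2) :=
  tsum_mul_tsum_of_summable_norm (summable_norm_cliffordCoeff_mul_pow hν a)
    (summable_norm_cliffordCoeff_mul_pow hν b)

lemma hasSum_mul_of_real {ι κ : Type*} {f : ι → ℝ} {g : κ → ℝ} {s t : ℝ} (hf : HasSum f s)
    (hg : HasSum g t) : HasSum (fun p : ι × κ => f p.1 * g p.2) (s * t) :=
  hf.mul hg (summable_mul_of_summable_norm (summable_norm_iff.2 hf.summable)
    (summable_norm_iff.2 hg.summable))

lemma hasSum_pow_div_factorial (x : ℝ) :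
    HasSum (fun n : ℕ => x ^ n / (n.factorial : ℝ)) (Real.exp x) := by
  rw [Real.exp_eq_exp_ℝ]
  exact NormedSpace.expSeries_div_hasSum_exp x

/-- Regrouping of a triple series along `(m, p, q) ↦ (m + p, m + q)`. -/
lemma hasSum_diagonal_shift {T : ℕ × (ℕ × ℕ) → ℝ} {S : ℝ} (hT : HasSum T S) :
    HasSum (fun jk : ℕ × ℕ => ∑ m ∈ Finset.range (jk.1 + 1),
      if m ≤ jk.1 ∧ m ≤ jk.2 then T (m, (jk.1 - m, jk.2 - m)) else 0) S := by
  obtain ⟨g, hg⟩ : ∃ g : ℕ × (ℕ × ℕ) → ℝ, ∀ m j k, g (m, (j, k)) =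
      if m ≤ j ∧ m ≤ k then T (m, (j - m, k - m)) else 0 :=
    ⟨fun p => if p.1 ≤ p.2.1 ∧ p.1 ≤ p.2.2 then T (p.1, (p.2.1 - p.1, p.2.2 - p.1)) else 0,
      fun _ _ _ => rfl⟩
  obtain ⟨i, hi⟩ : ∃ i : ℕ × (ℕ × ℕ) → ℕ × (ℕ × ℕ), ∀ m p q, i (m, (p, q)) = (m, (m + p, m + q)) :=
    ⟨fun p => (p.1, (p.1 + p.2.1, p.1 + p.2.2)), fun _ _ _ => rfl⟩
  have hinj : Function.Injective i := by
    rintro ⟨m, p, q⟩ ⟨m', p', q'⟩ h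
    simp only [hi, Prod.mk.injEq] at h ⊢
    omega
  have hgi : g ∘ i = T := by
    funext ⟨m, p, q⟩
    simp [hg, hi]
  have hG : HasSum g S := by
    refine (hinj.hasSum_iff ?_).1 (hgi ▸ hT)
    -- Off the range of `i` the function `g` vanishes, so extending the sum to all triples costs
    -- nothing.
    rintro ⟨m, j, k⟩ hx
    rw [hg, if_neg]
    rintro ⟨h1, h2⟩
    refine hx ⟨(m, (j - m, k - m)), ?_⟩
    rw [hi, Nat.add_sub_of_le h1, Nat.add_sub_of_le h2]
  have hG' : HasSum (fun p : (ℕ × ℕ) × ℕ => g (p.2, p.1)) S :=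
    (Equiv.prodComm (ℕ × ℕ) ℕ).hasSum_iff.2 hG
  simp only [← hg]
  refine HasSum.prod_fiberwise hG' fun ⟨j, k⟩ => ?_
  refine hasSum_sum_of_ne_finset_zero fun m hm => ?_
  rw [hg, if_neg]
  rintro ⟨h1, -⟩
  exact hm (Finset.mem_range.2 (Nat.lt_succ_of_le h1))

/-- Generating function behind Weber's second exponential integral. -/
lemma hasSum_weber {ν : ℝ} (hν : 0 ≤ ν) (a b : ℝ) :
    HasSum (fun p : ℕ × ℕ => cliffordCoeff ν p.1 * cliffordCoeff ν p.2 *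
      Real.Gamma (p.1 + p.2 + ν + 1) * (a ^ p.1 * b ^ p.2))
      (besselClifford ν (a * b) * (Real.exp a * Real.exp b)) := by
  have hT := hasSum_diagonal_shift (hasSum_mul_of_real
    (summable_cliffordCoeff_mul_pow hν (a * b)).hasSum
    (hasSum_mul_of_real (hasSum_pow_div_factorial a) (hasSum_pow_div_factorial b)))
  -- The coefficient of a^j b^k in the triple series for C_ν(ab) e^a e^b is a finite sum over m,
  -- evaluated by `sum_choose_mul_descFactorial_div_gamma`.
  refine hT.congr_fun ?_
  rintro ⟨j, k⟩
  dsimp only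
  have hj := (gamma_nat_add_pos hν j).ne'
  have hk := (gamma_nat_add_pos hν k).ne'
  have hj' : (j.factorial : ℝ) ≠ 0 := by positivity
  have hk' : (k.factorial : ℝ) ≠ 0 := by positivity
  have : cliffordCoeff ν j * cliffordCoeff ν k * Real.Gamma (j + k + ν + 1) * (a ^ j * b ^ k)
    = a ^ j * b ^ k / (j.factorial * k.factorial) * (Real.Gamma (j + k + ν + 1) /
      (Real.Gamma (j + ν + 1) * Real.Gamma (k + ν + 1))) := by
    unfold cliffordCoeff; field_simp
  rw [this, ← sum_choose_mul_descFactorial_div_gamma j hν k, Finset.mul_sum]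
  refine Finset.sum_congr rfl fun m hm => ?_
  have hmj : m ≤ j := Nat.lt_succ_iff.1 (Finset.mem_range.1 hm)
  by_cases hmk : m ≤ k
  · rw [if_pos ⟨hmj, hmk⟩]
    have c1 : (j.factorial : ℝ) = j.choose m * m.factorial * (j - m).factorial := by
      exact_mod_cast (Nat.choose_mul_factorial_mul_factorial hmj).symm
    have c2 : (k.factorial : ℝ) = (k - m).factorial * k.descFactorial m := by
      exact_mod_cast (Nat.factorial_mul_descFactorial hmk).symm
    have c3 : ((k.descFactorial m : ℕ) : ℝ) ≠ 0 := by
      rw [c2] at hk'; exact right_ne_zero_of_mul hk'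
    have c4 : ((j.choose m : ℕ) : ℝ) ≠ 0 := by
      rw [c1, mul_assoc] at hj'; exact left_ne_zero_of_mul hj'
    have c5 : ((k - m).factorial : ℝ) ≠ 0 := by positivity
    have c6 : ((j - m).factorial : ℝ) ≠ 0 := by positivity
    have c7 : (m.factorial : ℝ) ≠ 0 := by positivity
    have hm' := (gamma_nat_add_pos hν m).ne'
    have p1 : a ^ j = a ^ m * a ^ (j - m) := by rw [← pow_add]; congr 1; omega
    have p2 : b ^ k = b ^ m * b ^ (k - m) := by rw [← pow_add]; congr 1; omega
    rw [c1, c2, p1, p2, cliffordCoeff, mul_pow]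
    field_simp
  · rw [if_neg (fun h => hmk h.2), Nat.descFactorial_of_lt (not_le.1 hmk)]; simp

/-- The kernel `√s J_{lam-1/2}(s)` of the Hankel transform. -/
def hankelKernel (lam s : ℝ) : ℝ := √s * besselJ (lam - 1 / 2) s

lemma hankelKernel_eq {lam s : ℝ} (hs : 0 < s) : hankelKernel lam s
    = 2 ^ (-(lam - 1 / 2)) * s ^ lam * besselClifford (lam - 1 / 2) (-(s ^ 2 / 4)) := by
  have e : s ^ lam = s ^ (1 / 2 : ℝ) * s ^ (lam - 1 / 2) := by rw [← Real.rpow_add hs]; ring_nf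
  rw [hankelKernel, besselJ_eq hs, Real.sqrt_eq_rpow, Real.div_rpow hs.le zero_le_two,
    Real.rpow_neg zero_le_two, e]
  ring

lemma integral_rpow_mul_exp_neg_mul_sq_Ioi {q t : ℝ} (hq : -1 < q) (ht : 0 < t) :
    ∫ y in Ioi (0 : ℝ), y ^ q * Real.exp (-t * y ^ 2)
      = t ^ (-(q + 1) / 2) * (1 / 2) * Real.Gamma ((q + 1) / 2) := by
  have := integral_rpow_mul_exp_neg_mul_rpow (p := 2) (q := q) (b := t) two_pos hq ht
  simpa only [Real.rpow_two] using this

/-- Weber's second exponential integral, for Bessel–Clifford functions. -/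
lemma integral_weber {ν t : ℝ} (hν : 0 ≤ ν) (ht : 0 < t) (x z : ℝ) :
    ∫ y in Ioi (0 : ℝ), y ^ (2 * ν + 1) * Real.exp (-t * y ^ 2) *
      (besselClifford ν (-((x * y) ^ 2 / 4)) * besselClifford ν (-((y * z) ^ 2 / 4)))
    = t ^ (-(ν + 1)) / 2 * besselClifford ν ((x * z / (4 * t)) ^ 2) *
      Real.exp (-(x ^ 2 + z ^ 2) / (4 * t)) := by
  set c : ℕ × ℕ → ℝ := fun p => cliffordCoeff ν p.1 * cliffordCoeff ν p.2 with hc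
  set F : ℕ × ℕ → ℝ → ℝ := fun p y => c p * ((-(x ^ 2 / 4)) ^ p.1 * (-(z ^ 2 / 4)) ^ p.2) *
    (y ^ (2 * (p.1 + p.2 : ℝ) + (2 * ν + 1)) * Real.exp (-t * y ^ 2)) with hF
  have hq : ∀ p : ℕ × ℕ, (-1 : ℝ) < 2 * (p.1 + p.2 : ℝ) + (2 * ν + 1) := fun p => by
    have : (0 : ℝ) ≤ 2 * (p.1 + p.2 : ℝ) + 2 * ν := by positivity
    linarith
  have hint : ∀ p, IntegrableOn (F p) (Ioi 0) := fun p =>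
    (integrableOn_rpow_mul_exp_neg_mul_sq ht (hq p)).const_mul _
  have hval : ∀ p : ℕ × ℕ, ∫ y in Ioi (0 : ℝ),
      y ^ (2 * (p.1 + p.2 : ℝ) + (2 * ν + 1)) * Real.exp (-t * y ^ 2)
      = t ^ (-(ν + 1)) / 2 * (Real.Gamma (p.1 + p.2 + ν + 1) * ((t⁻¹) ^ p.1 * (t⁻¹) ^ p.2)) := by
    intro p
    rw [integral_rpow_mul_exp_neg_mul_sq_Ioi (hq p) ht]
    have e1 : (2 * (p.1 + p.2 : ℝ) + (2 * ν + 1) + 1) / 2 = p.1 + p.2 + ν + 1 := by ring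
    have e2 : -(2 * (p.1 + p.2 : ℝ) + (2 * ν + 1) + 1) / 2
        = -(ν + 1) + -((p.1 + p.2 : ℕ) : ℝ) := by push_cast; ring
    rw [e1, e2, Real.rpow_add ht, Real.rpow_neg ht.le ((p.1 + p.2 : ℕ) : ℝ), Real.rpow_natCast,
      ← inv_pow, pow_add]
    ring
  -- Absolute values only flip the signs of the two arguments, so the summability required for
  -- Fubini is again `hasSum_weber`, at positive arguments.
  have hnorm : ∀ p, ∫ y in Ioi (0 : ℝ), ‖F p y‖ = t ^ (-(ν + 1)) / 2 *
      (c p * Real.Gamma (p.1 + p.2 + ν + 1) *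
        ((x ^ 2 / (4 * t)) ^ p.1 * (z ^ 2 / (4 * t)) ^ p.2)) := by
    intro p
    have h0 : 0 ≤ c p := mul_nonneg (cliffordCoeff_pos hν _).le (cliffordCoeff_pos hν _).le
    have : ∀ y ∈ Ioi (0 : ℝ), ‖F p y‖ = c p * ((x ^ 2 / 4) ^ p.1 * (z ^ 2 / 4) ^ p.2) *
        (y ^ (2 * (p.1 + p.2 : ℝ) + (2 * ν + 1)) * Real.exp (-t * y ^ 2)) := by
      intro y hy
      have hy0 : 0 < y := hy
      simp only [hF]
      rw [norm_mul, norm_mul (c p), norm_mul _ (_ ^ p.2), norm_pow, norm_pow, norm_neg, norm_neg,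
        Real.norm_of_nonneg h0, Real.norm_of_nonneg (by positivity : 0 ≤ x ^ 2 / 4),
        Real.norm_of_nonneg (by positivity : 0 ≤ z ^ 2 / 4), Real.norm_of_nonneg (by positivity)]
    rw [setIntegral_congr_fun measurableSet_Ioi this, integral_const_mul, hval]
    simp only [div_pow, mul_pow, inv_pow]
    field_simp
  have hsum : Summable fun p => ∫ y in Ioi (0 : ℝ), ‖F p y‖ := by
    simp only [hnorm]
    exact (hasSum_weber hν _ _).summable.mul_left _
  have key := hasSum_integral_of_summable_integral_norm hint hsum
  have hpt : ∀ y ∈ Ioi (0 : ℝ), ∑' p, F p y = y ^ (2 * ν + 1) * Real.exp (-t * y ^ 2) *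
      (besselClifford ν (-((x * y) ^ 2 / 4)) * besselClifford ν (-((y * z) ^ 2 / 4))) := by
    intro y hy
    have hy0 : 0 < y := hy
    rw [besselClifford_mul_besselClifford hν, ← tsum_mul_left]
    refine tsum_congr fun p => ?_
    have e : y ^ (2 * (p.1 + p.2 : ℝ) + (2 * ν + 1))
        = y ^ (2 * p.1) * y ^ (2 * p.2) * y ^ (2 * ν + 1) := by
      rw [Real.rpow_add hy0, ← pow_add, ← Real.rpow_natCast]; push_cast; ring_nf
    simp only [hF, hc]
    rw [e]
    have e1 : (-((x * y) ^ 2 / 4)) ^ p.1 = (-(x ^ 2 / 4)) ^ p.1 * y ^ (2 * p.1) := by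
      rw [pow_mul, ← mul_pow]; congr 1; ring
    have e2 : (-((y * z) ^ 2 / 4)) ^ p.2 = (-(z ^ 2 / 4)) ^ p.2 * y ^ (2 * p.2) := by
      rw [pow_mul, ← mul_pow]; congr 1; ring
    rw [e1, e2]; ring
  rw [setIntegral_congr_fun measurableSet_Ioi hpt] at key
  -- Both arguments are negative but their product is positive: the oscillating factors of J type
  -- become one growing factor of I type.
  have key2 : HasSum (fun p => ∫ y in Ioi (0 : ℝ), F p y) (t ^ (-(ν + 1)) / 2 *
      (besselClifford ν (-(x ^ 2 / (4 * t)) * -(z ^ 2 / (4 * t))) *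
        (Real.exp (-(x ^ 2 / (4 * t))) * Real.exp (-(z ^ 2 / (4 * t)))))) := by
    convert! (hasSum_weber hν (-(x ^ 2 / (4 * t))) (-(z ^ 2 / (4 * t)))).mul_left
      (t ^ (-(ν + 1)) / 2) using 2 with p
    simp only [hF]
    rw [integral_const_mul, hval]
    simp only [hc, neg_pow (x ^ 2 / 4), neg_pow (z ^ 2 / 4), neg_pow (x ^ 2 / (4 * t)),
      neg_pow (z ^ 2 / (4 * t)), div_pow, mul_pow, inv_pow]
    field_simp
  rw [key.unique key2, ← Real.exp_add, mul_assoc]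
  congr 2
  · congr 1; field_simp
  · congr 1; field_simp; ring

/-- The heat kernel as the kernel of the Hankel multiplier e^{-ty²}; this is what ties the semigroup
to the Hankel transform. -/
lemma integral_hankelKernel_mul {lam t x z : ℝ} (hlam : 1 ≤ lam) (ht : 0 < t) (hx : 0 < x)
    (hz : 0 < z) :
    ∫ y in Ioi (0 : ℝ), Real.exp (-t * y ^ 2) * (hankelKernel lam (x * y) * hankelKernel lam (y * z))
      = besselHeatKernel lam t x z := by
  have hν : 0 ≤ lam - 1 / 2 := by linarith
  have h := integral_weber hν ht x z
  have : ∀ y ∈ Ioi (0 : ℝ),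
      Real.exp (-t * y ^ 2) * (hankelKernel lam (x * y) * hankelKernel lam (y * z))
      = 2 ^ (-(lam - 1 / 2)) * 2 ^ (-(lam - 1 / 2)) * (x * z) ^ lam *
        (y ^ (2 * (lam - 1 / 2) + 1) * Real.exp (-t * y ^ 2) *
      (besselClifford (lam - 1 / 2) (-((x * y) ^ 2 / 4)) *
        besselClifford (lam - 1 / 2) (-((y * z) ^ 2 / 4)))) := by
    intro y hy
    have hy0 : 0 < y := hy
    have e : y ^ (2 * (lam - 1 / 2) + 1) = y ^ lam * y ^ lam := by
      rw [← Real.rpow_add hy0]; ring_nf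
    rw [hankelKernel_eq (by positivity), hankelKernel_eq (by positivity),
      Real.mul_rpow hx.le hy0.le, Real.mul_rpow hy0.le hz.le, Real.mul_rpow hx.le hz.le, e]
    ring
  rw [setIntegral_congr_fun measurableSet_Ioi this, integral_const_mul, h,
    besselHeatKernel_eq ht hx hz]
  have hxz : 0 < x * z := by positivity
  have e1 : √(x * z) / (2 * t) * (x * z / (4 * t)) ^ (lam - 1 / 2)
      = 2 ^ (-(lam - 1 / 2)) * 2 ^ (-(lam - 1 / 2)) * (x * z) ^ lam
        * (t ^ (-(lam - 1 / 2 + 1)) / 2) := by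
    have e : (x * z) ^ lam = √(x * z) * (x * z) ^ (lam - 1 / 2) := by
      rw [Real.sqrt_eq_rpow, ← Real.rpow_add hxz]; ring_nf
    have e4 : (4 : ℝ) * t = 2 * 2 * t := by ring
    rw [e, Real.div_rpow hxz.le (by positivity), e4, Real.mul_rpow (by norm_num) ht.le,
      Real.mul_rpow zero_le_two zero_le_two, Real.rpow_neg zero_le_two, Real.rpow_neg ht.le,
      Real.rpow_add_one ht.ne']
    field_simp
  rw [← mul_assoc (√(x * z) / (2 * t)), e1]
  ring

/-- A crude bound without the decay of J at infinity; it suffices because it is only paired with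
Gaussians or rapidly decaying functions. -/
lemma abs_hankelKernel_le {lam s : ℝ} (hlam : 1 ≤ lam) (hs : 0 < s) : |hankelKernel lam s|
    ≤ 2 ^ (-(lam - 1 / 2)) * besselClifford (lam - 1 / 2) 0 * s ^ lam := by
  have hν : 0 ≤ lam - 1 / 2 := by linarith
  rw [hankelKernel_eq hs, abs_mul, abs_of_nonneg (by positivity)]
  have := abs_besselClifford_neg_le hν (w := s ^ 2 / 4) (by positivity)
  calc _ ≤ 2 ^ (-(lam - 1 / 2)) * s ^ lam * besselClifford (lam - 1 / 2) 0 := by gcongr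
    _ = _ := by ring

/-! ### Rapid decay and the operator (1/x) d/dx -/

/-- Decay at infinity faster than every power, for functions on `(0,∞)`. -/
def RapidDecay (f : ℝ → ℝ) : Prop :=
  ∀ s : ℝ, ∃ C : ℝ, 0 ≤ C ∧ ∀ x : ℝ, 0 < x → |f x| ≤ C * (1 + x) ^ (-s)

lemma rapidDecay_of_nat {f : ℝ → ℝ}
    (h : ∀ m : ℕ, ∃ C : ℝ, ∀ x : ℝ, 0 < x → (1 + x) ^ m * |f x| ≤ C) : RapidDecay f := by
  intro s
  obtain ⟨m, hm⟩ := exists_nat_ge s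
  obtain ⟨C, hC⟩ := h m
  -- Nonnegativity of C is read off from the bound at x = 1.
  refine ⟨C, (by positivity : (0 : ℝ) ≤ (1 + 1) ^ m * |f 1|).trans (hC 1 one_pos), fun x hx => ?_⟩
  have h1 : 0 < 1 + x := by linarith
  have h2 : (1 + x) ^ s ≤ (1 + x) ^ m := by
    rw [← Real.rpow_natCast]; exact Real.rpow_le_rpow_of_exponent_le (by linarith) hm
  rw [Real.rpow_neg h1.le, ← div_eq_mul_inv, le_div_iff₀ (by positivity), mul_comm]
  exact (mul_le_mul_of_nonneg_right h2 (abs_nonneg _)).trans (hC x hx)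

lemma RapidDecay.of_le_mul {f g : ℝ → ℝ} (hf : RapidDecay f) {K a : ℝ} (hK : 0 ≤ K)
    (h : ∀ x : ℝ, 0 < x → |g x| ≤ K * (1 + x) ^ a * |f x|) : RapidDecay g := by
  intro s
  obtain ⟨C, hC0, hC⟩ := hf (s + a)
  refine ⟨K * C, by positivity, fun x hx => (h x hx).trans ?_⟩
  have h1 : 0 < 1 + x := by linarith
  calc K * (1 + x) ^ a * |f x| ≤ K * (1 + x) ^ a * (C * (1 + x) ^ (-(s + a))) := by
        gcongr; exact hC x hx
    _ = K * C * ((1 + x) ^ a * (1 + x) ^ (-(s + a))) := by ring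
    _ = _ := by rw [← Real.rpow_add h1]; ring_nf

lemma RapidDecay.add {f g : ℝ → ℝ} (hf : RapidDecay f) (hg : RapidDecay g) :
    RapidDecay fun x => f x + g x := by
  intro s
  obtain ⟨C, hC0, hC⟩ := hf s
  obtain ⟨D, hD0, hD⟩ := hg s
  refine ⟨C + D, by positivity, fun x hx => (abs_add_le _ _).trans ?_⟩
  rw [add_mul]; exact add_le_add (hC x hx) (hD x hx)

lemma RapidDecay.rpow_mul {f : ℝ → ℝ} (hf : RapidDecay f) {a : ℝ} (ha : 0 ≤ a) :
    RapidDecay fun x => x ^ a * f x := by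
  refine hf.of_le_mul (K := 1) (a := a) zero_le_one fun x hx => ?_
  rw [abs_mul, abs_of_nonneg (by positivity), one_mul]
  gcongr; linarith

lemma RapidDecay.const_mul {f : ℝ → ℝ} (hf : RapidDecay f) (c : ℝ) :
    RapidDecay fun x => c * f x := by
  refine hf.of_le_mul (K := |c|) (a := 0) (abs_nonneg c) fun x hx => ?_
  rw [abs_mul, Real.rpow_zero, mul_one]

lemma RapidDecay.abs {f : ℝ → ℝ} (hf : RapidDecay f) : RapidDecay fun x => |f x| := by
  refine hf.of_le_mul (K := 1) (a := 0) zero_le_one fun x hx => ?_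
  simp

lemma integrableOn_one_add_rpow {s : ℝ} (hs : 1 < s) :
    IntegrableOn (fun x : ℝ => (1 + x) ^ (-s)) (Ioi 0) := by
  have := integrableOn_add_rpow_Ioi_of_lt (a := -s) (c := 0) (m := 1) (by linarith) (by linarith)
  simpa only [add_comm] using this

lemma RapidDecay.integrableOn {f : ℝ → ℝ} (hf : RapidDecay f) (hc : ContinuousOn f (Ioi 0)) :
    IntegrableOn f (Ioi 0) := by
  obtain ⟨C, -, hC⟩ := hf 2
  refine Integrable.mono' ((integrableOn_one_add_rpow one_lt_two).const_mul C)
    (hc.aestronglyMeasurable measurableSet_Ioi) ?_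
  exact (ae_restrict_iff' measurableSet_Ioi).2 (Eventually.of_forall fun x hx => hC x hx)

lemma RapidDecay.integrableOn_rpow_mul {f : ℝ → ℝ} (hf : RapidDecay f)
    (hc : ContinuousOn f (Ioi 0)) {a : ℝ} (ha : 0 ≤ a) :
    IntegrableOn (fun x => x ^ a * f x) (Ioi 0) :=
  (hf.rpow_mul ha).integrableOn
    ((Real.continuous_rpow_const ha).continuousOn.mul hc)

/-- Smooth functions on `(0,∞)` all of whose `(1/x)d/dx`-derivatives decay rapidly. -/
structure IsRapidEven (p : ℝ → ℝ) : Prop where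
  smooth : ContDiffOn ℝ (⊤ : ℕ∞) p (Ioi 0)
  decay : ∀ m k : ℕ, ∃ C : ℝ, ∀ x : ℝ, 0 < x → (1 + x) ^ m * |(invDeriv^[k] p) x| ≤ C

lemma contDiffOn_invDeriv {p : ℝ → ℝ} (hp : ContDiffOn ℝ (⊤ : ℕ∞) p (Ioi 0)) :
    ContDiffOn ℝ (⊤ : ℕ∞) (invDeriv p) (Ioi 0) :=
  (contDiffOn_id.inv fun _ hx => ne_of_gt hx).mul (hp.deriv_of_isOpen isOpen_Ioi (by simp))

lemma hasDerivAt_of_invDeriv {p : ℝ → ℝ} (hp : ContDiffOn ℝ (⊤ : ℕ∞) p (Ioi 0)) {x : ℝ}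
    (hx : 0 < x) : HasDerivAt p (x * invDeriv p x) x := by
  have h := ((hp.differentiableOn (by simp)).differentiableAt (Ioi_mem_nhds hx)).hasDerivAt
  rwa [invDeriv, mul_inv_cancel_left₀ hx.ne']

lemma invDeriv_congr {p q : ℝ → ℝ} (h : EqOn p q (Ioi 0)) :
    EqOn (invDeriv p) (invDeriv q) (Ioi 0) := by
  intro x hx
  rw [invDeriv, invDeriv, (h.eventuallyEq_of_mem (Ioi_mem_nhds hx)).deriv_eq]

lemma iterate_invDeriv_congr {p q : ℝ → ℝ} (h : EqOn p q (Ioi 0)) (k : ℕ) :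
    EqOn (invDeriv^[k] p) (invDeriv^[k] q) (Ioi 0) := by
  induction k generalizing p q with
  | zero => exact h
  | succ k ih => exact ih (invDeriv_congr h)

lemma iterate_invDeriv_add {p q : ℝ → ℝ} (hp : ContDiffOn ℝ (⊤ : ℕ∞) p (Ioi 0))
    (hq : ContDiffOn ℝ (⊤ : ℕ∞) q (Ioi 0)) (k : ℕ) : EqOn (invDeriv^[k] fun x => p x + q x)
      (fun x => (invDeriv^[k] p) x + (invDeriv^[k] q) x) (Ioi 0) := by
  induction k generalizing p q with
  | zero => exact fun _ _ => rfl
  | succ k ih =>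
    refine (iterate_invDeriv_congr (q := fun x => invDeriv p x + invDeriv q x) ?_ k).trans
      (ih (contDiffOn_invDeriv hp) (contDiffOn_invDeriv hq))
    intro x hx
    have h := (hasDerivAt_of_invDeriv hp hx).add (hasDerivAt_of_invDeriv hq hx)
    rw [invDeriv, show deriv (fun x => p x + q x) x = _ from h.deriv, ← mul_add,
      inv_mul_cancel_left₀ (ne_of_gt hx)]

lemma iterate_invDeriv_const_mul {p : ℝ → ℝ} (c : ℝ) (k : ℕ) :
    (invDeriv^[k] fun x => c * p x) = fun x => c * (invDeriv^[k] p) x := by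
  induction k generalizing p with
  | zero => rfl
  | succ k ih =>
    rw [Function.iterate_succ_apply, Function.iterate_succ_apply, ← ih]
    congr 1
    funext x
    rw [invDeriv, invDeriv, deriv_const_mul_field]; ring

namespace IsRapidEven

variable {p q : ℝ → ℝ}

lemma invDeriv (hp : IsRapidEven p) : IsRapidEven (invDeriv p) :=
  ⟨contDiffOn_invDeriv hp.smooth, fun m k => hp.decay m (k + 1)⟩

lemma congr (hp : IsRapidEven p) (h : EqOn q p (Ioi 0)) : IsRapidEven q := by
  refine ⟨hp.smooth.congr h, fun m k => ?_⟩
  obtain ⟨C, hC⟩ := hp.decay m k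
  exact ⟨C, fun x hx => by rw [iterate_invDeriv_congr h k hx]; exact hC x hx⟩

lemma add (hp : IsRapidEven p) (hq : IsRapidEven q) : IsRapidEven fun x => p x + q x := by
  refine ⟨hp.smooth.add hq.smooth, fun m k => ?_⟩
  obtain ⟨C, hC⟩ := hp.decay m k
  obtain ⟨D, hD⟩ := hq.decay m k
  refine ⟨C + D, fun x hx => ?_⟩
  rw [iterate_invDeriv_add hp.smooth hq.smooth k hx]
  have h1 : 0 < (1 + x) ^ m := by positivity
  calc _ ≤ (1 + x) ^ m * (|(_root_.invDeriv^[k] p) x| + |(_root_.invDeriv^[k] q) x|) := by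
        gcongr; exact abs_add_le _ _
    _ ≤ _ := by rw [mul_add]; exact add_le_add (hC x hx) (hD x hx)

lemma const_mul (hp : IsRapidEven p) (c : ℝ) : IsRapidEven fun x => c * p x := by
  refine ⟨contDiffOn_const.mul hp.smooth, fun m k => ?_⟩
  obtain ⟨C, hC⟩ := hp.decay m k
  refine ⟨|c| * C, fun x hx => ?_⟩
  rw [iterate_invDeriv_const_mul, abs_mul, mul_left_comm]
  exact mul_le_mul_of_nonneg_left (hC x hx) (abs_nonneg c)

/-- With D = (1/x) d/dx one has D(x² p) = 2p + x² Dp, so the seminorms of x² p follow by induction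
on the number of derivatives, with p varying. -/
lemma sq_mul (hp : IsRapidEven p) : IsRapidEven fun x => x ^ 2 * p x := by
  refine ⟨(contDiffOn_id.pow 2).mul hp.smooth, fun m k => ?_⟩
  induction k generalizing p with
  | zero =>
    obtain ⟨C, hC⟩ := hp.decay (m + 2) 0
    refine ⟨C, fun x hx => le_trans ?_ (hC x hx)⟩
    simp only [Function.iterate_zero, id_eq]
    rw [abs_mul, abs_of_nonneg (sq_nonneg x), ← mul_assoc, pow_add]
    gcongr; linarith
  | succ k ih =>
    obtain ⟨C, hC⟩ := (hp.const_mul 2).decay m k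
    obtain ⟨D, hD⟩ := ih hp.invDeriv
    have hs : ContDiffOn ℝ (⊤ : ℕ∞) (fun x => x ^ 2 * _root_.invDeriv p x) (Ioi 0) :=
      (contDiffOn_id.pow 2).mul hp.invDeriv.smooth
    refine ⟨C + D, fun x hx => ?_⟩
    have e : EqOn (_root_.invDeriv fun x => x ^ 2 * p x)
        (fun x => 2 * p x + x ^ 2 * _root_.invDeriv p x) (Ioi 0) := by
      intro y hy
      have h := (hasDerivAt_pow 2 y).mul (hasDerivAt_of_invDeriv hp.smooth hy)
      have hy0 : y ≠ 0 := ne_of_gt hy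
      rw [_root_.invDeriv, show deriv (fun x => x ^ 2 * p x) y = _ from h.deriv]
      simp only [Nat.cast_ofNat, Nat.add_one_sub_one, pow_one]
      field_simp
    rw [Function.iterate_succ_apply, iterate_invDeriv_congr e k hx,
      iterate_invDeriv_add (hp.const_mul 2).smooth hs k hx]
    have h1 : 0 < (1 + x) ^ m := by positivity
    calc _ ≤ (1 + x) ^ m * (|(_root_.invDeriv^[k] fun x => 2 * p x) x|
          + |(_root_.invDeriv^[k] fun x => x ^ 2 * _root_.invDeriv p x) x|) := by
          gcongr; exact abs_add_le _ _
      _ ≤ _ := by rw [mul_add]; exact add_le_add (hC x hx) (hD x hx)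

lemma rapidDecay (hp : IsRapidEven p) : RapidDecay p := rapidDecay_of_nat fun m => hp.decay m 0

lemma continuousOn (hp : IsRapidEven p) : ContinuousOn p (Ioi 0) := hp.smooth.continuousOn

end IsRapidEven

/-- The operator `-(p'' + (2 lam / x) p')`, conjugate to the Bessel operator by `x^lam`. -/
def conjBesselOp (lam : ℝ) (p : ℝ → ℝ) (x : ℝ) : ℝ :=
  -(2 * lam + 1) * invDeriv p x + -1 * (x ^ 2 * invDeriv (invDeriv p) x)

/-- In terms of D = (1/x) d/dx the operator is -(2λ+1) D - x² D², and the class is stable under D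
and under multiplication by x². -/
lemma IsRapidEven.conjBesselOp {p : ℝ → ℝ} (hp : IsRapidEven p) (lam : ℝ) :
    IsRapidEven (conjBesselOp lam p) :=
  (hp.invDeriv.const_mul _).add (hp.invDeriv.invDeriv.sq_mul.const_mul _)

/-! ### The Hankel transform of test functions -/

/-- The Hankel transform of `x^lam p`, up to normalization. -/
def cliffordTransform (lam : ℝ) (p : ℝ → ℝ) (a : ℝ) : ℝ :=
  ∫ y in Ioi (0 : ℝ), besselClifford (lam - 1 / 2) (-((a * y) ^ 2 / 4)) * (y ^ (2 * lam) * p y)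

section CliffordTransform

variable {lam : ℝ} {p : ℝ → ℝ}

lemma continuous_besselClifford_neg_sq {ν : ℝ} (hν : 0 ≤ ν) (a : ℝ) :
    Continuous fun y : ℝ => besselClifford ν (-((a * y) ^ 2 / 4)) :=
  (continuous_besselClifford hν).comp (by fun_prop)

lemma abs_besselClifford_neg_sq_le {ν : ℝ} (hν : 0 ≤ ν) (a y : ℝ) :
    |besselClifford ν (-((a * y) ^ 2 / 4))| ≤ besselClifford ν 0 :=
  abs_besselClifford_neg_le hν (by positivity)

lemma integrableOn_cliffordTransform (hlam : 1 ≤ lam) (hp : RapidDecay p)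
    (hc : ContinuousOn p (Ioi 0)) (a : ℝ) :
    IntegrableOn (fun y => besselClifford (lam - 1 / 2) (-((a * y) ^ 2 / 4)) * (y ^ (2 * lam) * p y))
      (Ioi 0) :=
  (hp.integrableOn_rpow_mul hc (by linarith)).bdd_mul (c := besselClifford (lam - 1 / 2) 0)
    (continuous_besselClifford_neg_sq (by linarith) a).aestronglyMeasurable
    (Eventually.of_forall fun y => abs_besselClifford_neg_sq_le (by linarith) a y)

lemma abs_cliffordTransform_le (hlam : 1 ≤ lam) (hp : RapidDecay p)
    (hc : ContinuousOn p (Ioi 0)) (a : ℝ) : |cliffordTransform lam p a|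
      ≤ besselClifford (lam - 1 / 2) 0 * ∫ y in Ioi (0 : ℝ), ‖y ^ (2 * lam) * p y‖ := by
  rw [cliffordTransform, ← integral_const_mul, ← Real.norm_eq_abs]
  refine norm_integral_le_of_norm_le
    ((hp.integrableOn_rpow_mul hc (by linarith)).norm.const_mul _) (Eventually.of_forall fun y => ?_)
  rw [norm_mul]
  exact mul_le_mul_of_nonneg_right (abs_besselClifford_neg_sq_le (by linarith) a y) (norm_nonneg _)

lemma continuous_cliffordTransform (hlam : 1 ≤ lam) (hp : RapidDecay p)
    (hc : ContinuousOn p (Ioi 0)) : Continuous (cliffordTransform lam p) := by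
  refine continuous_of_dominated
    (bound := fun y => besselClifford (lam - 1 / 2) 0 * ‖y ^ (2 * lam) * p y‖)
    (fun a => (integrableOn_cliffordTransform hlam hp hc a).aestronglyMeasurable)
    (fun a => Eventually.of_forall fun y => ?_)
    ((hp.integrableOn_rpow_mul hc (by linarith)).norm.const_mul _) (Eventually.of_forall fun y => ?_)
  · rw [norm_mul]
    exact mul_le_mul_of_nonneg_right (abs_besselClifford_neg_sq_le (by linarith) a y) (norm_nonneg _)
  · exact ((continuous_besselClifford (by linarith)).comp (by fun_prop)).mul continuous_const

/-- The transform diagonalizes the conjugated Bessel operator. -/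
lemma cliffordTransform_conjBesselOp (hlam : 1 ≤ lam) (hp : IsRapidEven p) (a : ℝ) :
    cliffordTransform lam (conjBesselOp lam p) a = a ^ 2 * cliffordTransform lam p a := by
  set ν := lam - 1 / 2 with hν
  have hν0 : 0 ≤ ν := by linarith
  set c : ℝ → ℝ := fun y => besselClifford ν (-((a * y) ^ 2 / 4)) with hc
  set c1 : ℝ → ℝ := fun y => besselClifford (ν + 1) (-((a * y) ^ 2 / 4)) with hc1
  -- y^{2λ+1} U is the weighted Wronskian y^{2λ} (c p' - c' p), since p' = y Dp with D = (1/y) d/dy,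
  -- and c' = -(a² y/2) c1. Its derivative is the difference of the two integrands, and it vanishes
  -- at 0 and at infinity.
  set U : ℝ → ℝ := fun y => c y * invDeriv p y + a ^ 2 / 2 * (c1 y * p y) with hU
  have hlp := hp.conjBesselOp lam
  have i1 := integrableOn_cliffordTransform hlam hlp.rapidDecay hlp.continuousOn a
  have i2 := integrableOn_cliffordTransform hlam hp.rapidDecay hp.continuousOn a
  have hUd : RapidDecay U := by
    refine RapidDecay.add ?_ (RapidDecay.const_mul ?_ _)
    · refine hp.invDeriv.rapidDecay.of_le_mul (K := besselClifford ν 0) (a := 0)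
        (besselClifford_nonneg hν0 le_rfl) fun x _ => ?_
      rw [abs_mul, Real.rpow_zero, mul_one]
      exact mul_le_mul_of_nonneg_right (abs_besselClifford_neg_sq_le hν0 a x) (abs_nonneg _)
    · refine hp.rapidDecay.of_le_mul (K := besselClifford (ν + 1) 0) (a := 0)
        (besselClifford_nonneg (by linarith) le_rfl) fun x _ => ?_
      rw [abs_mul, Real.rpow_zero, mul_one]
      exact mul_le_mul_of_nonneg_right (abs_besselClifford_neg_sq_le (by linarith) a x)
        (abs_nonneg _)
  have hder : ∀ y ∈ Ioi (0 : ℝ), HasDerivAt (fun y => y ^ (2 * lam + 1) * U y)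
      (a ^ 2 * (c y * (y ^ (2 * lam) * p y)) - c y * (y ^ (2 * lam) * conjBesselOp lam p y)) y := by
    intro y hy
    have hy0 : 0 < y := hy
    have d1 := hasDerivAt_besselClifford_neg_sq hν0 a y
    have d2 := hasDerivAt_besselClifford_neg_sq (ν := ν + 1) (by linarith) a y
    have d3 := hasDerivAt_of_invDeriv hp.smooth hy0
    have d4 := hasDerivAt_of_invDeriv hp.invDeriv.smooth hy0
    have d5 := Real.hasDerivAt_rpow_const (p := 2 * lam + 1) (Or.inl hy0.ne')
    have d := d5.mul ((d1.mul d4).add ((d2.mul d3).const_mul (a ^ 2 / 2)))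
    refine d.congr_deriv ?_
    have hr := besselClifford_recurrence hν0 (-((a * y) ^ 2 / 4))
    have e1 : y ^ (2 * lam + 1) = y ^ (2 * lam) * y := Real.rpow_add_one hy0.ne' _
    rw [add_sub_cancel_right, e1]
    simp only [hc, conjBesselOp]
    simp only [Pi.add_apply, Pi.mul_apply, hr]
    simp only [hν]
    ring
  have hcont : ContinuousWithinAt (fun y => y ^ (2 * lam + 1) * U y) (Ici 0) 0 := by
    obtain ⟨C, hC0, hC⟩ := hUd 0
    have h0 : (0 : ℝ) ^ (2 * lam + 1) * U 0 = 0 := by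
      simp [Real.zero_rpow (by linarith : 2 * lam + 1 ≠ 0)]
    rw [ContinuousWithinAt, h0]
    have hlim : Tendsto (fun y : ℝ => C * y ^ (2 * lam + 1)) (𝓝[Ici 0] 0) (𝓝 0) := by
      have : Continuous fun y : ℝ => C * y ^ (2 * lam + 1) :=
        continuous_const.mul (Real.continuous_rpow_const (by linarith))
      have h := (this.tendsto 0).mono_left (nhdsWithin_le_nhds (s := Ici 0))
      simpa [Real.zero_rpow (by linarith : 2 * lam + 1 ≠ 0)] using h
    refine squeeze_zero_norm' ?_ hlim
    filter_upwards [self_mem_nhdsWithin] with y hy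
    rcases (mem_Ici.1 hy).eq_or_lt with rfl | hy0
    · simp [Real.zero_rpow (by linarith : 2 * lam + 1 ≠ 0)]
    · have := hC y hy0
      rw [neg_zero, Real.rpow_zero, mul_one] at this
      rw [norm_mul, Real.norm_of_nonneg (by positivity), mul_comm]
      exact mul_le_mul_of_nonneg_right this (by positivity)
  have hlim : Tendsto (fun y => y ^ (2 * lam + 1) * U y) atTop (𝓝 0) := by
    obtain ⟨C, hC0, hC⟩ := hUd.rpow_mul (a := 2 * lam + 1) (by linarith) 1
    have h1 : Tendsto (fun y : ℝ => C * (1 + y) ^ (-1 : ℝ)) atTop (𝓝 0) := by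
      have := (tendsto_rpow_neg_atTop one_pos).comp (tendsto_atTop_add_const_left atTop (1 : ℝ)
        tendsto_id)
      simpa using this.const_mul C
    refine squeeze_zero_norm' ?_ h1
    filter_upwards [eventually_gt_atTop 0] with y hy
    exact hC y hy
  have hI := integral_Ioi_of_hasDerivAt_of_tendsto hcont hder ((i2.const_mul _).sub i1) hlim
  rw [integral_sub (i2.const_mul _) i1, integral_const_mul,
    Real.zero_rpow (by linarith : 2 * lam + 1 ≠ 0)] at hI
  rw [cliffordTransform, cliffordTransform]
  linarith

/-- Every factor a² can be traded for an application of `conjBesselOp`, which preserves the class,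
and the transform of a function of the class is bounded. -/
lemma rapidDecay_cliffordTransform (hlam : 1 ≤ lam) (hp : IsRapidEven p) :
    RapidDecay (cliffordTransform lam p) := by
  have hpow : ∀ n : ℕ, ∀ p, IsRapidEven p → ∃ C, ∀ a : ℝ,
      (a ^ 2) ^ n * |cliffordTransform lam p a| ≤ C := by
    intro n
    induction n with
    | zero =>
      intro p hp
      exact ⟨_, fun a => by
        rw [pow_zero, one_mul]; exact abs_cliffordTransform_le hlam hp.rapidDecay hp.continuousOn a⟩
    | succ n ih =>
      intro p hp
      obtain ⟨C, hC⟩ := ih _ (hp.conjBesselOp lam)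
      refine ⟨C, fun a => le_trans (le_of_eq ?_) (hC a)⟩
      rw [cliffordTransform_conjBesselOp hlam hp, abs_mul, abs_of_nonneg (sq_nonneg a)]; ring
  refine rapidDecay_of_nat fun m => ?_
  obtain ⟨C, hC⟩ := hpow m p hp
  obtain ⟨D, hD⟩ := hpow 0 p hp
  refine ⟨4 ^ m * (C + D), fun x hx => ?_⟩
  have h1 := hC x
  have h2 := hD x
  rw [pow_zero, one_mul] at h2
  have h3 : (1 + x) ^ m ≤ 4 ^ m * ((x ^ 2) ^ m + 1) := by
    rcases le_total x 1 with h | h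
    · calc (1 + x) ^ m ≤ 4 ^ m := by gcongr; linarith
        _ ≤ _ := by nlinarith [pow_pos (pow_pos hx 2) m, pow_pos (by norm_num : (0 : ℝ) < 4) m]
    · calc (1 + x) ^ m ≤ (4 * x ^ 2) ^ m := by gcongr; nlinarith
        _ = 4 ^ m * (x ^ 2) ^ m := mul_pow _ _ _
        _ ≤ _ := by gcongr; linarith
  calc _ ≤ 4 ^ m * ((x ^ 2) ^ m + 1) * |cliffordTransform lam p x| := by gcongr
    _ = 4 ^ m * ((x ^ 2) ^ m * |cliffordTransform lam p x| + |cliffordTransform lam p x|) := by ring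
    _ ≤ _ := by gcongr

end CliffordTransform

lemma IsBesselTest.isRapidEven {lam : ℝ} {φ : ℝ → ℝ} (h : IsBesselTest lam φ) :
    IsRapidEven fun y => y ^ (-lam) * φ y :=
  ⟨(contDiffOn_id.rpow_const_of_ne fun _ hx => ne_of_gt hx).mul h.smooth, h.decay⟩

lemma IsRapidEven.isBesselTest {p : ℝ → ℝ} (hp : IsRapidEven p) (lam : ℝ) :
    IsBesselTest lam fun y => y ^ lam * p y := by
  have e : EqOn (fun y => y ^ (-lam) * (y ^ lam * p y)) p (Ioi 0) := by
    intro y hy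
    have hy0 : 0 < y := hy
    simp only
    rw [← mul_assoc, ← Real.rpow_add hy0, neg_add_cancel, Real.rpow_zero, one_mul]
  exact ⟨(contDiffOn_id.rpow_const_of_ne fun _ hx => ne_of_gt hx).mul hp.smooth,
    (hp.congr e).decay⟩

lemma IsBesselTest.exists_rapidEven {lam : ℝ} {φ : ℝ → ℝ} (h : IsBesselTest lam φ) :
    ∃ p, IsRapidEven p ∧ ∀ y, 0 < y → φ y = y ^ lam * p y := by
  refine ⟨_, h.isRapidEven, fun y hy => ?_⟩
  rw [← mul_assoc, ← Real.rpow_add hy, add_neg_cancel, Real.rpow_zero, one_mul]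

lemma hankel_eq_cliffordTransform {lam : ℝ} {φ p : ℝ → ℝ}
    (h : ∀ y, 0 < y → φ y = y ^ lam * p y) {x : ℝ} (hx : 0 < x) :
    hankel lam φ x = 2 ^ (-(lam - 1 / 2)) * (x ^ lam * cliffordTransform lam p x) := by
  rw [hankel, cliffordTransform, ← integral_const_mul, ← integral_const_mul]
  refine setIntegral_congr_fun measurableSet_Ioi fun y hy => ?_
  have hy0 : 0 < y := hy
  have := hankelKernel_eq (lam := lam) (mul_pos hx hy0)
  rw [hankelKernel] at this
  have e : y ^ (2 * lam) = y ^ lam * y ^ lam := by rw [← Real.rpow_add hy0]; ring_nf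
  rw [this, h y hy0, Real.mul_rpow hx.le hy0.le, e]; ring

section Test

variable {lam : ℝ} {φ : ℝ → ℝ}

lemma IsBesselTest.rapidDecay (hlam : 0 ≤ lam) (h : IsBesselTest lam φ) : RapidDecay φ := by
  obtain ⟨p, hp, he⟩ := h.exists_rapidEven
  exact (hp.rapidDecay.rpow_mul hlam).of_le_mul (K := 1) (a := 0) zero_le_one
    fun x hx => by rw [he x hx]; simp

lemma IsBesselTest.continuousOn (h : IsBesselTest lam φ) : ContinuousOn φ (Ioi 0) :=
  h.smooth.continuousOn

lemma IsBesselTest.rapidDecay_hankel (hlam : 1 ≤ lam) (h : IsBesselTest lam φ) :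
    RapidDecay (hankel lam φ) := by
  obtain ⟨p, hp, he⟩ := h.exists_rapidEven
  refine (((rapidDecay_cliffordTransform hlam hp).rpow_mul (a := lam) (by linarith)).const_mul
    (2 ^ (-(lam - 1 / 2)))).of_le_mul (K := 1) (a := 0) zero_le_one fun x hx => ?_
  rw [hankel_eq_cliffordTransform he hx]; simp

lemma IsBesselTest.continuousOn_hankel (hlam : 1 ≤ lam) (h : IsBesselTest lam φ) :
    ContinuousOn (hankel lam φ) (Ioi 0) := by
  obtain ⟨p, hp, he⟩ := h.exists_rapidEven
  have : ContinuousOn (fun x => 2 ^ (-(lam - 1 / 2)) * (x ^ lam * cliffordTransform lam p x))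
      (Ioi 0) :=
    continuousOn_const.mul ((Real.continuous_rpow_const (by linarith)).continuousOn.mul
      (continuous_cliffordTransform hlam hp.rapidDecay hp.continuousOn).continuousOn)
  exact this.congr fun x hx => hankel_eq_cliffordTransform he hx

/-- The image of a test function under the Bessel operator, characterized on the Hankel side. -/
lemma IsBesselTest.exists_besselOp (hlam : 1 ≤ lam) (h : IsBesselTest lam φ) :
    ∃ ψ, IsBesselTest lam ψ ∧ ∀ y, 0 < y → hankel lam ψ y = y ^ 2 * hankel lam φ y := by
  obtain ⟨p, hp, he⟩ := h.exists_rapidEven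
  refine ⟨_, (hp.conjBesselOp lam).isBesselTest lam, fun y hy => ?_⟩
  rw [hankel_eq_cliffordTransform he hy, hankel_eq_cliffordTransform (fun _ _ => rfl) hy,
    cliffordTransform_conjBesselOp hlam hp]
  ring

/-- For φ = x^λ p the derivative is λ x^{λ-1} p + x^{λ+1} (p'/x), bounded at the origin because λ ≥
1. It serves to show that the semigroup tends to the identity. -/
lemma IsBesselTest.lipschitz (hlam : 1 ≤ lam) (h : IsBesselTest lam φ) :
    ∃ C, 0 ≤ C ∧ ∀ x y, 0 < x → 0 < y → |φ x - φ y| ≤ C * |x - y| := by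
  obtain ⟨p, hp, he⟩ := h.exists_rapidEven
  have hd : RapidDecay fun x => lam * (x ^ (lam - 1) * p x) + x ^ (lam + 1) * invDeriv p x :=
    ((hp.rapidDecay.rpow_mul (by linarith)).const_mul lam).add
      (hp.invDeriv.rapidDecay.rpow_mul (by linarith))
  obtain ⟨C, hC0, hC⟩ := hd 0
  refine ⟨C, hC0, fun x y hx hy => ?_⟩
  have hder : ∀ z ∈ Ioi (0 : ℝ), HasDerivWithinAt φ
      (lam * (z ^ (lam - 1) * p z) + z ^ (lam + 1) * invDeriv p z) (Ioi 0) z := by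
    intro z hz
    have hz0 : 0 < z := hz
    have d := (Real.hasDerivAt_rpow_const (p := lam) (Or.inl hz0.ne')).mul
      (hasDerivAt_of_invDeriv hp.smooth hz0)
    have d' : HasDerivAt φ _ z := d.congr_of_eventuallyEq
      (Filter.eventually_of_mem (Ioi_mem_nhds hz0) fun w hw => he w hw)
    refine (d'.congr_deriv ?_).hasDerivWithinAt
    rw [Real.rpow_add_one hz0.ne']; ring
  have := (convex_Ioi (0 : ℝ)).norm_image_sub_le_of_norm_hasDerivWithin_le (C := C) hder
    (fun z hz => by simpa using hC z hz) hy hx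
  simpa using this

end Test

/-! ### Gaussian moments, tails and Peetre inequalities -/

/-- Absolute moments of the standard heat kernel. -/
def gaussMoment (s : ℝ) : ℝ := Real.Gamma ((s + 1) / 2) * 4 ^ (s / 2) / √Real.pi

lemma gaussMoment_pos {s : ℝ} (hs : 0 ≤ s) : 0 < gaussMoment s := by
  have := Real.Gamma_pos_of_pos (show 0 < (s + 1) / 2 by linarith)
  unfold gaussMoment; positivity

lemma gaussMoment_zero : gaussMoment 0 = 1 := by
  have : √Real.pi ≠ 0 := by positivity
  simp [gaussMoment, -one_div, Real.Gamma_one_half_eq, this]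

lemma integral_gaussKernel_mul_abs_rpow {s t : ℝ} (hs : 0 ≤ s) (ht : 0 < t) :
    ∫ r, gaussKernel t r * |r| ^ s = gaussMoment s * t ^ (s / 2) := by
  have h1 : ∀ r : ℝ, gaussKernel t r * |r| ^ s
      = (fun r => (√(4 * Real.pi * t))⁻¹ * (r ^ s * Real.exp (-(1 / (4 * t)) * r ^ 2))) |r| := by
    intro r
    have : -r ^ 2 / (4 * t) = -(1 / (4 * t)) * |r| ^ 2 := by rw [sq_abs]; ring
    rw [gaussKernel, this]; ring
  refine (integral_congr_ae (Eventually.of_forall h1)).trans ((integral_comp_abs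
    (f := fun r => (√(4 * Real.pi * t))⁻¹ * (r ^ s * Real.exp (-(1 / (4 * t)) * r ^ 2)))).trans ?_)
  rw [integral_const_mul,
    integral_rpow_mul_exp_neg_mul_sq_Ioi (by linarith) (by positivity)]
  have h4 : (0 : ℝ) < 4 * t := by positivity
  have e1 : (1 / (4 * t)) ^ (-(s + 1) / 2) = 4 ^ (s / 2) * t ^ (s / 2) * √(4 * t) := by
    rw [one_div, Real.inv_rpow h4.le, ← Real.rpow_neg h4.le, Real.sqrt_eq_rpow,
      ← Real.mul_rpow (by norm_num) ht.le, ← Real.rpow_add h4]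
    congr 1; ring
  have e2 : √(4 * Real.pi * t) = √Real.pi * √(4 * t) := by
    rw [← Real.sqrt_mul (by positivity)]; congr 1; ring
  have : √(4 * t) ≠ 0 := by positivity
  have : √Real.pi ≠ 0 := by positivity
  rw [e1, e2, gaussMoment]; field_simp

lemma integrable_gaussKernel_mul_abs_rpow {s t : ℝ} (hs : 0 ≤ s) (ht : 0 < t) :
    Integrable fun r => gaussKernel t r * |r| ^ s := by
  -- A nonintegrable function has Bochner integral 0, so the positive value just computed implies
  -- integrability.
  refine not_imp_comm.1 integral_undef ?_
  rw [integral_gaussKernel_mul_abs_rpow hs ht]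
  have := gaussMoment_pos hs
  positivity

lemma integrable_gaussKernel_sub {s t : ℝ} (hs : 0 ≤ s) (ht : 0 < t) (x : ℝ) :
    Integrable fun y => gaussKernel t (x - y) * |x - y| ^ s :=
  (integrable_gaussKernel_mul_abs_rpow hs ht).comp_sub_left x

lemma integral_gaussKernel_sub {s t : ℝ} (hs : 0 ≤ s) (ht : 0 < t) (x : ℝ) :
    ∫ y, gaussKernel t (x - y) * |x - y| ^ s = gaussMoment s * t ^ (s / 2) := by
  rw [← integral_gaussKernel_mul_abs_rpow hs ht,
    integral_sub_left_eq_self (fun r => gaussKernel t r * |r| ^ s)]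

lemma setIntegral_gaussKernel_sub_le {s t : ℝ} (hs : 0 ≤ s) (ht : 0 < t) (x : ℝ) :
    ∫ y in Ioi (0 : ℝ), gaussKernel t (x - y) * |x - y| ^ s ≤ gaussMoment s * t ^ (s / 2) := by
  rw [← integral_gaussKernel_sub hs ht x]
  exact setIntegral_le_integral (integrable_gaussKernel_sub hs ht x)
    (Eventually.of_forall fun y => mul_nonneg (gaussKernel_nonneg _ _) (by positivity))

lemma continuous_gaussKernel (t : ℝ) : Continuous (gaussKernel t) := by
  unfold gaussKernel; fun_prop

lemma integral_gaussKernel_odd (t x : ℝ) : ∫ y, gaussKernel t (x - y) * (y - x) = 0 := by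
  have h := integral_sub_left_eq_self (fun r => gaussKernel t r * (-r)) volume x
  simp only [neg_sub] at h
  rw [h]
  have h2 := integral_neg_eq_self (fun r => gaussKernel t r * (-r)) volume
  have h3 : ∀ r, gaussKernel t (-r) * (- -r) = -(gaussKernel t r * (-r)) := by
    intro r; rw [gaussKernel, gaussKernel, neg_sq]; ring
  simp only [h3, integral_neg] at h2
  linarith

/-- Polynomial tail bound for the heat kernel. -/
lemma exists_gaussKernel_le (σ : ℝ) : ∃ C, 0 ≤ C ∧ ∀ t r : ℝ, 0 < t →
    gaussKernel t r ≤ C * t ^ (1 + σ) * (t + r ^ 2) ^ (-(3 / 2 + σ)) := by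
  -- The exponent is chosen for later use: ∫_1^∞ (t + y²)^{-q} dt is a multiple of (1 +
  -- y²)^{-(1/2+σ)}, comparable to the weight of L_σ.
  set q := 3 / 2 + σ with hq
  obtain ⟨n, hn⟩ := exists_nat_ge q
  refine ⟨4 ^ n * n.factorial * Real.exp (1 / 4), by positivity, fun t r ht => ?_⟩
  set a := r ^ 2 / t with ha
  have ha0 : 0 ≤ a := by positivity
  -- Round q up to an integer n and keep only the n-th term of the series of exp((1 + a)/4); this
  -- produces the constant 4^n n! e^{1/4}.
  have h1 : (1 + a) ^ q * Real.exp (-(a / 4)) ≤ 4 ^ n * n.factorial * Real.exp (1 / 4) := by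
    have h2 : (1 + a) ^ q ≤ (1 + a) ^ n := by
      rw [← Real.rpow_natCast]; exact Real.rpow_le_rpow_of_exponent_le (by linarith) hn
    have h3 := Real.pow_div_factorial_le_exp (x := (1 + a) / 4) (by positivity) n
    rw [div_le_iff₀ (by positivity), div_pow, div_le_iff₀ (by positivity)] at h3
    have h4 : Real.exp ((1 + a) / 4) = Real.exp (1 / 4) * Real.exp (a / 4) := by
      rw [← Real.exp_add]; ring_nf
    rw [Real.exp_neg, ← div_eq_mul_inv, div_le_iff₀ (Real.exp_pos _)]
    calc _ ≤ _ := h2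
      _ ≤ _ := h3
      _ = _ := by rw [h4]; ring
  have h5 : t + r ^ 2 = t * (1 + a) := by rw [ha]; field_simp
  have h6 : (t + r ^ 2) ^ (-q) = t ^ (-q) * ((1 + a) ^ q)⁻¹ := by
    rw [h5, Real.mul_rpow ht.le (by positivity), Real.rpow_neg (by positivity : 0 ≤ 1 + a)]
  have h7 : (√(4 * Real.pi * t))⁻¹ ≤ t ^ (1 + σ) * t ^ (-q) := by
    rw [← Real.rpow_add ht, show 1 + σ + -q = -(1 / 2) by rw [hq]; ring, Real.rpow_neg ht.le,
      ← Real.sqrt_eq_rpow]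
    gcongr
    nlinarith [Real.pi_gt_three]
  have h8 : -r ^ 2 / (4 * t) = -(a / 4) := by rw [ha]; field_simp
  have h9 : 0 < (1 + a) ^ q := by positivity
  rw [gaussKernel, h8, h6]
  calc (√(4 * Real.pi * t))⁻¹ * Real.exp (-(a / 4))
      ≤ (t ^ (1 + σ) * t ^ (-q)) * (4 ^ n * n.factorial * Real.exp (1 / 4) / (1 + a) ^ q) := by
        gcongr
        rw [le_div_iff₀ h9, mul_comm]; exact h1
    _ = _ := by ring

/-- Peetre's inequality, adapted to the parabolic weight `t + y²`. -/
lemma peetre_parabolic {q t : ℝ} (hq : 0 ≤ q) (ht : 0 < t) (x y : ℝ) :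
    (t + (x - y) ^ 2) ^ (-q) ≤ (2 * (1 + x ^ 2 / t)) ^ q * (t + y ^ 2) ^ (-q) := by
  -- This is y² ≤ 2x² + 2(x - y)², the difference of the two sides being (2x - y)².
  have h1 : t + y ^ 2 ≤ 2 * (1 + x ^ 2 / t) * (t + (x - y) ^ 2) := by
    have e : x ^ 2 / t * t = x ^ 2 := by field_simp
    have : 0 ≤ x ^ 2 / t := by positivity
    nlinarith [sq_nonneg (2 * x - y), mul_nonneg this (sq_nonneg (x - y))]
  have h2 : 0 < t + (x - y) ^ 2 := by positivity
  have h3 : 0 < t + y ^ 2 := by positivity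
  rw [Real.rpow_neg h2.le, Real.rpow_neg h3.le, ← div_eq_mul_inv, inv_le_comm₀ (by positivity)
    (by positivity), inv_div, div_le_iff₀ (by positivity), ← Real.mul_rpow h2.le (by positivity)]
  exact Real.rpow_le_rpow h3.le (by linarith) hq

/-- From 1 + x ≤ (1 + y)(1 + |x - y|). Decay in y becomes decay in x, at the price of a power of |x
- y| that a Gaussian moment pays. -/
lemma peetre_one_add {s x y : ℝ} (hs : 0 ≤ s) (hx : 0 < x) (hy : 0 < y) :
    (1 + y) ^ (-s) ≤ (1 + x) ^ (-s) * (1 + |x - y|) ^ s := by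
  have h1 : 1 + x ≤ (1 + y) * (1 + |x - y|) := by
    nlinarith [le_abs_self (x - y), mul_nonneg hy.le (abs_nonneg (x - y))]
  rw [Real.rpow_neg (by positivity), Real.rpow_neg (by positivity), ← one_div, ← one_div,
    div_mul_eq_mul_div, one_mul, div_le_div_iff₀ (by positivity) (by positivity), one_mul,
    mul_comm, ← Real.mul_rpow (by positivity) (by positivity)]
  exact Real.rpow_le_rpow (by positivity) h1 hs

/-! ### Fractional powers -/

/-- The weight `min(t,1) t^{-1-σ}`. -/
def fracWeight (σ t : ℝ) : ℝ := min t 1 * t ^ (-(1 + σ))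

lemma integrableOn_rpow_Ioc {a : ℝ} (ha : -1 < a) : IntegrableOn (fun t : ℝ => t ^ a) (Ioc 0 1) := by
  have := intervalIntegral.intervalIntegrable_rpow' (a := 0) (b := 1) ha
  rwa [intervalIntegrable_iff_integrableOn_Ioc_of_le zero_le_one] at this

/-- The condition σ < 1 is used at the origin and σ > 0 at infinity. -/
lemma integrableOn_fracWeight {σ : ℝ} (hσ0 : 0 < σ) (hσ1 : σ < 1) :
    IntegrableOn (fracWeight σ) (Ioi 0) := by
  rw [← Ioc_union_Ioi_eq_Ioi (zero_le_one : (0 : ℝ) ≤ 1)]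
  refine IntegrableOn.union ?_ ?_
  · refine (integrableOn_rpow_Ioc (a := -σ) (by linarith)).congr_fun (fun t ht => ?_)
      measurableSet_Ioc
    rw [fracWeight, min_eq_left ht.2]
    nth_rewrite 2 [← Real.rpow_one t]
    rw [← Real.rpow_add ht.1]; ring_nf
  · refine (integrableOn_Ioi_rpow_of_lt (a := -(1 + σ)) (by linarith) one_pos).congr_fun
      (fun t ht => ?_) measurableSet_Ioi
    rw [fracWeight, min_eq_right (le_of_lt ht), one_mul]

lemma abs_exp_neg_mul_sub_one_le {t s : ℝ} (ht : 0 ≤ t) (hs : 0 ≤ s) :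
    |Real.exp (-(t * s)) - 1| ≤ (1 + s) * min t 1 := by
  have h0 : 0 ≤ t * s := by positivity
  have h1 := Real.add_one_le_exp (-(t * s))
  have h2 : Real.exp (-(t * s)) ≤ 1 := Real.exp_le_one_iff.2 (by linarith)
  have h3 := Real.exp_pos (-(t * s))
  rw [abs_sub_comm, abs_of_nonneg (by linarith)]
  rcases le_total t 1 with h | h
  · rw [min_eq_left h]; nlinarith
  · rw [min_eq_right h]; linarith

lemma integrableOn_exp_neg_sub_one_mul {σ s : ℝ} (hσ0 : 0 < σ) (hσ1 : σ < 1) (hs : 0 ≤ s) :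
    IntegrableOn (fun t => (Real.exp (-(t * s)) - 1) * t ^ (-(1 + σ))) (Ioi 0) := by
  refine Integrable.mono' ((integrableOn_fracWeight hσ0 hσ1).const_mul (1 + s)) ?_ ?_
  · refine ContinuousOn.aestronglyMeasurable (ContinuousOn.mul (by fun_prop) ?_) measurableSet_Ioi
    exact continuousOn_id.rpow_const fun t ht => Or.inl (ne_of_gt ht)
  · refine (ae_restrict_iff' measurableSet_Ioi).2 (Eventually.of_forall fun t ht => ?_)
    have ht0 : 0 < t := ht
    rw [norm_mul, Real.norm_eq_abs, Real.norm_of_nonneg (by positivity), fracWeight, ← mul_assoc]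
    exact mul_le_mul_of_nonneg_right (abs_exp_neg_mul_sub_one_le ht0.le hs) (by positivity)

/-- `s^σ = Γ(-σ)⁻¹ ∫ (e^{-ts} - 1) t^{-1-σ} dt`. -/
lemma integral_exp_neg_sub_one_mul {σ s : ℝ} (hσ0 : 0 < σ) (hσ1 : σ < 1) (hs : 0 < s) :
    ∫ t in Ioi (0 : ℝ), (Real.exp (-(t * s)) - 1) * t ^ (-(1 + σ)) = Real.Gamma (-σ) * s ^ σ := by
  have hσ : -σ ≠ 0 := by linarith
  have hG : Real.Gamma (1 - σ) = -σ * Real.Gamma (-σ) := by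
    rw [← Real.Gamma_add_one hσ]; ring_nf
  -- Integration by parts against the antiderivative t^{-σ}/(-σ): the boundary terms vanish, and Γ(1
  -- - σ) s^{σ-1} appears, with Γ(1 - σ) = -σ Γ(-σ).
  have hu : ∀ t ∈ Ioi (0 : ℝ), HasDerivAt (fun t => Real.exp (-(t * s)) - 1)
      (-(s * Real.exp (-(s * t)))) t := by
    intro t _
    have := ((((hasDerivAt_id t).mul_const s).neg).exp).sub_const 1
    refine this.congr_deriv ?_
    simp; ring_nf
  have hv : ∀ t ∈ Ioi (0 : ℝ), HasDerivAt (fun t => t ^ (-σ) / (-σ)) (t ^ (-(1 + σ))) t := by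
    intro t ht
    have := (Real.hasDerivAt_rpow_const (p := -σ) (Or.inl (ne_of_gt ht))).div_const (-σ)
    refine this.congr_deriv ?_
    rw [mul_div_cancel_left₀ _ hσ]; ring_nf
  have hi := integrableOn_rpow_mul_exp_neg (lam := 1 - σ) (z := s) (by linarith) hs
  have e : ∀ t : ℝ, -(s * Real.exp (-(s * t))) * (t ^ (-σ) / (-σ))
      = s / σ * (t ^ (1 - σ - 1) * Real.exp (-(s * t))) := by
    intro t
    rw [show 1 - σ - 1 = -σ by ring]; field_simp
  have hlim0 : Tendsto ((fun t => Real.exp (-(t * s)) - 1) * fun t => t ^ (-σ) / (-σ))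
      (𝓝[>] 0) (𝓝 0) := by
    have hl : Tendsto (fun t : ℝ => s / σ * t ^ (1 - σ)) (𝓝[>] 0) (𝓝 0) := by
      have hc : Continuous fun t : ℝ => s / σ * t ^ (1 - σ) :=
        continuous_const.mul (Real.continuous_rpow_const (by linarith))
      have := (hc.tendsto 0).mono_left (nhdsWithin_le_nhds (s := Ioi 0))
      simpa [Real.zero_rpow (by linarith : 1 - σ ≠ 0)] using this
    refine squeeze_zero_norm' ?_ hl
    filter_upwards [self_mem_nhdsWithin] with t ht
    have ht0 : 0 < t := ht
    have h1 := Real.add_one_le_exp (-(t * s))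
    have h2 : Real.exp (-(t * s)) ≤ 1 := Real.exp_le_one_iff.2 (by nlinarith)
    rw [Pi.mul_apply, norm_mul, Real.norm_eq_abs, abs_sub_comm, abs_of_nonneg (by linarith),
      norm_div, Real.norm_of_nonneg (by positivity), norm_neg, Real.norm_of_nonneg hσ0.le]
    have e2 : t ^ (1 - σ) = t * t ^ (-σ) := by
      rw [sub_eq_add_neg, Real.rpow_add ht0, Real.rpow_one]
    rw [e2]
    calc _ ≤ (t * s) * (t ^ (-σ) / σ) := by gcongr; linarith
      _ = _ := by ring
  have hlim1 : Tendsto ((fun t => Real.exp (-(t * s)) - 1) * fun t => t ^ (-σ) / (-σ))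
      atTop (𝓝 0) := by
    have hl : Tendsto (fun t : ℝ => t ^ (-σ) / σ) atTop (𝓝 0) := by
      simpa using (tendsto_rpow_neg_atTop hσ0).div_const σ
    refine squeeze_zero_norm' ?_ hl
    filter_upwards [eventually_gt_atTop 0] with t ht0
    have h3 := Real.exp_pos (-(t * s))
    have h2 : Real.exp (-(t * s)) ≤ 1 := Real.exp_le_one_iff.2 (by nlinarith)
    rw [Pi.mul_apply, norm_mul, Real.norm_eq_abs, abs_sub_comm, abs_of_nonneg (by linarith),
      norm_div, Real.norm_of_nonneg (by positivity), norm_neg, Real.norm_of_nonneg hσ0.le]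
    have : 0 ≤ t ^ (-σ) / σ := by positivity
    nlinarith
  have key := integral_Ioi_mul_deriv_eq_deriv_mul hu hv
    (integrableOn_exp_neg_sub_one_mul hσ0 hσ1 hs.le)
    (by
      have : IntegrableOn (fun t => s / σ * (t ^ (1 - σ - 1) * Real.exp (-(s * t)))) (Ioi 0) :=
        hi.const_mul (s / σ)
      refine this.congr_fun (fun t _ => (e t).symm) measurableSet_Ioi) hlim0 hlim1
  rw [key]
  simp only [e]
  rw [integral_const_mul, integral_rpow_mul_exp_neg_eq (by linarith) hs, hG,
    show -(1 - σ) = σ - 1 by ring, Real.rpow_sub_one hs.ne']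
  field_simp
  ring

/-! ### The Bessel heat kernel -/

section HeatKernel

variable {lam : ℝ}

lemma continuousOn_besselHeatKernel (hlam : 1 ≤ lam) :
    ContinuousOn (fun z : (ℝ × ℝ) × ℝ => besselHeatKernel lam z.1.1 z.1.2 z.2)
      ((Ioi 0 ×ˢ Ioi 0) ×ˢ Ioi 0) := by
  have : ContinuousOn (fun z : (ℝ × ℝ) × ℝ => √(z.1.2 * z.2) / (2 * z.1.1) *
      ((z.1.2 * z.2 / (4 * z.1.1)) ^ (lam - 1 / 2) *
      besselClifford (lam - 1 / 2) ((z.1.2 * z.2 / (4 * z.1.1)) ^ 2)) *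
      Real.exp (-(z.1.2 ^ 2 + z.2 ^ 2) / (4 * z.1.1))) ((Ioi 0 ×ˢ Ioi 0) ×ˢ Ioi 0) := by
    have hne : ∀ z ∈ ((Ioi (0 : ℝ) ×ˢ Ioi (0 : ℝ)) ×ˢ Ioi (0 : ℝ)), z.1.1 ≠ 0 :=
      fun z hz => ne_of_gt hz.1.1
    have h1 : ContinuousOn (fun z : (ℝ × ℝ) × ℝ => z.1.2 * z.2 / (4 * z.1.1))
        ((Ioi 0 ×ˢ Ioi 0) ×ˢ Ioi 0) :=
      ContinuousOn.div (by fun_prop) (by fun_prop) fun z hz => mul_ne_zero four_ne_zero (hne z hz)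
    refine ContinuousOn.mul (ContinuousOn.mul ?_ (ContinuousOn.mul ?_ ?_)) ?_
    · exact ContinuousOn.div (by fun_prop) (by fun_prop)
        fun z hz => mul_ne_zero two_ne_zero (hne z hz)
    · exact h1.rpow_const fun z _ => Or.inr (by linarith)
    · exact (continuous_besselClifford (by linarith)).comp_continuousOn (h1.pow 2)
    · exact Real.continuous_exp.comp_continuousOn (ContinuousOn.div (by fun_prop) (by fun_prop)
        fun z hz => mul_ne_zero four_ne_zero (hne z hz))
  exact this.congr fun z hz => besselHeatKernel_eq hz.1.1 hz.1.2 hz.2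

lemma continuousOn_besselHeatKernel_right (hlam : 1 ≤ lam) {t x : ℝ} (ht : 0 < t) (hx : 0 < x) :
    ContinuousOn (fun y => besselHeatKernel lam t x y) (Ioi 0) :=
  (continuousOn_besselHeatKernel hlam).comp (f := fun y : ℝ => ((t, x), y)) (by fun_prop)
    fun _ hy => ⟨⟨ht, hx⟩, hy⟩

lemma continuousOn_besselHeatKernel_mid (hlam : 1 ≤ lam) {t y : ℝ} (ht : 0 < t) (hy : 0 < y) :
    ContinuousOn (fun x => besselHeatKernel lam t x y) (Ioi 0) :=
  (continuousOn_besselHeatKernel hlam).comp (f := fun x : ℝ => ((t, x), y)) (by fun_prop)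
    fun _ hx => ⟨⟨ht, hx⟩, hy⟩

lemma abs_besselHeatKernel_le (hlam : 1 ≤ lam) {t x y : ℝ} (ht : 0 < t) (hx : 0 < x)
    (hy : 0 < y) : |besselHeatKernel lam t x y| ≤ gaussKernel t (x - y) := by
  rw [abs_of_nonneg (besselHeatKernel_nonneg hlam ht hx hy)]
  exact (besselHeatKernel_bounds hlam ht hx hy).1

lemma besselHeatKernel_symm (t x y : ℝ) :
    besselHeatKernel lam t x y = besselHeatKernel lam t y x := by
  rw [besselHeatKernel, besselHeatKernel, mul_comm x y, add_comm (x ^ 2)]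

/-- The Bessel heat kernel differs from the Gauss–Weierstrass kernel by a relative error
`(t + |x-y|²)/x²`; the Bessel kernel is extended by zero to `y ≤ 0`. -/
lemma abs_besselHeatKernel_sub_le (hlam : 1 ≤ lam) {t x : ℝ} (ht : 0 < t) (hx : 0 < x) (y : ℝ) :
    |(Ioi 0).indicator (fun y => besselHeatKernel lam t x y) y - gaussKernel t (x - y)|
      ≤ (4 + 2 * lam ^ 2) / x ^ 2 * (gaussKernel t (x - y) * (t + (x - y) ^ 2)) := by
  have hg := gaussKernel_nonneg t (x - y)
  have key : ∀ A : ℝ, A ≤ (4 + 2 * lam ^ 2) / x ^ 2 * (t + (x - y) ^ 2) →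
      gaussKernel t (x - y) * A
        ≤ (4 + 2 * lam ^ 2) / x ^ 2 * (gaussKernel t (x - y) * (t + (x - y) ^ 2)) := by
    intro A hA
    calc _ ≤ gaussKernel t (x - y) * ((4 + 2 * lam ^ 2) / x ^ 2 * (t + (x - y) ^ 2)) := by gcongr
      _ = _ := by ring
  -- When |x - y| ≥ x/2 the claimed relative error already exceeds 1, so 0 ≤ W ≤ Gauss is enough.
  -- Only y ≥ x/2 needs the refined lower bound.
  have hfar : x ^ 2 ≤ 4 * (x - y) ^ 2 → 1 ≤ (4 + 2 * lam ^ 2) / x ^ 2 * (t + (x - y) ^ 2) := by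
    intro h
    rw [div_mul_eq_mul_div, le_div_iff₀ (by positivity)]
    nlinarith [mul_nonneg (sq_nonneg lam) (sq_nonneg (x - y)), mul_nonneg (sq_nonneg lam) ht.le]
  by_cases hy : 0 < y
  · rw [indicator_of_mem (show y ∈ Ioi (0 : ℝ) from hy)]
    obtain ⟨h1, h2⟩ := besselHeatKernel_bounds hlam ht hx hy
    have h0 := besselHeatKernel_nonneg hlam ht hx hy
    rw [abs_sub_comm, abs_of_nonneg (by linarith)]
    rcases le_total (x / 2) y with hxy | hxy
    · refine le_trans ?_ (key (lam ^ 2 * t / (x * y)) ?_)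
      · linarith
      · have : lam ^ 2 * t / (x * y) ≤ 2 * lam ^ 2 / x ^ 2 * t := by
          rw [div_mul_eq_mul_div, div_le_div_iff₀ (by positivity) (by positivity)]
          have : x ^ 2 ≤ 2 * (x * y) := by nlinarith
          nlinarith [mul_nonneg (sq_nonneg lam) ht.le]
        refine this.trans ?_
        gcongr
        · linarith
        · nlinarith [sq_nonneg (x - y)]
    · refine le_trans ?_ (key 1 (hfar ?_))
      · linarith
      · nlinarith
  · rw [indicator_of_notMem (show y ∉ Ioi (0 : ℝ) from hy), zero_sub, abs_neg, abs_of_nonneg hg]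
    refine le_trans ?_ (key 1 (hfar ?_))
    · linarith
    · nlinarith [not_lt.1 hy]

end HeatKernel

/-! ### Mass, centering and small-time increments of the semigroup -/

section HeatEstimates

variable {lam : ℝ}

lemma ae_Ioi_of_forall {P : ℝ → Prop} (h : ∀ y, 0 < y → P y) :
    ∀ᵐ y ∂(volume.restrict (Ioi (0 : ℝ))), P y :=
  (ae_restrict_iff' measurableSet_Ioi).2 (Eventually.of_forall h)

lemma aestronglyMeasurable_besselHeatKernel (hlam : 1 ≤ lam) :
    AEStronglyMeasurable (fun z : (ℝ × ℝ) × ℝ => besselHeatKernel lam z.1.1 z.1.2 z.2)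
      (((volume.restrict (Ioi 0)).prod (volume.restrict (Ioi 0))).prod (volume.restrict (Ioi 0))) := by
  rw [Measure.prod_restrict, Measure.prod_restrict]
  exact (continuousOn_besselHeatKernel hlam).aestronglyMeasurable
    ((measurableSet_Ioi.prod measurableSet_Ioi).prod measurableSet_Ioi)

lemma aestronglyMeasurable_besselHeat (hlam : 1 ≤ lam) {f : ℝ → ℝ}
    (hf : AEStronglyMeasurable f (volume.restrict (Ioi 0))) :
    AEStronglyMeasurable (fun z : ℝ × ℝ => besselHeat lam z.1 f z.2)
      ((volume.restrict (Ioi 0)).prod (volume.restrict (Ioi 0))) :=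
  ((aestronglyMeasurable_besselHeatKernel hlam).mul hf.comp_snd).integral_prod_right'

/-- The general device for the semigroup: integrability and size are both deduced from a majorant of
the Gauss kernel times |f|. -/
lemma integrableOn_besselHeatKernel_mul (hlam : 1 ≤ lam) {t x : ℝ} (ht : 0 < t) (hx : 0 < x)
    {f b : ℝ → ℝ} (hf : AEStronglyMeasurable f (volume.restrict (Ioi 0)))
    (hb : IntegrableOn b (Ioi 0)) (h : ∀ y, 0 < y → gaussKernel t (x - y) * |f y| ≤ b y) :
    IntegrableOn (fun y => besselHeatKernel lam t x y * f y) (Ioi 0) ∧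
      |∫ y in Ioi (0 : ℝ), besselHeatKernel lam t x y * f y| ≤ ∫ y in Ioi (0 : ℝ), b y := by
  have h1 : ∀ᵐ y ∂(volume.restrict (Ioi (0 : ℝ))), ‖besselHeatKernel lam t x y * f y‖ ≤ b y :=
    ae_Ioi_of_forall fun y hy => by
      rw [norm_mul, Real.norm_eq_abs, Real.norm_eq_abs]
      exact (mul_le_mul_of_nonneg_right (abs_besselHeatKernel_le hlam ht hx hy)
        (abs_nonneg _)).trans (h y hy)
  exact ⟨Integrable.mono' hb (((continuousOn_besselHeatKernel_right hlam ht hx).aestronglyMeasurable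
    measurableSet_Ioi).mul hf) h1, norm_integral_le_of_norm_le hb h1⟩

lemma integrableOn_besselHeatKernel (hlam : 1 ≤ lam) {t x : ℝ} (ht : 0 < t) (hx : 0 < x) :
    IntegrableOn (fun y => besselHeatKernel lam t x y) (Ioi 0) := by
  have := (integrableOn_besselHeatKernel_mul hlam ht hx (f := fun _ => 1)
    aestronglyMeasurable_const (integrable_gaussKernel_sub le_rfl ht x).integrableOn
    (fun y _ => by simp)).1
  simpa using this

lemma integrableOn_besselHeatKernel_mul_sub (hlam : 1 ≤ lam) {t x : ℝ} (ht : 0 < t) (hx : 0 < x) :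
    IntegrableOn (fun y => besselHeatKernel lam t x y * (y - x)) (Ioi 0) ∧
    |∫ y in Ioi (0 : ℝ), besselHeatKernel lam t x y * (y - x)| ≤ gaussMoment 1 * t ^ (1 / 2 : ℝ) := by
  have := integrableOn_besselHeatKernel_mul hlam ht hx (f := fun y => y - x)
    (by fun_prop : Continuous fun y : ℝ => y - x).aestronglyMeasurable
    (integrable_gaussKernel_sub zero_le_one ht x).integrableOn
    (fun y _ => by rw [Real.rpow_one, abs_sub_comm])
  exact ⟨this.1, this.2.trans (setIntegral_gaussKernel_sub_le zero_le_one ht x)⟩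

/-- The Bessel heat semigroup almost preserves the mass. -/
lemma abs_integral_besselHeatKernel_sub_one_le (hlam : 1 ≤ lam) {t x : ℝ} (ht : 0 < t)
    (hx : 0 < x) : |(∫ y in Ioi (0 : ℝ), besselHeatKernel lam t x y) - 1|
      ≤ (4 + 2 * lam ^ 2) * (1 + gaussMoment 2) * (t / x ^ 2) := by
  have g0 := integrable_gaussKernel_sub le_rfl ht x
  have g2 := integrable_gaussKernel_sub zero_le_two ht x
  have v0 := integral_gaussKernel_sub le_rfl ht x
  have v2 := integral_gaussKernel_sub zero_le_two ht x
  simp only [Real.rpow_zero, mul_one, zero_div, gaussMoment_zero] at g0 v0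
  simp only [Real.rpow_two, sq_abs, ne_eq, OfNat.ofNat_ne_zero, not_false_eq_true, div_self,
    Real.rpow_one] at g2 v2
  have hi := (integrable_indicator_iff measurableSet_Ioi).2 (integrableOn_besselHeatKernel hlam ht hx)
  rw [← integral_indicator measurableSet_Ioi, ← v0, ← integral_sub hi g0,
    ← Real.norm_eq_abs]
  have hb : Integrable fun y => (4 + 2 * lam ^ 2) / x ^ 2 *
      (t * gaussKernel t (x - y) + gaussKernel t (x - y) * (x - y) ^ 2) :=
    ((g0.const_mul t).add g2).const_mul _
  refine (norm_integral_le_of_norm_le hb (Eventually.of_forall fun y => ?_)).trans (le_of_eq ?_)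
  · refine (abs_besselHeatKernel_sub_le hlam ht hx y).trans (le_of_eq ?_); ring
  · rw [integral_const_mul, integral_add (g0.const_mul t) g2, integral_const_mul, v0, v2]; ring

/-- The Bessel heat kernel is almost centered. -/
lemma abs_integral_besselHeatKernel_mul_sub_le (hlam : 1 ≤ lam) {t x : ℝ} (ht : 0 < t)
    (hx : 0 < x) : |∫ y in Ioi (0 : ℝ), besselHeatKernel lam t x y * (y - x)|
      ≤ ((4 + 2 * lam ^ 2) * (gaussMoment 1 + gaussMoment 3) + gaussMoment 1) * (t / x) := by
  have m1 := gaussMoment_pos zero_le_one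
  have m3 := gaussMoment_pos zero_le_three
  obtain ⟨hi0, htriv⟩ := integrableOn_besselHeatKernel_mul_sub hlam ht hx
  have hsq : √t * √t = t := Real.mul_self_sqrt ht.le
  have hs0 : 0 < √t := by positivity
  rw [← Real.sqrt_eq_rpow] at htriv
  -- If √t ≤ x, subtract the centered Gauss kernel; the error t√t/x² is at most t/x. Otherwise the
  -- trivial bound √t is itself at most t/x.
  rcases le_total (√t) x with h | h
  · have g1 := integrable_gaussKernel_sub zero_le_one ht x
    have g3 := integrable_gaussKernel_sub zero_le_three ht x
    have v1 := integral_gaussKernel_sub zero_le_one ht x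
    have v3 := integral_gaussKernel_sub zero_le_three ht x
    have e3 : t ^ (3 / 2 : ℝ) = t * √t := by
      rw [Real.sqrt_eq_rpow, show (3 / 2 : ℝ) = 1 + 1 / 2 by norm_num, Real.rpow_add ht,
        Real.rpow_one]
    rw [← Real.sqrt_eq_rpow] at v1
    rw [e3] at v3
    have go : Integrable fun y => gaussKernel t (x - y) * (y - x) := by
      refine Integrable.mono' g1 ((continuous_gaussKernel t).comp (by fun_prop) |>.mul
        (by fun_prop)).aestronglyMeasurable (Eventually.of_forall fun y => ?_)
      rw [norm_mul, Real.norm_of_nonneg (gaussKernel_nonneg _ _), Real.rpow_one, Real.norm_eq_abs,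
        abs_sub_comm]
    have hi := (integrable_indicator_iff measurableSet_Ioi).2 hi0
    have hb : Integrable fun y => (4 + 2 * lam ^ 2) / x ^ 2 *
        (t * (gaussKernel t (x - y) * |x - y| ^ (1 : ℝ))
          + gaussKernel t (x - y) * |x - y| ^ (3 : ℝ)) :=
      ((g1.const_mul t).add g3).const_mul _
    have e : ∫ y in Ioi (0 : ℝ), besselHeatKernel lam t x y * (y - x)
        = ∫ y, ((Ioi 0).indicator (fun y => besselHeatKernel lam t x y * (y - x)) y
          - gaussKernel t (x - y) * (y - x)) := by
      rw [integral_sub hi go, integral_gaussKernel_odd, sub_zero, integral_indicator measurableSet_Ioi]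
    rw [e, ← Real.norm_eq_abs]
    refine (norm_integral_le_of_norm_le hb (Eventually.of_forall fun y => ?_)).trans ?_
    · have e2 : (Ioi 0).indicator (fun y => besselHeatKernel lam t x y * (y - x)) y
          - gaussKernel t (x - y) * (y - x) = ((Ioi 0).indicator
            (fun y => besselHeatKernel lam t x y) y - gaussKernel t (x - y)) * (y - x) := by
        rw [indicator_mul_left]; ring
      have e4 : |x - y| ^ (3 : ℝ) = (x - y) ^ 2 * |x - y| := by
        rw [← sq_abs, show (3 : ℝ) = ((3 : ℕ) : ℝ) by norm_num, Real.rpow_natCast]; ring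
      rw [e2, norm_mul, Real.norm_eq_abs, Real.norm_eq_abs, abs_sub_comm y x, e4, Real.rpow_one]
      refine (mul_le_mul_of_nonneg_right (abs_besselHeatKernel_sub_le hlam ht hx y)
        (abs_nonneg _)).trans (le_of_eq ?_)
      ring
    · rw [integral_const_mul, integral_add (g1.const_mul t) g3, integral_const_mul, v1, v3]
      have h5 : t * √t / x ^ 2 ≤ t / x := by
        rw [div_le_div_iff₀ (by positivity) hx]
        nlinarith [mul_nonneg (mul_nonneg ht.le hx.le) (sub_nonneg.2 h)]
      calc _ = (4 + 2 * lam ^ 2) * (gaussMoment 1 + gaussMoment 3) * (t * √t / x ^ 2) := by ring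
        _ ≤ (4 + 2 * lam ^ 2) * (gaussMoment 1 + gaussMoment 3) * (t / x) := by gcongr
        _ ≤ _ := by gcongr; linarith
  · have h5 : √t ≤ t / x := by
      rw [le_div_iff₀ hx]; nlinarith
    calc _ ≤ gaussMoment 1 * √t := htriv
      _ ≤ gaussMoment 1 * (t / x) := by gcongr
      _ ≤ _ := by
        gcongr
        have : 0 ≤ (4 + 2 * lam ^ 2) * (gaussMoment 1 + gaussMoment 3) := by positivity
        linarith

/-- Small-time behaviour of the Bessel heat semigroup on functions with a first-order expansion
with Hölder remainder. -/
lemma exists_besselHeat_sub_le (hlam : 1 ≤ lam) {β : ℝ} (hβ : 0 ≤ β) :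
    ∃ C, 0 ≤ C ∧ ∀ (f : ℝ → ℝ) (t x d H : ℝ),
      AEStronglyMeasurable f (volume.restrict (Ioi 0)) → 0 < t → 0 < x →
      (∀ y, 0 < y → |f y - f x - d * (y - x)| ≤ H * |x - y| ^ β) →
      IntegrableOn (fun y => besselHeatKernel lam t x y * f y) (Ioi 0) ∧
      |besselHeat lam t f x - f x| ≤ C * (H * t ^ (β / 2) + |d| * (t / x) + |f x| * (t / x ^ 2)) := by
  have m1 := gaussMoment_pos zero_le_one
  have m3 := gaussMoment_pos zero_le_three
  have m2 := gaussMoment_pos zero_le_two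
  have mβ := gaussMoment_pos hβ
  set A := (4 + 2 * lam ^ 2) * (1 + gaussMoment 2) with hA
  set B := (4 + 2 * lam ^ 2) * (gaussMoment 1 + gaussMoment 3) + gaussMoment 1 with hB
  have hA0 : 0 ≤ A := by positivity
  have hB0 : 0 ≤ B := by positivity
  refine ⟨A + B + gaussMoment β, by positivity, fun f t x d H hf ht hx h => ?_⟩
  -- At y = x + 1 the remainder bound reads 0 ≤ |…| ≤ H.
  have hH : 0 ≤ H := by
    have := (abs_nonneg _).trans (h (x + 1) (by linarith))
    simpa using this
  have i0 := integrableOn_besselHeatKernel hlam ht hx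
  obtain ⟨i1, -⟩ := integrableOn_besselHeatKernel_mul_sub hlam ht hx
  have hrem : AEStronglyMeasurable (fun y => f y - f x - d * (y - x))
      (volume.restrict (Ioi 0)) :=
    (hf.sub aestronglyMeasurable_const).sub
      (by fun_prop : Continuous fun y : ℝ => d * (y - x)).aestronglyMeasurable
  obtain ⟨i2, hI2⟩ := integrableOn_besselHeatKernel_mul hlam ht hx hrem
    ((integrable_gaussKernel_sub hβ ht x).integrableOn.const_mul H)
    (fun y hy => by
      have := mul_le_mul_of_nonneg_left (h y hy) (gaussKernel_nonneg t (x - y))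
      linarith)
  rw [integral_const_mul] at hI2
  have hI2' := hI2.trans (mul_le_mul_of_nonneg_left (setIntegral_gaussKernel_sub_le hβ ht x) hH)
  -- Constant, linear and remainder parts: they meet the mass defect, the centering defect and the
  -- moment of order β respectively.
  have e : (fun y => besselHeatKernel lam t x y * f y) = fun y =>
      f x * besselHeatKernel lam t x y + d * (besselHeatKernel lam t x y * (y - x))
        + besselHeatKernel lam t x y * (f y - f x - d * (y - x)) := by
    funext y; ring
  have hI0 := abs_integral_besselHeatKernel_sub_one_le hlam ht hx
  have hI1 := abs_integral_besselHeatKernel_mul_sub_le hlam ht hx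
  have j : IntegrableOn (fun y => f x * besselHeatKernel lam t x y
      + d * (besselHeatKernel lam t x y * (y - x))) (Ioi 0) := (i0.const_mul _).add (i1.const_mul _)
  refine ⟨by rw [e]; exact j.add i2, ?_⟩
  rw [besselHeat, e, integral_add j i2, integral_add (i0.const_mul _) (i1.const_mul _),
    integral_const_mul, integral_const_mul]
  set I0 := ∫ y in Ioi (0 : ℝ), besselHeatKernel lam t x y
  set I1 := ∫ y in Ioi (0 : ℝ), besselHeatKernel lam t x y * (y - x)
  set I2 := ∫ y in Ioi (0 : ℝ), besselHeatKernel lam t x y * (f y - f x - d * (y - x))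
  have e2 : f x * I0 + d * I1 + I2 - f x = f x * (I0 - 1) + d * I1 + I2 := by ring
  rw [e2]
  have t1 : 0 ≤ H * t ^ (β / 2) := by positivity
  have t2 : 0 ≤ |d| * (t / x) := by positivity
  have t3 : 0 ≤ |f x| * (t / x ^ 2) := by positivity
  calc |f x * (I0 - 1) + d * I1 + I2| ≤ |f x * (I0 - 1)| + |d * I1| + |I2| :=
        (abs_add_le _ _).trans (add_le_add_left (abs_add_le _ _) _)
    _ ≤ |f x| * (A * (t / x ^ 2)) + |d| * (B * (t / x)) + H * (gaussMoment β * t ^ (β / 2)) := by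
        rw [abs_mul, abs_mul]; gcongr
    _ = A * (|f x| * (t / x ^ 2)) + B * (|d| * (t / x)) + gaussMoment β * (H * t ^ (β / 2)) := by
        ring
    _ ≤ _ := by nlinarith [mul_nonneg hA0 t1, mul_nonneg hA0 t2, mul_nonneg hB0 t1,
        mul_nonneg hB0 t3, mul_nonneg mβ.le t2, mul_nonneg mβ.le t3]

end HeatEstimates

/-! ### The semigroup and the fractional operator on test functions -/

section TestFunctions

variable {lam : ℝ} {φ : ℝ → ℝ}

lemma hankel_eq (f : ℝ → ℝ) (x : ℝ) :
    hankel lam f x = ∫ y in Ioi (0 : ℝ), hankelKernel lam (x * y) * f y := rfl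

lemma continuousOn_hankelKernel (hlam : 1 ≤ lam) : ContinuousOn (hankelKernel lam) (Ioi 0) := by
  have : ContinuousOn (fun s => 2 ^ (-(lam - 1 / 2)) * s ^ lam *
      besselClifford (lam - 1 / 2) (-(s ^ 2 / 4))) (Ioi 0) :=
    ((continuousOn_const.mul (Real.continuous_rpow_const (by linarith)).continuousOn)).mul
      ((continuous_besselClifford (by linarith)).comp (by fun_prop)).continuousOn
  exact this.congr fun s hs => hankelKernel_eq hs

lemma exists_abs_hankelKernel_mul_le (hlam : 1 ≤ lam) : ∃ K, 0 ≤ K ∧ ∀ x y : ℝ, 0 < x → 0 < y →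
    |hankelKernel lam (x * y)| ≤ K * x ^ lam * y ^ lam := by
  refine ⟨2 ^ (-(lam - 1 / 2)) * besselClifford (lam - 1 / 2) 0,
    mul_nonneg (by positivity) (besselClifford_nonneg (by linarith) le_rfl), fun x y hx hy => ?_⟩
  refine (abs_hankelKernel_le hlam (mul_pos hx hy)).trans (le_of_eq ?_)
  rw [Real.mul_rpow hx.le hy.le]; ring

lemma continuousOn_hankelKernel_mul (hlam : 1 ≤ lam) {x : ℝ} (hx : 0 < x) :
    ContinuousOn (fun y => hankelKernel lam (x * y)) (Ioi 0) :=
  (continuousOn_hankelKernel hlam).comp (by fun_prop) fun _ hy => mul_pos hx hy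

/-- Rapidly decaying functions may be integrated against the Hankel kernel. -/
lemma integrableOn_hankelKernel_mul (hlam : 1 ≤ lam) {f : ℝ → ℝ} (hf : RapidDecay f)
    (hc : ContinuousOn f (Ioi 0)) {x : ℝ} (hx : 0 < x) :
    IntegrableOn (fun y => hankelKernel lam (x * y) * f y) (Ioi 0) := by
  obtain ⟨K, hK0, hK⟩ := exists_abs_hankelKernel_mul_le hlam
  refine Integrable.mono' (((hf.integrableOn_rpow_mul hc (a := lam) (by linarith)).norm.const_mul
    (K * x ^ lam))) (((continuousOn_hankelKernel_mul hlam hx).mul hc).aestronglyMeasurable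
      measurableSet_Ioi) (ae_Ioi_of_forall fun y hy => ?_)
  rw [norm_mul, norm_mul, Real.norm_of_nonneg (by positivity : 0 ≤ y ^ lam), ← mul_assoc]
  exact mul_le_mul_of_nonneg_right (hK x y hx hy) (norm_nonneg _)

/-- The Bessel heat semigroup on the Hankel side. -/
lemma IsBesselTest.besselHeat_eq (hlam : 1 ≤ lam) (h : IsBesselTest lam φ) {t x : ℝ} (ht : 0 < t)
    (hx : 0 < x) : besselHeat lam t φ x = ∫ y in Ioi (0 : ℝ),
      Real.exp (-t * y ^ 2) * (hankelKernel lam (x * y) * hankel lam φ y) := by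
  obtain ⟨K, hK0, hK⟩ := exists_abs_hankelKernel_mul_le hlam
  have hl : 0 ≤ lam := by linarith
  -- With the crude bound on the Hankel kernel, the Gaussian handles y and the decay of φ handles z;
  -- Fubini and Weber's integral then give the claim.
  have hi : Integrable (Function.uncurry fun y z : ℝ =>
      Real.exp (-t * y ^ 2) * (hankelKernel lam (x * y) * hankelKernel lam (y * z)) * φ z)
      ((volume.restrict (Ioi 0)).prod (volume.restrict (Ioi 0))) := by
    have b1 : IntegrableOn (fun y : ℝ => K * x ^ lam * K * (y ^ (2 * lam) * Real.exp (-t * y ^ 2)))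
        (Ioi 0) := (integrableOn_rpow_mul_exp_neg_mul_sq ht (by linarith)).const_mul _
    have b2 : IntegrableOn (fun z => z ^ lam * |φ z|) (Ioi 0) :=
      (h.rapidDecay hl).abs.integrableOn_rpow_mul h.continuousOn.abs hl
    refine Integrable.mono' (b1.mul_prod b2) ?_ ?_
    · rw [Measure.prod_restrict]
      refine ContinuousOn.aestronglyMeasurable ?_ (measurableSet_Ioi.prod measurableSet_Ioi)
      refine ContinuousOn.mul (ContinuousOn.mul (by fun_prop) (ContinuousOn.mul ?_ ?_)) ?_
      · exact (continuousOn_hankelKernel hlam).comp (by fun_prop) fun z hz => mul_pos hx hz.1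
      · exact (continuousOn_hankelKernel hlam).comp (by fun_prop) fun z hz =>
          mem_Ioi.2 (mul_pos (mem_Ioi.1 hz.1) (mem_Ioi.1 hz.2))
      · exact h.continuousOn.comp (by fun_prop) fun z hz => hz.2
    · rw [Measure.prod_restrict]
      refine (ae_restrict_iff' (measurableSet_Ioi.prod measurableSet_Ioi)).2
        (Eventually.of_forall ?_)
      rintro ⟨y, z⟩ ⟨hy, hz⟩
      have hy0 : 0 < y := hy
      have hz0 : 0 < z := hz
      have e : y ^ (2 * lam) = y ^ lam * y ^ lam := by rw [← Real.rpow_add hy0]; ring_nf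
      simp only [Function.uncurry]
      rw [norm_mul, norm_mul, norm_mul, Real.norm_of_nonneg (Real.exp_pos _).le, Real.norm_eq_abs,
        Real.norm_eq_abs, Real.norm_eq_abs]
      calc _ ≤ Real.exp (-t * y ^ 2) * ((K * x ^ lam * y ^ lam) * (K * y ^ lam * z ^ lam)) * |φ z| := by
            gcongr
            · exact hK x y hx hy0
            · exact hK y z hy0 hz0
        _ = _ := by rw [e]; ring
  have e1 : ∀ y, Real.exp (-t * y ^ 2) * (hankelKernel lam (x * y) * hankel lam φ y)
      = ∫ z in Ioi (0 : ℝ),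
        Real.exp (-t * y ^ 2) * (hankelKernel lam (x * y) * hankelKernel lam (y * z)) * φ z := by
    intro y
    rw [hankel_eq, ← integral_const_mul, ← integral_const_mul]
    refine integral_congr_ae (Eventually.of_forall fun z => ?_)
    simp only; ring
  simp only [e1]
  rw [integral_integral_swap hi, besselHeat]
  refine setIntegral_congr_fun measurableSet_Ioi fun z hz => ?_
  rw [integral_mul_const, integral_hankelKernel_mul hlam ht hx hz]

/-- The Bessel heat semigroup is an approximate identity on test functions. -/
lemma IsBesselTest.tendsto_besselHeat (hlam : 1 ≤ lam) (h : IsBesselTest lam φ) {x : ℝ}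
    (hx : 0 < x) : Tendsto (fun t => besselHeat lam t φ x) (𝓝[>] 0) (𝓝 (φ x)) := by
  obtain ⟨H, hH0, hH⟩ := h.lipschitz hlam
  obtain ⟨C, hC0, hC⟩ := exists_besselHeat_sub_le hlam (β := 1) zero_le_one
  rw [tendsto_iff_norm_sub_tendsto_zero]
  have hl : Tendsto (fun t : ℝ => C * (H * t ^ (1 / 2 : ℝ) + |(0 : ℝ)| * (t / x) +
      |φ x| * (t / x ^ 2))) (𝓝[>] 0) (𝓝 0) := by
    have hc : Continuous fun t : ℝ => C * (H * t ^ (1 / 2 : ℝ) + |(0 : ℝ)| * (t / x) +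
        |φ x| * (t / x ^ 2)) := by
      have := Real.continuous_rpow_const (q := 1 / 2) (by norm_num)
      fun_prop
    have := (hc.tendsto 0).mono_left (nhdsWithin_le_nhds (s := Ioi 0))
    simpa [Real.zero_rpow (by norm_num : (2⁻¹ : ℝ) ≠ 0)] using this
  refine squeeze_zero' (Eventually.of_forall fun t => norm_nonneg _) ?_ hl
  filter_upwards [self_mem_nhdsWithin] with t ht
  refine (hC φ t x 0 H (h.continuousOn.aestronglyMeasurable measurableSet_Ioi) ht hx
    fun y hy => ?_).2
  rw [zero_mul, sub_zero, Real.rpow_one, abs_sub_comm x y]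
  exact hH y x hy hx

/-- Hankel inversion on test functions. -/
lemma IsBesselTest.hankel_inversion (hlam : 1 ≤ lam) (h : IsBesselTest lam φ) {x : ℝ}
    (hx : 0 < x) : φ x = ∫ y in Ioi (0 : ℝ), hankelKernel lam (x * y) * hankel lam φ y := by
  have hi := integrableOn_hankelKernel_mul hlam (h.rapidDecay_hankel hlam)
    (h.continuousOn_hankel hlam) hx
  have h2 : Tendsto (fun t => ∫ y in Ioi (0 : ℝ),
      Real.exp (-t * y ^ 2) * (hankelKernel lam (x * y) * hankel lam φ y)) (𝓝[>] 0)
      (𝓝 (∫ y in Ioi (0 : ℝ), hankelKernel lam (x * y) * hankel lam φ y)) := by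
    refine tendsto_integral_filter_of_dominated_convergence _
      (Eventually.of_forall fun t => (by fun_prop : Continuous fun y : ℝ =>
        Real.exp (-t * y ^ 2)).aestronglyMeasurable.mul hi.aestronglyMeasurable) ?_ hi.norm
      (Eventually.of_forall fun y => ?_)
    · filter_upwards [self_mem_nhdsWithin] with t ht
      refine Eventually.of_forall fun y => ?_
      rw [norm_mul, Real.norm_of_nonneg (Real.exp_pos _).le]
      have ht0 : 0 < t := ht
      have : Real.exp (-t * y ^ 2) ≤ 1 := Real.exp_le_one_iff.2 (by nlinarith [sq_nonneg y])
      exact mul_le_of_le_one_left (norm_nonneg _) this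
    · have hc : Continuous fun t : ℝ =>
          Real.exp (-t * y ^ 2) * (hankelKernel lam (x * y) * hankel lam φ y) := by fun_prop
      have := (hc.tendsto 0).mono_left (nhdsWithin_le_nhds (s := Ioi 0))
      simpa using this
  -- The semigroup tends to φ(x) in physical space and to the double Hankel transform in frequency
  -- space.
  refine tendsto_nhds_unique (h.tendsto_besselHeat hlam hx) (h2.congr' ?_)
  filter_upwards [self_mem_nhdsWithin] with t ht
  exact (h.besselHeat_eq hlam ht hx).symm

lemma IsBesselTest.besselHeat_sub_eq (hlam : 1 ≤ lam) (h : IsBesselTest lam φ) {t x : ℝ}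
    (ht : 0 < t) (hx : 0 < x) : besselHeat lam t φ x - φ x = ∫ y in Ioi (0 : ℝ),
      (Real.exp (-(t * y ^ 2)) - 1) * (hankelKernel lam (x * y) * hankel lam φ y) := by
  have hi := integrableOn_hankelKernel_mul hlam (h.rapidDecay_hankel hlam)
    (h.continuousOn_hankel hlam) hx
  have hi2 : IntegrableOn (fun y => Real.exp (-t * y ^ 2) *
      (hankelKernel lam (x * y) * hankel lam φ y)) (Ioi 0) := by
    refine hi.bdd_mul (c := 1) (by fun_prop : Continuous fun y : ℝ =>
      Real.exp (-t * y ^ 2)).aestronglyMeasurable (Eventually.of_forall fun y => ?_)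
    rw [Real.norm_of_nonneg (Real.exp_pos _).le]
    exact Real.exp_le_one_iff.2 (by nlinarith [sq_nonneg y])
  rw [h.besselHeat_eq hlam ht hx]
  conv_lhs => rw [h.hankel_inversion hlam hx]
  rw [← integral_sub hi2 hi]
  refine integral_congr_ae (Eventually.of_forall fun y => ?_)
  simp only [neg_mul]; ring

/-- Duhamel: a bound on the semigroup applied to the Bessel operator of `φ` controls the
increment of the semigroup on `φ`. -/
lemma IsBesselTest.abs_besselHeat_sub_le (hlam : 1 ≤ lam) (h : IsBesselTest lam φ) {ψ : ℝ → ℝ}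
    (hψ : IsBesselTest lam ψ) (he : ∀ y, 0 < y → hankel lam ψ y = y ^ 2 * hankel lam φ y)
    {t x B : ℝ} (ht : 0 < t) (hx : 0 < x)
    (hB : ∀ s, 0 < s → s ≤ t → |besselHeat lam s ψ x| ≤ B) :
    |besselHeat lam t φ x - φ x| ≤ B * t := by
  have hi := integrableOn_hankelKernel_mul hlam (hψ.rapidDecay_hankel hlam)
    (hψ.continuousOn_hankel hlam) hx
  have hI : Integrable (Function.uncurry fun s y : ℝ =>
      Real.exp (-s * y ^ 2) * (hankelKernel lam (x * y) * hankel lam ψ y))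
      ((volume.restrict (Ioc 0 t)).prod (volume.restrict (Ioi 0))) := by
    have b1 : Integrable (fun _ : ℝ => (1 : ℝ)) (volume.restrict (Ioc 0 t)) := integrable_const 1
    refine (b1.mul_prod hi).bdd_mul (c := 1) (f := fun z : ℝ × ℝ => Real.exp (-z.1 * z.2 ^ 2))
      (by fun_prop : Continuous fun z : ℝ × ℝ => Real.exp (-z.1 * z.2 ^ 2)).aestronglyMeasurable ?_
      |>.congr (Eventually.of_forall fun z => by simp [Function.uncurry])
    rw [Measure.prod_restrict]
    refine (ae_restrict_iff' (measurableSet_Ioc.prod measurableSet_Ioi)).2 (Eventually.of_forall ?_)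
    rintro ⟨s, y⟩ ⟨hs, -⟩
    rw [Real.norm_of_nonneg (Real.exp_pos _).le]
    have hs0 : 0 < s := hs.1
    exact Real.exp_le_one_iff.2 (by nlinarith [sq_nonneg y])
  -- W_t φ - φ = -∫_0^t W_s ψ ds, because ∫_0^t e^{-sy²} y² ds = 1 - e^{-ty²} on the Hankel side.
  have key : besselHeat lam t φ x - φ x = -∫ s in Ioc 0 t, besselHeat lam s ψ x := by
    have e1 : ∫ s in Ioc 0 t, besselHeat lam s ψ x = ∫ s in Ioc 0 t, ∫ y in Ioi (0 : ℝ),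
        Real.exp (-s * y ^ 2) * (hankelKernel lam (x * y) * hankel lam ψ y) :=
      setIntegral_congr_fun measurableSet_Ioc fun s hs => hψ.besselHeat_eq hlam hs.1 hx
    rw [e1, integral_integral_swap hI, h.besselHeat_sub_eq hlam ht hx, ← integral_neg]
    refine setIntegral_congr_fun measurableSet_Ioi fun y hy => ?_
    rw [integral_mul_const, he y hy]
    have e2 : (∫ s in Ioc 0 t, Real.exp (-s * y ^ 2)) * y ^ 2 = 1 - Real.exp (-(t * y ^ 2)) := by
      rw [← intervalIntegral.integral_of_le ht.le, ← intervalIntegral.integral_mul_const]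
      have hd : ∀ s ∈ uIcc 0 t, HasDerivAt (fun s : ℝ => -Real.exp (-s * y ^ 2))
          (Real.exp (-s * y ^ 2) * y ^ 2) s := by
        intro s _
        have := ((((hasDerivAt_id s).neg).mul_const (y ^ 2)).exp).neg
        refine this.congr_deriv ?_
        simp
      rw [intervalIntegral.integral_eq_sub_of_hasDerivAt hd
        ((by fun_prop : Continuous fun s : ℝ => Real.exp (-s * y ^ 2) * y ^ 2).intervalIntegrable _ _)]
      simp; ring
    linear_combination (hankelKernel lam (x * y) * hankel lam φ y) * e2
  rw [key, abs_neg]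
  have := norm_setIntegral_le_of_norm_le_const (μ := volume) (s := Ioc 0 t) (C := B)
    (f := fun s => besselHeat lam s ψ x) (by simp) (fun s hs => hB s hs.1 hs.2)
  simpa [ht.le] using this

/-- Peetre's inequality moves the decay of φ from y to x, uniformly for s ≤ 1. The exponent 3 is
enough because 1 + 2σ < 3. -/
lemma IsBesselTest.exists_abs_besselHeat_le (hlam : 1 ≤ lam) (h : IsBesselTest lam φ) :
    ∃ C, 0 ≤ C ∧ ∀ s x, 0 < s → s ≤ 1 → 0 < x → |besselHeat lam s φ x| ≤ C * (1 + x) ^ (-3 : ℝ) := by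
  obtain ⟨C, hC0, hC⟩ := h.rapidDecay (by linarith) 3
  have m3 := gaussMoment_pos zero_le_three
  refine ⟨4 * C * (1 + gaussMoment 3), by positivity, fun s x hs hs1 hx => ?_⟩
  set D := 4 * C * (1 + x) ^ (-3 : ℝ) with hD
  have hD0 : 0 ≤ D := by positivity
  have g0 := (integrable_gaussKernel_sub le_rfl hs x).integrableOn (s := Ioi 0)
  have g3 := (integrable_gaussKernel_sub zero_le_three hs x).integrableOn (s := Ioi 0)
  have key := (integrableOn_besselHeatKernel_mul hlam hs hx
    (h.continuousOn.aestronglyMeasurable measurableSet_Ioi) ((g0.add g3).const_mul D)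
    (fun y hy => ?_)).2
  · refine key.trans ?_
    simp only [Pi.add_apply]
    rw [integral_const_mul, integral_add g0 g3]
    have v0 := setIntegral_gaussKernel_sub_le le_rfl hs x
    have v3 := setIntegral_gaussKernel_sub_le zero_le_three hs x
    rw [gaussMoment_zero, zero_div, Real.rpow_zero, mul_one] at v0
    have h3 : s ^ (3 / 2 : ℝ) ≤ 1 := Real.rpow_le_one hs.le hs1 (by norm_num)
    calc _ ≤ D * (1 + gaussMoment 3 * 1) := by
          refine mul_le_mul_of_nonneg_left (add_le_add v0 (v3.trans ?_)) hD0
          gcongr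
      _ = _ := by rw [hD]; ring
  · have h1 := hC y hy
    have h2 := peetre_one_add (s := 3) zero_le_three hx hy
    -- With r = |x - y|, the difference 4(1 + r³) - (1 + r)³ equals 3(1 - r)²(1 + r).
    have h3 : (1 + |x - y|) ^ (3 : ℝ) ≤ 4 * (|x - y| ^ (0 : ℝ) + |x - y| ^ (3 : ℝ)) := by
      have hr := abs_nonneg (x - y)
      rw [Real.rpow_zero, show (3 : ℝ) = ((3 : ℕ) : ℝ) by norm_num, Real.rpow_natCast,
        Real.rpow_natCast]
      nlinarith [mul_nonneg (sq_nonneg (1 - |x - y|)) (by linarith : 0 ≤ 1 + |x - y|)]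
    have hx3 : 0 ≤ (1 + x) ^ (-3 : ℝ) := by positivity
    calc gaussKernel s (x - y) * |φ y| ≤ gaussKernel s (x - y) * (C * ((1 + x) ^ (-3 : ℝ) *
          (4 * (|x - y| ^ (0 : ℝ) + |x - y| ^ (3 : ℝ))))) := by
          refine mul_le_mul_of_nonneg_left (h1.trans ?_) (gaussKernel_nonneg _ _)
          exact mul_le_mul_of_nonneg_left (h2.trans (mul_le_mul_of_nonneg_left h3 hx3)) hC0
      _ = _ := by simp only [Pi.add_apply, hD]; ring

/-- Small-time bound for the heat semigroup on test functions. -/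
lemma IsBesselTest.exists_abs_besselHeat_sub_le (hlam : 1 ≤ lam) (h : IsBesselTest lam φ) :
    ∃ C, 0 ≤ C ∧ ∀ t x, 0 < t → t ≤ 1 → 0 < x →
      |besselHeat lam t φ x - φ x| ≤ C * (1 + x) ^ (-3 : ℝ) * t := by
  obtain ⟨ψ, hψ, he⟩ := h.exists_besselOp hlam
  obtain ⟨C, hC0, hC⟩ := hψ.exists_abs_besselHeat_le hlam
  exact ⟨C, hC0, fun t x ht ht1 hx => h.abs_besselHeat_sub_le hlam hψ he ht hx
    fun s hs hst => hC s x hs (hst.trans ht1) hx⟩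

/-- Large-time bound for the heat semigroup on test functions. -/
lemma IsBesselTest.exists_abs_besselHeat_le_large (hlam : 1 ≤ lam) (h : IsBesselTest lam φ) {σ : ℝ}
    (hσ : 0 < σ) : ∃ C, 0 ≤ C ∧ ∀ t x, 1 ≤ t → 0 < x →
      |besselHeat lam t φ x| ≤ C * t ^ (1 + σ) * (t + x ^ 2) ^ (-(3 / 2 + σ)) := by
  obtain ⟨C, hC0, hC⟩ := exists_gaussKernel_le σ
  set q := 3 / 2 + σ with hq
  have hd : RapidDecay fun y => (2 * (1 + y ^ 2)) ^ q * |φ y| := by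
    refine (h.rapidDecay (by linarith)).of_le_mul (K := 2 ^ q) (a := 2 * q) (by positivity)
      fun y hy => ?_
    rw [abs_mul, abs_abs, abs_of_nonneg (by positivity)]
    gcongr
    rw [Real.rpow_mul (by positivity), Real.rpow_two, ← Real.mul_rpow zero_le_two (by positivity)]
    gcongr
    nlinarith
  have hi : IntegrableOn (fun y => (2 * (1 + y ^ 2)) ^ q * |φ y|) (Ioi 0) :=
    hd.integrableOn (ContinuousOn.mul (ContinuousOn.rpow_const (by fun_prop)
      fun y _ => Or.inl (by positivity)) h.continuousOn.abs)
  have hI0 : 0 ≤ ∫ y in Ioi (0 : ℝ), (2 * (1 + y ^ 2)) ^ q * |φ y| :=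
    integral_nonneg fun y => by positivity
  refine ⟨C * ∫ y in Ioi (0 : ℝ), (2 * (1 + y ^ 2)) ^ q * |φ y|, by positivity,
    fun t x ht hx => ?_⟩
  have ht0 : 0 < t := by linarith
  refine (integrableOn_besselHeatKernel_mul hlam ht0 hx
    (h.continuousOn.aestronglyMeasurable measurableSet_Ioi)
    (hi.const_mul (C * t ^ (1 + σ) * (t + x ^ 2) ^ (-q))) (fun y hy => ?_)).2.trans (le_of_eq ?_)
  · have h1 := hC t (x - y) ht0
    -- Peetre with the roles exchanged: the loss falls on y, where φ decays, and the gain (t +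
    -- x²)^{-q} remains in x.
    have h2 := peetre_parabolic (q := q) (by positivity) ht0 y x
    have h3 : y ^ 2 / t ≤ y ^ 2 := div_le_self (sq_nonneg y) ht
    rw [← neg_sub x y, neg_sq] at h2
    calc gaussKernel t (x - y) * |φ y|
        ≤ (C * t ^ (1 + σ) * ((2 * (1 + y ^ 2)) ^ q * (t + x ^ 2) ^ (-q))) * |φ y| := by
          gcongr
          refine h1.trans ?_
          gcongr
          refine h2.trans ?_
          gcongr
      _ = _ := by ring
  · rw [integral_const_mul]; ring

/-- The fractional Bessel operator on test functions through the heat semigroup. -/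
lemma IsBesselTest.fracBesselTest_eq (hlam : 1 ≤ lam) (h : IsBesselTest lam φ) {σ : ℝ}
    (hσ0 : 0 < σ) (hσ1 : σ < 1) {x : ℝ} (hx : 0 < x) :
    fracBesselTest lam σ φ x = (Real.Gamma (-σ))⁻¹ *
      ∫ t in Ioi (0 : ℝ), (besselHeat lam t φ x - φ x) * t ^ (-(1 + σ)) := by
  have hΓ : Real.Gamma (-σ) ≠ 0 := by
    refine Real.Gamma_ne_zero fun m hm => ?_
    rcases m with _ | m
    · simp at hm; linarith
    · push_cast at hm; nlinarith [(Nat.cast_nonneg m : (0 : ℝ) ≤ m)]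
  have hr := h.rapidDecay_hankel hlam
  have hcn := h.continuousOn_hankel hlam
  -- The factor 1 + y² comes from |e^{-ty²} - 1| ≤ (1 + y²) min(t,1), which separates the variables
  -- for Fubini.
  have hd : RapidDecay fun y => (1 + y ^ 2) * hankel lam φ y := by
    refine hr.of_le_mul (K := 1) (a := 2) zero_le_one fun y hy => ?_
    rw [abs_mul, abs_of_nonneg (by positivity), one_mul, Real.rpow_two]
    gcongr
    nlinarith
  have hi := integrableOn_hankelKernel_mul hlam hd (ContinuousOn.mul (by fun_prop) hcn) hx
  have hI : Integrable (Function.uncurry fun t y : ℝ => (Real.exp (-(t * y ^ 2)) - 1) *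
      (hankelKernel lam (x * y) * hankel lam φ y) * t ^ (-(1 + σ)))
      ((volume.restrict (Ioi 0)).prod (volume.restrict (Ioi 0))) := by
    have b1 : Integrable (fracWeight σ) (volume.restrict (Ioi 0)) :=
      integrableOn_fracWeight hσ0 hσ1
    refine Integrable.mono' (b1.mul_prod hi.norm) ?_ ?_
    · rw [Measure.prod_restrict]
      refine ContinuousOn.aestronglyMeasurable ?_ (measurableSet_Ioi.prod measurableSet_Ioi)
      refine ContinuousOn.mul (ContinuousOn.mul (by fun_prop) (ContinuousOn.mul ?_ ?_)) ?_
      · exact (continuousOn_hankelKernel hlam).comp (by fun_prop) fun z hz => mul_pos hx hz.2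
      · exact hcn.comp (by fun_prop) fun z hz => hz.2
      · exact ContinuousOn.rpow_const (by fun_prop) fun z hz => Or.inl (ne_of_gt hz.1)
    · rw [Measure.prod_restrict]
      refine (ae_restrict_iff' (measurableSet_Ioi.prod measurableSet_Ioi)).2
        (Eventually.of_forall ?_)
      rintro ⟨t, y⟩ ⟨ht, hy⟩
      have ht0 : 0 < t := ht
      simp only [Function.uncurry, fracWeight]
      rw [norm_mul, norm_mul, norm_mul, norm_mul, norm_mul,
        Real.norm_of_nonneg (by positivity : 0 ≤ t ^ (-(1 + σ))),
        Real.norm_of_nonneg (by positivity : 0 ≤ 1 + y ^ 2), Real.norm_eq_abs]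
      calc _ ≤ ((1 + y ^ 2) * min t 1) * (‖hankelKernel lam (x * y)‖ * ‖hankel lam φ y‖)
            * t ^ (-(1 + σ)) := by
            gcongr; exact abs_exp_neg_mul_sub_one_le ht0.le (sq_nonneg y)
        _ = _ := by ring
  have e1 : ∫ t in Ioi (0 : ℝ), (besselHeat lam t φ x - φ x) * t ^ (-(1 + σ))
      = ∫ t in Ioi (0 : ℝ), ∫ y in Ioi (0 : ℝ), (Real.exp (-(t * y ^ 2)) - 1) *
      (hankelKernel lam (x * y) * hankel lam φ y) * t ^ (-(1 + σ)) := by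
    refine setIntegral_congr_fun measurableSet_Ioi fun t ht => ?_
    rw [h.besselHeat_sub_eq hlam ht hx, integral_mul_const]
  rw [e1, integral_integral_swap hI, fracBesselTest, hankel_eq, ← integral_const_mul]
  refine setIntegral_congr_fun measurableSet_Ioi fun y hy => ?_
  have hy0 : 0 < y := hy
  have e2 : ∀ t : ℝ, (Real.exp (-(t * y ^ 2)) - 1) *
      (hankelKernel lam (x * y) * hankel lam φ y) * t ^ (-(1 + σ))
      = (hankelKernel lam (x * y) * hankel lam φ y) *
        ((Real.exp (-(t * y ^ 2)) - 1) * t ^ (-(1 + σ))) := fun t => by ring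
  simp only [e2]
  rw [integral_const_mul, integral_exp_neg_sub_one_mul hσ0 hσ1 (by positivity),
    Real.rpow_mul hy0.le, Real.rpow_two]
  field_simp

end TestFunctions

/-! ### The class L_σ at large times -/

section Weights

variable {σ : ℝ} {u : ℝ → ℝ}

lemma ae_prod_Ioi_of_forall {P : ℝ × ℝ → Prop} (h : ∀ x y, 0 < x → 0 < y → P (x, y)) :
    ∀ᵐ z ∂((volume.restrict (Ioi (0 : ℝ))).prod (volume.restrict (Ioi (0 : ℝ)))), P z := by
  rw [Measure.prod_restrict]
  exact (ae_restrict_iff' (measurableSet_Ioi.prod measurableSet_Ioi)).2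
    (Eventually.of_forall fun z hz => h z.1 z.2 hz.1 hz.2)

lemma ContinuousOn.aestronglyMeasurable_prod_Ioi {f : ℝ × ℝ → ℝ}
    (hf : ContinuousOn f (Ioi 0 ×ˢ Ioi 0)) :
    AEStronglyMeasurable f ((volume.restrict (Ioi 0)).prod (volume.restrict (Ioi 0))) := by
  rw [Measure.prod_restrict]
  exact hf.aestronglyMeasurable (measurableSet_Ioi.prod measurableSet_Ioi)

lemma MemLWeight.integrableOn_abs_mul (hu : MemLWeight σ u) :
    IntegrableOn (fun x => |u x| * (1 + x) ^ (-(1 + 2 * σ))) (Ioi 0) := by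
  refine (Integrable.norm hu).congr (ae_Ioi_of_forall fun x hx => ?_)
  have : 0 ≤ (1 + x) ^ (1 + 2 * σ) := by positivity
  simp only [norm_div, Real.norm_eq_abs]
  rw [abs_of_nonneg this, Real.rpow_neg (by positivity), div_eq_mul_inv]

lemma MemLWeight.integrableOn_of_le (hu : MemLWeight σ u) (hc : ContinuousOn u (Ioi 0))
    {w : ℝ → ℝ} (hw : ContinuousOn w (Ioi 0)) {K : ℝ}
    (h : ∀ x, 0 < x → |w x| ≤ K * (1 + x) ^ (-(1 + 2 * σ))) :
    IntegrableOn (fun x => |u x| * w x) (Ioi 0) := by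
  refine Integrable.mono' (hu.integrableOn_abs_mul.const_mul K)
    ((hc.abs.mul hw).aestronglyMeasurable measurableSet_Ioi) (ae_Ioi_of_forall fun x hx => ?_)
  rw [norm_mul, Real.norm_eq_abs, abs_abs, Real.norm_eq_abs, mul_left_comm]
  exact mul_le_mul_of_nonneg_left (h x hx) (abs_nonneg _)

lemma one_add_sq_rpow_le {s y : ℝ} (hs : 0 ≤ s) (hy : 0 < y) :
    (1 + y ^ 2) ^ (-s) ≤ 2 ^ s * (1 + y) ^ (-(2 * s)) := by
  have h1 : (1 + y) ^ (2 * s) = ((1 + y) ^ 2) ^ s := by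
    rw [Real.rpow_mul (by positivity), Real.rpow_two]
  rw [Real.rpow_neg (by positivity), Real.rpow_neg (by positivity), h1, ← div_eq_mul_inv,
    inv_le_comm₀ (by positivity) (by positivity), inv_div, div_le_iff₀ (by positivity), mul_comm,
    ← Real.mul_rpow (by positivity) (by positivity)]
  exact Real.rpow_le_rpow (by positivity) (by nlinarith [sq_nonneg (1 - y)]) hs

lemma continuousOn_parabolic_weight {t q : ℝ} (ht : 0 < t) :
    ContinuousOn (fun y : ℝ => (t + y ^ 2) ^ (-q)) (Ioi 0) :=
  ContinuousOn.rpow_const (by fun_prop) fun y _ => Or.inl (by positivity)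

/-- For fixed t the weight decays like (1 + y)^{-(3+2σ)}, two powers better than L_σ requires. -/
lemma MemLWeight.integrableOn_parabolic (hσ : 0 < σ) (hu : MemLWeight σ u)
    (hc : ContinuousOn u (Ioi 0)) {t : ℝ} (ht : 0 < t) :
    IntegrableOn (fun y => |u y| * (t + y ^ 2) ^ (-(3 / 2 + σ))) (Ioi 0) := by
  set q := 3 / 2 + σ with hq
  have hq0 : 0 < q := by positivity
  refine hu.integrableOn_of_le hc (continuousOn_parabolic_weight ht)
    (K := (1 + 1 / t) ^ q * 2 ^ q) fun y hy => ?_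
  have h1 : 1 + y ^ 2 ≤ (1 + 1 / t) * (t + y ^ 2) := by
    have : 1 / t * t = 1 := by field_simp
    have h2 : 0 < 1 / t := by positivity
    nlinarith [mul_nonneg h2.le (sq_nonneg y)]
  have h2 : (t + y ^ 2) ^ (-q) ≤ (1 + 1 / t) ^ q * (1 + y ^ 2) ^ (-q) := by
    rw [Real.rpow_neg (by positivity), Real.rpow_neg (by positivity), ← div_eq_mul_inv,
      inv_le_comm₀ (by positivity) (by positivity), inv_div, div_le_iff₀ (by positivity), mul_comm,
      ← Real.mul_rpow (by positivity) (by positivity)]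
    exact Real.rpow_le_rpow (by positivity) h1 hq0.le
  rw [abs_of_nonneg (by positivity)]
  have h3 := one_add_sq_rpow_le hq0.le hy
  have h4 : (1 + y) ^ (-(2 * q)) ≤ (1 + y) ^ (-(1 + 2 * σ)) :=
    Real.rpow_le_rpow_of_exponent_le (by linarith) (by linarith)
  calc _ ≤ (1 + 1 / t) ^ q * (2 ^ q * (1 + y) ^ (-(1 + 2 * σ))) := by
        refine h2.trans ?_
        gcongr
        exact h3.trans (by gcongr)
    _ = _ := by ring

lemma integral_parabolic_weight {q c : ℝ} (hq : 1 < q) (hc : 0 ≤ c) :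
    ∫ t in Ioi (1 : ℝ), (t + c) ^ (-q) = (1 + c) ^ (-(q - 1)) / (q - 1) := by
  have hd : ∀ t ∈ Ici (1 : ℝ), HasDerivAt (fun t => (t + c) ^ (-(q - 1)) / (-(q - 1)))
      ((t + c) ^ (-q)) t := by
    intro t ht
    have ht0 : 0 < t + c := by linarith [mem_Ici.1 ht]
    have := (((hasDerivAt_id t).add_const c).rpow_const (p := -(q - 1))
      (Or.inl ht0.ne')).div_const (-(q - 1))
    refine this.congr_deriv ?_
    rw [one_mul, mul_div_cancel_left₀ _ (by linarith : -(q - 1) ≠ 0)]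
    simp only [id]; congr 1; ring
  have hl : Tendsto (fun t : ℝ => (t + c) ^ (-(q - 1)) / (-(q - 1))) atTop (𝓝 0) := by
    have := ((tendsto_rpow_neg_atTop (by linarith : 0 < q - 1)).comp
      (tendsto_atTop_add_const_right atTop c tendsto_id)).div_const (-(q - 1))
    simpa only [zero_div, Function.comp_def, id] using this
  rw [integral_Ioi_of_hasDerivAt_of_tendsto' hd
    (integrableOn_add_rpow_Ioi_of_lt (by linarith) (by linarith)) hl, zero_sub, div_neg, neg_neg]

/-- Functions of the weighted class are jointly integrable against the parabolic weight. -/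
lemma MemLWeight.integrable_parabolic_prod (hσ : 0 < σ) (hu : MemLWeight σ u)
    (hc : ContinuousOn u (Ioi 0)) :
    Integrable (fun z : ℝ × ℝ => (Ioi 1).indicator
      (fun t => |u z.2| * (t + z.2 ^ 2) ^ (-(3 / 2 + σ))) z.1)
      ((volume.restrict (Ioi 0)).prod (volume.restrict (Ioi 0))) := by
  set q := 3 / 2 + σ with hq
  have hq1 : 1 < q := by linarith
  have hmeas : AEStronglyMeasurable (fun z : ℝ × ℝ => (Ioi 1).indicator
      (fun t => |u z.2| * (t + z.2 ^ 2) ^ (-q)) z.1)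
      ((volume.restrict (Ioi 0)).prod (volume.restrict (Ioi 0))) := by
    have h1 : AEStronglyMeasurable (fun z : ℝ × ℝ => |u z.2| * (z.1 + z.2 ^ 2) ^ (-q))
        ((volume.restrict (Ioi 0)).prod (volume.restrict (Ioi 0))) := by
      refine ContinuousOn.aestronglyMeasurable_prod_Ioi (ContinuousOn.mul ?_ ?_)
      · exact hc.abs.comp (by fun_prop) fun z hz => hz.2
      · refine ContinuousOn.rpow_const (by fun_prop) fun z hz => Or.inl ?_
        have : 0 < z.1 := hz.1
        positivity
    exact h1.indicator (s := {z : ℝ × ℝ | z.1 ∈ Ioi 1}) (measurable_fst measurableSet_Ioi)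
  have hslice : ∀ y : ℝ, Integrable (fun t => (Ioi 1).indicator
      (fun t => |u y| * (t + y ^ 2) ^ (-q)) t) (volume.restrict (Ioi 0)) := by
    intro y
    have : IntegrableOn (fun t => |u y| * (t + y ^ 2) ^ (-q)) (Ioi 1) :=
      (integrableOn_add_rpow_Ioi_of_lt (by linarith) (by nlinarith [sq_nonneg y])).const_mul _
    exact ((integrable_indicator_iff measurableSet_Ioi).2 this).integrableOn
  refine (integrable_prod_iff' hmeas).2 ⟨Eventually.of_forall hslice, ?_⟩
  -- Integrating in t first leaves (1 + y²)^{-(1/2+σ)}, which the weight (1 + y)^{-(1+2σ)} controls: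
  -- the class L_σ is exactly matched here.
  have hval : ∀ y : ℝ, ∫ t in Ioi (0 : ℝ), ‖(Ioi 1).indicator
      (fun t => |u y| * (t + y ^ 2) ^ (-q)) t‖ = |u y| * ((1 + y ^ 2) ^ (-(q - 1)) / (q - 1)) := by
    intro y
    have e : ∀ t : ℝ, ‖(Ioi 1).indicator (fun t => |u y| * (t + y ^ 2) ^ (-q)) t‖
        = (Ioi 1).indicator (fun t => |u y| * (t + y ^ 2) ^ (-q)) t := by
      intro t
      refine Real.norm_of_nonneg (indicator_nonneg (fun t ht => ?_) t)
      have : 0 < t := lt_trans one_pos ht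
      positivity
    simp only [e]
    rw [setIntegral_indicator measurableSet_Ioi, inter_eq_right.2 (Ioi_subset_Ioi zero_le_one),
      integral_const_mul, integral_parabolic_weight hq1 (sq_nonneg y)]
  simp only [hval]
  refine hu.integrableOn_of_le hc (K := 2 ^ (q - 1) / (q - 1)) ?_ fun y hy => ?_
  · exact (ContinuousOn.rpow_const (by fun_prop) fun y _ => Or.inl (by positivity)).div_const _
  · have h1 : 0 < q - 1 := by linarith
    have := one_add_sq_rpow_le (s := q - 1) h1.le hy
    rw [abs_of_nonneg (by positivity), div_mul_eq_mul_div]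
    gcongr
    refine this.trans (le_of_eq ?_)
    rw [hq]; ring_nf

/-- The large-time profile of the semigroup on the weighted class. -/
def parabolicMass (σ : ℝ) (u : ℝ → ℝ) (t : ℝ) : ℝ :=
  ∫ y in Ioi (0 : ℝ), |u y| * (t + y ^ 2) ^ (-(3 / 2 + σ))

lemma MemLWeight.integrableOn_parabolicMass (hσ : 0 < σ) (hu : MemLWeight σ u)
    (hc : ContinuousOn u (Ioi 0)) :
    IntegrableOn ((Ioi 1).indicator (parabolicMass σ u)) (Ioi 0) := by
  refine (hu.integrable_parabolic_prod hσ hc).integral_prod_left.congr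
    (Eventually.of_forall fun t => ?_)
  by_cases ht : t ∈ Ioi (1 : ℝ)
  · simp only [indicator_of_mem ht, parabolicMass]
  · simp only [indicator_of_notMem ht, integral_zero]

/-- The polynomial tail and Peetre's inequality make x enter only through (1 + x²/t)^q. For t ≥ 1
this is a polynomial loss, harmless against test functions, and C does not depend on u. -/
lemma exists_besselHeat_le_parabolicMass {lam : ℝ} (hlam : 1 ≤ lam) (hσ : 0 < σ) : ∃ C, 0 ≤ C ∧
    ∀ u : ℝ → ℝ, MemLWeight σ u → ContinuousOn u (Ioi 0) → ∀ t x : ℝ, 0 < t → 0 < x →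
      (∀ y, gaussKernel t (x - y) ≤
        C * t ^ (1 + σ) * (2 * (1 + x ^ 2 / t)) ^ (3 / 2 + σ) * (t + y ^ 2) ^ (-(3 / 2 + σ))) ∧
      |besselHeat lam t u x| ≤
        C * t ^ (1 + σ) * (2 * (1 + x ^ 2 / t)) ^ (3 / 2 + σ) * parabolicMass σ u t := by
  obtain ⟨C, hC0, hC⟩ := exists_gaussKernel_le σ
  refine ⟨C, hC0, fun u hu hc t x ht hx => ?_⟩
  have h1 : ∀ y, gaussKernel t (x - y) ≤
      C * t ^ (1 + σ) * (2 * (1 + x ^ 2 / t)) ^ (3 / 2 + σ) * (t + y ^ 2) ^ (-(3 / 2 + σ)) := by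
    intro y
    refine (hC t (x - y) ht).trans ?_
    rw [mul_assoc (C * t ^ (1 + σ))]
    gcongr
    exact peetre_parabolic (by positivity) ht x y
  refine ⟨h1, ?_⟩
  have := (integrableOn_besselHeatKernel_mul hlam ht hx (hc.aestronglyMeasurable measurableSet_Ioi)
    ((hu.integrableOn_parabolic hσ hc ht).const_mul
      (C * t ^ (1 + σ) * (2 * (1 + x ^ 2 / t)) ^ (3 / 2 + σ)))
    (fun y hy => (mul_le_mul_of_nonneg_right (h1 y) (abs_nonneg _)).trans (le_of_eq (by ring)))).2
  rwa [integral_const_mul] at this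

end Weights

/-! ### The heat formula by duality -/

/-- Functions on which the heat-semigroup formula for the fractional Bessel operator makes sense:
`A` controls the small-time increments of the semigroup. -/
structure HeatRegular (lam σ β : ℝ) (u A : ℝ → ℝ) : Prop where
  cont : ContinuousOn u (Ioi 0)
  weight : MemLWeight σ u
  exponent : 2 * σ < β
  contBound : ContinuousOn A (Ioi 0)
  small : ∀ t x, 0 < t → t ≤ 1 → 0 < x → |besselHeat lam t u x - u x| ≤ A x * (t ^ (β / 2) + t)
  integrable : ∀ t x, 0 < t → 0 < x → IntegrableOn (fun y => besselHeatKernel lam t x y * u y) (Ioi 0)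
  testBound : ∀ φ, IsBesselTest lam φ → IntegrableOn (fun x => A x * φ x) (Ioi 0)
  test : ∀ φ, IsBesselTest lam φ → IntegrableOn (fun x => u x * φ x) (Ioi 0)

/-- The heat-semigroup formula for the fractional Bessel operator. -/
def heatFrac (lam σ : ℝ) (u : ℝ → ℝ) (x : ℝ) : ℝ :=
  (Real.Gamma (-σ))⁻¹ * ∫ t in Ioi (0 : ℝ), (besselHeat lam t u x - u x) / t ^ (1 + σ)

section Main

variable {lam σ β : ℝ} {u A : ℝ → ℝ}

/-- The time profile dominating the increments of the semigroup. -/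
def timeProfile (σ β : ℝ) (u : ℝ → ℝ) (t : ℝ) : ℝ :=
  (Ioc 0 1).indicator (fun t => t ^ (β / 2 - (1 + σ)) + t ^ (-σ)) t +
    ((Ioi 1).indicator (parabolicMass σ u) t + (Ioi 1).indicator (fun t => t ^ (-(1 + σ))) t)

/-- At the origin 2σ < β and σ < 1 make both exponents exceed -1; at infinity the parabolic mass and
σ > 0 suffice. -/
lemma HeatRegular.integrableOn_timeProfile (hσ0 : 0 < σ) (hσ1 : σ < 1)
    (h : HeatRegular lam σ β u A) : IntegrableOn (timeProfile σ β u) (Ioi 0) := by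
  refine Integrable.add ?_ (Integrable.add (h.weight.integrableOn_parabolicMass hσ0 h.cont) ?_)
  · have := h.exponent
    exact ((integrable_indicator_iff measurableSet_Ioc).2 ((integrableOn_rpow_Ioc
      (by linarith)).add (integrableOn_rpow_Ioc (by linarith)))).integrableOn
  · exact ((integrable_indicator_iff measurableSet_Ioi).2 (integrableOn_Ioi_rpow_of_lt
      (by linarith) one_pos)).integrableOn

lemma parabolicMass_nonneg {t : ℝ} (ht : 0 < t) : 0 ≤ parabolicMass σ u t :=
  integral_nonneg fun y => by positivity

lemma timeProfile_nonneg (t : ℝ) : 0 ≤ timeProfile σ β u t := by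
  refine add_nonneg (indicator_nonneg (fun s hs => ?_) t)
    (add_nonneg (indicator_nonneg (fun s hs => ?_) t) (indicator_nonneg (fun s hs => ?_) t))
  · have : 0 < s := hs.1
    positivity
  · exact parabolicMass_nonneg (lt_trans one_pos hs)
  · have : 0 < s := lt_trans one_pos hs
    positivity

/-- The increments of the semigroup are dominated by a product of a space and a time profile. -/
lemma HeatRegular.exists_profile (hlam : 1 ≤ lam) (hσ0 : 0 < σ) (h : HeatRegular lam σ β u A) :
    ∃ E : ℝ → ℝ, ContinuousOn E (Ioi 0) ∧
      (∀ φ, IsBesselTest lam φ → IntegrableOn (fun x => E x * φ x) (Ioi 0)) ∧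
      ∀ t x, 0 < t → 0 < x →
        |(besselHeat lam t u x - u x) / t ^ (1 + σ)| ≤ E x * timeProfile σ β u t := by
  obtain ⟨C, hC0, hC⟩ := exists_besselHeat_le_parabolicMass hlam hσ0
  set q := 3 / 2 + σ with hq
  -- |A| covers t ≤ 1; for t > 1 the second term covers W_t u and |u| covers the subtracted value.
  refine ⟨fun x => |A x| + (C * (2 * (1 + x ^ 2)) ^ q + |u x|), ?_, fun φ hφ => ?_,
    fun t x ht hx => ?_⟩
  · exact h.contBound.abs.add ((continuousOn_const.mul (ContinuousOn.rpow_const (by fun_prop)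
      fun y _ => Or.inl (by positivity))).add h.cont.abs)
  · have hd : RapidDecay fun y => (2 * (1 + y ^ 2)) ^ q * φ y := by
      refine (hφ.rapidDecay (by linarith)).of_le_mul (K := 2 ^ q) (a := 2 * q) (by positivity)
        fun y hy => ?_
      rw [abs_mul, abs_of_nonneg (by positivity)]
      gcongr
      rw [Real.rpow_mul (by positivity), Real.rpow_two, ← Real.mul_rpow zero_le_two (by positivity)]
      gcongr
      nlinarith
    have hi : IntegrableOn (fun y => (2 * (1 + y ^ 2)) ^ q * φ y) (Ioi 0) :=
      hd.integrableOn (ContinuousOn.mul (ContinuousOn.rpow_const (by fun_prop)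
        fun y _ => Or.inl (by positivity)) hφ.continuousOn)
    have habs : ∀ f : ℝ → ℝ, ContinuousOn f (Ioi 0) → IntegrableOn (fun x => f x * φ x) (Ioi 0) →
        IntegrableOn (fun x => |f x| * φ x) (Ioi 0) := by
      intro f hf hi
      refine Integrable.mono hi ((hf.abs.mul hφ.continuousOn).aestronglyMeasurable
        measurableSet_Ioi) (Eventually.of_forall fun x => ?_)
      simp
    refine ((habs A h.contBound (h.testBound φ hφ)).add ((hi.const_mul C).add
      (habs u h.cont (h.test φ hφ)))).congr (Eventually.of_forall fun x => ?_)
    simp only [Pi.add_apply]; ring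
  · have htp : 0 < t ^ (1 + σ) := by positivity
    rw [abs_div, abs_of_pos htp, div_le_iff₀ htp]
    have hq0 : 0 ≤ C * (2 * (1 + x ^ 2)) ^ q := by positivity
    rcases le_or_gt t 1 with ht1 | ht1
    · have m1 : t ∈ Ioc (0 : ℝ) 1 := ⟨ht, ht1⟩
      have m2 : t ∉ Ioi (1 : ℝ) := fun hh => absurd ht1 (not_le.2 hh)
      rw [timeProfile, indicator_of_mem m1, indicator_of_notMem m2, indicator_of_notMem m2, add_zero,
        add_zero]
      have e : (t ^ (β / 2 - (1 + σ)) + t ^ (-σ)) * t ^ (1 + σ) = t ^ (β / 2) + t := by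
        rw [add_mul, ← Real.rpow_add ht, ← Real.rpow_add ht, sub_add_cancel,
          show -σ + (1 + σ) = 1 by ring, Real.rpow_one]
      rw [mul_assoc, e]
      have h0 : 0 ≤ t ^ (β / 2) + t := by positivity
      refine (h.small t x ht ht1 hx).trans (mul_le_mul_of_nonneg_right ?_ h0)
      linarith [le_abs_self (A x), abs_nonneg (u x)]
    · have m1 : t ∉ Ioc (0 : ℝ) 1 := fun hh => absurd hh.2 (not_le.2 ht1)
      have m2 : t ∈ Ioi (1 : ℝ) := ht1
      rw [timeProfile, indicator_of_notMem m1, indicator_of_mem m2, indicator_of_mem m2, zero_add]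
      have e : t ^ (-(1 + σ)) * t ^ (1 + σ) = 1 := by
        rw [← Real.rpow_add ht, neg_add_cancel, Real.rpow_zero]
      have hm := parabolicMass_nonneg (σ := σ) (u := u) ht
      have h1 := (hC u h.weight h.cont t x ht hx).2
      have h2 : x ^ 2 / t ≤ x ^ 2 := div_le_self (sq_nonneg x) ht1.le
      have h3 : C * t ^ (1 + σ) * (2 * (1 + x ^ 2 / t)) ^ q * parabolicMass σ u t
          ≤ C * t ^ (1 + σ) * (2 * (1 + x ^ 2)) ^ q * parabolicMass σ u t := by gcongr
      set P := C * (2 * (1 + x ^ 2)) ^ q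
      have e2 : (|A x| + (P + |u x|)) * (parabolicMass σ u t + t ^ (-(1 + σ))) * t ^ (1 + σ)
          = (|A x| + (P + |u x|)) * (parabolicMass σ u t * t ^ (1 + σ) + 1) := by
        rw [mul_assoc, add_mul (parabolicMass σ u t), e]
      rw [e2]
      have hA := abs_nonneg (A x)
      have hU := abs_nonneg (u x)
      have hm' : 0 ≤ parabolicMass σ u t * t ^ (1 + σ) := by positivity
      calc |besselHeat lam t u x - u x| ≤ |besselHeat lam t u x| + |u x| := abs_sub _ _
        _ ≤ P * (parabolicMass σ u t * t ^ (1 + σ)) + |u x| := by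
          gcongr
          refine (h1.trans h3).trans (le_of_eq ?_); ring
        _ ≤ _ := by nlinarith [mul_nonneg hA hm', mul_nonneg hU hm']

lemma aestronglyMeasurable_besselHeat_time (hlam : 1 ≤ lam)
    (hu : AEStronglyMeasurable u (volume.restrict (Ioi 0))) {x : ℝ} (hx : 0 < x) :
    AEStronglyMeasurable (fun t => besselHeat lam t u x) (volume.restrict (Ioi 0)) := by
  have h1 : AEStronglyMeasurable (fun z : ℝ × ℝ => besselHeatKernel lam z.1 x z.2)
      ((volume.restrict (Ioi 0)).prod (volume.restrict (Ioi 0))) :=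
    ContinuousOn.aestronglyMeasurable_prod_Ioi ((continuousOn_besselHeatKernel hlam).comp
      (f := fun z : ℝ × ℝ => ((z.1, x), z.2)) (by fun_prop) fun z hz => ⟨⟨hz.1, hx⟩, hz.2⟩)
  exact (h1.mul hu.comp_snd).integral_prod_right'

lemma HeatRegular.integrableOn_time (hlam : 1 ≤ lam) (hσ0 : 0 < σ) (hσ1 : σ < 1)
    (h : HeatRegular lam σ β u A) {x : ℝ} (hx : 0 < x) :
    IntegrableOn (fun t => (besselHeat lam t u x - u x) / t ^ (1 + σ)) (Ioi 0) := by
  obtain ⟨E, -, -, hE⟩ := h.exists_profile hlam hσ0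
  have hp : ContinuousOn (fun t : ℝ => t ^ (1 + σ)) (Ioi 0) :=
    (Real.continuous_rpow_const (by linarith)).continuousOn
  refine Integrable.mono' ((h.integrableOn_timeProfile hσ0 hσ1).const_mul (E x)) ?_
    (ae_Ioi_of_forall fun t ht => hE t x ht hx)
  exact (((aestronglyMeasurable_besselHeat_time hlam (h.cont.aestronglyMeasurable measurableSet_Ioi)
    hx).sub aestronglyMeasurable_const).aemeasurable.div
      (hp.aestronglyMeasurable measurableSet_Ioi).aemeasurable).aestronglyMeasurable

/-- Dominated convergence: Peetre's factor is continuous in x, so near x0 a single multiple of |u|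
(t + y²)^{-q} dominates. -/
lemma continuousOn_besselHeat (hlam : 1 ≤ lam) (hσ0 : 0 < σ) (hu : MemLWeight σ u)
    (hc : ContinuousOn u (Ioi 0)) {t : ℝ} (ht : 0 < t) :
    ContinuousOn (besselHeat lam t u) (Ioi 0) := by
  obtain ⟨C, hC0, hC⟩ := exists_besselHeat_le_parabolicMass hlam hσ0
  intro x0 hx0
  refine ContinuousAt.continuousWithinAt ?_
  set q := 3 / 2 + σ with hq
  have hcont : ContinuousAt (fun x : ℝ => (2 * (1 + x ^ 2 / t)) ^ q) x0 :=
    ContinuousAt.rpow_const (by fun_prop) (Or.inl (by positivity))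
  have hev : ∀ᶠ x in 𝓝 x0, (2 * (1 + x ^ 2 / t)) ^ q < (2 * (1 + x0 ^ 2 / t)) ^ q + 1 :=
    hcont.eventually (gt_mem_nhds (by linarith))
  have hpos : ∀ᶠ x in 𝓝 x0, 0 < x := Ioi_mem_nhds hx0
  refine continuousAt_of_dominated (bound := fun y => C * t ^ (1 + σ) *
    ((2 * (1 + x0 ^ 2 / t)) ^ q + 1) * (|u y| * (t + y ^ 2) ^ (-q))) ?_ ?_
    ((hu.integrableOn_parabolic hσ0 hc ht).const_mul _) ?_
  · filter_upwards [hpos] with x hx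
    exact ((continuousOn_besselHeatKernel_right hlam ht hx).mul hc).aestronglyMeasurable
      measurableSet_Ioi
  · filter_upwards [hpos, hev] with x hx hx2
    refine ae_Ioi_of_forall fun y hy => ?_
    rw [norm_mul, Real.norm_eq_abs, Real.norm_eq_abs]
    have h1 := (abs_besselHeatKernel_le hlam ht hx hy).trans ((hC u hu hc t x ht hx).1 y)
    calc _ ≤ (C * t ^ (1 + σ) * ((2 * (1 + x0 ^ 2 / t)) ^ q + 1) * (t + y ^ 2) ^ (-q)) * |u y| := by
          gcongr
          refine h1.trans ?_
          gcongr
      _ = _ := by ring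
  · exact ae_Ioi_of_forall fun y hy => ((continuousOn_besselHeatKernel_mid hlam ht hy).continuousAt
      (Ioi_mem_nhds hx0)).mul continuousAt_const

lemma HeatRegular.continuousOn_heatFrac (hlam : 1 ≤ lam) (hσ0 : 0 < σ) (hσ1 : σ < 1)
    (h : HeatRegular lam σ β u A) : ContinuousOn (heatFrac lam σ u) (Ioi 0) := by
  obtain ⟨E, hEc, -, hE⟩ := h.exists_profile hlam hσ0
  refine continuousOn_const.mul ?_
  intro x0 hx0
  refine ContinuousAt.continuousWithinAt ?_
  have hev : ∀ᶠ x in 𝓝 x0, E x < E x0 + 1 :=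
    (hEc.continuousAt (Ioi_mem_nhds hx0)).eventually (gt_mem_nhds (by linarith))
  have hpos : ∀ᶠ x in 𝓝 x0, 0 < x := Ioi_mem_nhds hx0
  refine continuousAt_of_dominated (bound := fun t => (E x0 + 1) * timeProfile σ β u t) ?_ ?_
    ((h.integrableOn_timeProfile hσ0 hσ1).const_mul _) ?_
  · filter_upwards [hpos] with x hx
    exact (h.integrableOn_time hlam hσ0 hσ1 hx).aestronglyMeasurable
  · filter_upwards [hpos, hev] with x hx hx2
    refine ae_Ioi_of_forall fun t ht => (hE t x ht hx).trans ?_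
    exact mul_le_mul_of_nonneg_right hx2.le (timeProfile_nonneg t)
  · refine ae_Ioi_of_forall fun t ht => ContinuousAt.div_const (ContinuousAt.sub ?_ ?_) _
    · exact (continuousOn_besselHeat hlam hσ0 h.weight h.cont ht).continuousAt (Ioi_mem_nhds hx0)
    · exact h.cont.continuousAt (Ioi_mem_nhds hx0)

lemma aestronglyMeasurable_increment (hlam : 1 ≤ lam) (hσ0 : 0 < σ) (hc : ContinuousOn u (Ioi 0)) :
    AEStronglyMeasurable (fun z : ℝ × ℝ => (besselHeat lam z.1 u z.2 - u z.2) / z.1 ^ (1 + σ))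
      ((volume.restrict (Ioi 0)).prod (volume.restrict (Ioi 0))) := by
  have hm := hc.aestronglyMeasurable (μ := volume) measurableSet_Ioi
  have hp : AEStronglyMeasurable (fun t : ℝ => t ^ (1 + σ)) (volume.restrict (Ioi 0)) :=
    (Real.continuous_rpow_const (by linarith)).aestronglyMeasurable
  exact (((aestronglyMeasurable_besselHeat hlam hm).sub hm.comp_snd).aemeasurable.div
    hp.comp_fst.aemeasurable).aestronglyMeasurable

lemma HeatRegular.integrable_prod (hlam : 1 ≤ lam) (hσ0 : 0 < σ) (hσ1 : σ < 1)
    (h : HeatRegular lam σ β u A) {φ : ℝ → ℝ} (hφ : IsBesselTest lam φ) :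
    Integrable (fun z : ℝ × ℝ => (besselHeat lam z.1 u z.2 - u z.2) / z.1 ^ (1 + σ) * φ z.2)
      ((volume.restrict (Ioi 0)).prod (volume.restrict (Ioi 0))) := by
  obtain ⟨E, -, hEφ, hE⟩ := h.exists_profile hlam hσ0
  have b := Integrable.mul_prod (h.integrableOn_timeProfile hσ0 hσ1) (hEφ φ hφ).norm
  refine Integrable.mono' b ((aestronglyMeasurable_increment hlam hσ0 h.cont).mul
    (hφ.continuousOn.aestronglyMeasurable measurableSet_Ioi).comp_snd)
    (ae_prod_Ioi_of_forall fun t x ht hx => ?_)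
  have h1 := hE t x ht hx
  have h2 : 0 ≤ timeProfile σ β u t := timeProfile_nonneg t
  simp only
  rw [norm_mul, norm_mul, Real.norm_eq_abs]
  calc _ ≤ (‖E x‖ * timeProfile σ β u t) * ‖φ x‖ := by
        refine mul_le_mul_of_nonneg_right (h1.trans ?_) (norm_nonneg _)
        exact mul_le_mul_of_nonneg_right (le_abs_self _) h2
    _ = _ := by ring

/-- The increments of the semigroup on test functions are jointly integrable against the weighted
class. -/
lemma IsBesselTest.integrable_prod (hlam : 1 ≤ lam) (hσ0 : 0 < σ) (hσ1 : σ < 1)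
    (h : HeatRegular lam σ β u A) {φ : ℝ → ℝ} (hφ : IsBesselTest lam φ) :
    Integrable (fun z : ℝ × ℝ => u z.2 * ((besselHeat lam z.1 φ z.2 - φ z.2) / z.1 ^ (1 + σ)))
      ((volume.restrict (Ioi 0)).prod (volume.restrict (Ioi 0))) := by
  obtain ⟨C1, hC10, hC1⟩ := hφ.exists_abs_besselHeat_sub_le hlam
  obtain ⟨C2, hC20, hC2⟩ := hφ.exists_abs_besselHeat_le_large hlam hσ0
  have i1 : IntegrableOn (fun x => |u x| * (1 + x) ^ (-3 : ℝ)) (Ioi 0) := by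
    refine h.weight.integrableOn_of_le h.cont (K := 1) (ContinuousOn.rpow_const (by fun_prop)
      fun x hx => Or.inl ?_) fun x hx => ?_
    · have : 0 < x := hx
      positivity
    · rw [abs_of_nonneg (by positivity), one_mul]
      exact Real.rpow_le_rpow_of_exponent_le (by linarith) (by linarith)
  have j1 : IntegrableOn ((Ioc (0 : ℝ) 1).indicator fun t => t ^ (-σ)) (Ioi 0) :=
    ((integrable_indicator_iff measurableSet_Ioc).2
      (integrableOn_rpow_Ioc (by linarith))).integrableOn
  have j2 : IntegrableOn ((Ioi (1 : ℝ)).indicator fun t => t ^ (-(1 + σ))) (Ioi 0) :=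
    ((integrable_indicator_iff measurableSet_Ioi).2 (integrableOn_Ioi_rpow_of_lt
      (by linarith) one_pos)).integrableOn
  -- Three majorants: the Duhamel bound for t ≤ 1, and for t > 1 the parabolic tail of W_t φ and the
  -- subtracted φ.
  have b := ((j1.mul_prod (i1.const_mul C1)).add
    (((h.weight.integrable_parabolic_prod hσ0 h.cont).const_mul C2).add
      (j2.mul_prod (h.test φ hφ).norm)))
  refine Integrable.mono' b ((h.cont.aestronglyMeasurable measurableSet_Ioi).comp_snd.mul
    (aestronglyMeasurable_increment hlam hσ0 hφ.continuousOn))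
    (ae_prod_Ioi_of_forall fun t x ht hx => ?_)
  have htp : 0 < t ^ (1 + σ) := by positivity
  simp only [Pi.add_apply]
  rw [norm_mul, norm_div, Real.norm_of_nonneg htp.le, norm_mul]
  simp only [Real.norm_eq_abs]
  have hinv : ∀ a : ℝ, a / t ^ (1 + σ) = a * t ^ (-(1 + σ)) := fun a => by
    rw [Real.rpow_neg ht.le, div_eq_mul_inv]
  rcases le_or_gt t 1 with ht1 | ht1
  · have m1 : t ∈ Ioc (0 : ℝ) 1 := ⟨ht, ht1⟩
    have m2 : t ∉ Ioi (1 : ℝ) := fun hh => absurd ht1 (not_le.2 hh)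
    rw [indicator_of_mem m1, indicator_of_notMem m2, indicator_of_notMem m2]
    have e : t * t ^ (-(1 + σ)) = t ^ (-σ) := by
      nth_rewrite 1 [← Real.rpow_one t]
      rw [← Real.rpow_add ht]; ring_nf
    rw [hinv]
    calc _ ≤ |u x| * (C1 * (1 + x) ^ (-3 : ℝ) * t * t ^ (-(1 + σ))) := by
          gcongr; exact hC1 t x ht ht1 hx
      _ = _ := by rw [mul_assoc (C1 * _), e]; ring
  · have m1 : t ∉ Ioc (0 : ℝ) 1 := fun hh => absurd hh.2 (not_le.2 ht1)
    have m2 : t ∈ Ioi (1 : ℝ) := ht1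
    rw [indicator_of_notMem m1, indicator_of_mem m2, indicator_of_mem m2]
    have e : t ^ (1 + σ) * t ^ (-(1 + σ)) = 1 := by
      rw [← Real.rpow_add ht, add_neg_cancel, Real.rpow_zero]
    rw [hinv]
    calc _ ≤ |u x| * ((C2 * t ^ (1 + σ) * (t + x ^ 2) ^ (-(3 / 2 + σ)) + |φ x|)
            * t ^ (-(1 + σ))) := by
          gcongr
          exact (abs_sub _ _).trans (add_le_add_left (hC2 t x ht1.le hx) _)
      _ = |u x| * (C2 * (t + x ^ 2) ^ (-(3 / 2 + σ)) * (t ^ (1 + σ) * t ^ (-(1 + σ)))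
            + |φ x| * t ^ (-(1 + σ))) := by ring
      _ = _ := by rw [e]; ring

/-- Symmetry of the Bessel heat semigroup. -/
lemma HeatRegular.integral_symm (hlam : 1 ≤ lam) (hσ0 : 0 < σ)
    (h : HeatRegular lam σ β u A) {φ : ℝ → ℝ} (hφ : IsBesselTest lam φ) {t : ℝ} (ht : 0 < t) :
    ∫ x in Ioi (0 : ℝ), u x * (besselHeat lam t φ x - φ x)
      = ∫ x in Ioi (0 : ℝ), (besselHeat lam t u x - u x) * φ x := by
  obtain ⟨C, hC0, hC⟩ := exists_besselHeat_le_parabolicMass hlam hσ0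
  set q := 3 / 2 + σ with hq
  have hd : RapidDecay fun y => (2 * (1 + y ^ 2 / t)) ^ q * φ y := by
    refine (hφ.rapidDecay (by linarith)).of_le_mul (K := (2 * (1 + 1 / t)) ^ q) (a := 2 * q)
      (by positivity) fun y hy => ?_
    rw [abs_mul, abs_of_nonneg (by positivity)]
    rw [Real.rpow_mul (by positivity), Real.rpow_two, ← Real.mul_rpow (by positivity) (by positivity)]
    refine mul_le_mul_of_nonneg_right (Real.rpow_le_rpow (by positivity) ?_ (by positivity))
      (abs_nonneg _)
    have h1 : 1 + y ^ 2 / t ≤ (1 + 1 / t) * (1 + y) ^ 2 := by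
      have e : y ^ 2 / t = 1 / t * y ^ 2 := by ring
      have : 0 < 1 / t := by positivity
      rw [e]
      nlinarith [mul_pos this hy, mul_pos this (pow_pos hy 2)]
    linarith
  have hi : IntegrableOn (fun y => (2 * (1 + y ^ 2 / t)) ^ q * φ y) (Ioi 0) :=
    hd.integrableOn (ContinuousOn.mul (ContinuousOn.rpow_const (by fun_prop)
      fun y _ => Or.inl (by positivity)) hφ.continuousOn)
  -- Here Peetre is applied around y, so that x carries the weight suited to u and the polynomial
  -- loss in y is absorbed by φ.
  have hI : Integrable (Function.uncurry fun x y : ℝ => u x * (besselHeatKernel lam t x y * φ y))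
      ((volume.restrict (Ioi 0)).prod (volume.restrict (Ioi 0))) := by
    have b := ((h.weight.integrableOn_parabolic hσ0 h.cont ht).const_mul
      (C * t ^ (1 + σ))).mul_prod hi.norm
    refine Integrable.mono' b ?_ (ae_prod_Ioi_of_forall fun x y hx hy => ?_)
    · refine ContinuousOn.aestronglyMeasurable_prod_Ioi (ContinuousOn.mul ?_ (ContinuousOn.mul ?_ ?_))
      · exact h.cont.comp (by fun_prop) fun z hz => hz.1
      · exact (continuousOn_besselHeatKernel hlam).comp (f := fun z : ℝ × ℝ => ((t, z.1), z.2))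
          (by fun_prop) fun z hz => ⟨⟨ht, hz.1⟩, hz.2⟩
      · exact hφ.continuousOn.comp (by fun_prop) fun z hz => hz.2
    · have h1 := (abs_besselHeatKernel_le hlam ht hy hx).trans
        ((hC u h.weight h.cont t y ht hy).1 x)
      rw [besselHeatKernel_symm] at h1
      simp only [Function.uncurry]
      rw [norm_mul, norm_mul, norm_mul, Real.norm_of_nonneg
        (by positivity : 0 ≤ (2 * (1 + y ^ 2 / t)) ^ q)]
      simp only [Real.norm_eq_abs]
      calc _ ≤ |u x| * ((C * t ^ (1 + σ) * (2 * (1 + y ^ 2 / t)) ^ q * (t + x ^ 2) ^ (-q))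
            * |φ y|) := by gcongr
        _ = _ := by ring
  have i1 : IntegrableOn (fun x => u x * besselHeat lam t φ x) (Ioi 0) := by
    refine hI.integral_prod_left.congr (Eventually.of_forall fun x => ?_)
    simp only [Function.uncurry]
    rw [integral_const_mul, besselHeat]
  have e2 : ∀ y, ∫ x in Ioi (0 : ℝ), u x * (besselHeatKernel lam t x y * φ y)
      = besselHeat lam t u y * φ y := by
    intro y
    rw [besselHeat, ← integral_mul_const]
    refine integral_congr_ae (Eventually.of_forall fun x => ?_)
    simp only
    rw [besselHeatKernel_symm t y x]; ring
  have i2 : IntegrableOn (fun y => besselHeat lam t u y * φ y) (Ioi 0) := by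
    refine hI.integral_prod_right.congr (Eventually.of_forall fun y => ?_)
    simp only [Function.uncurry]
    rw [e2]
  have i3 := h.test φ hφ
  have e1 : ∫ x in Ioi (0 : ℝ), u x * besselHeat lam t φ x
      = ∫ y in Ioi (0 : ℝ), besselHeat lam t u y * φ y := by
    have := integral_integral_swap hI
    simp only [e2, integral_const_mul] at this
    exact this
  simp only [mul_sub, sub_mul]
  rw [integral_sub i1 i3, integral_sub i2 i3, e1]

/-- For heat-regular functions the fractional Bessel operator is given by the heat formula. -/
lemma HeatRegular.isFracBessel (hlam : 1 ≤ lam) (hσ0 : 0 < σ) (hσ1 : σ < 1)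
    (h : HeatRegular lam σ β u A) : IsFracBessel lam σ u (heatFrac lam σ u) := by
  have hfrac : ∀ φ, IsBesselTest lam φ → ∀ x, 0 < x → u x * fracBesselTest lam σ φ x =
      (Real.Gamma (-σ))⁻¹ * ∫ t in Ioi (0 : ℝ),
        u x * ((besselHeat lam t φ x - φ x) / t ^ (1 + σ)) := by
    intro φ hφ x hx
    rw [hφ.fracBesselTest_eq hlam hσ0 hσ1 hx, integral_const_mul, mul_left_comm]
    congr 2
    refine setIntegral_congr_fun measurableSet_Ioi fun t ht => ?_
    rw [Real.rpow_neg (le_of_lt ht), div_eq_mul_inv]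
  refine ⟨h.continuousOn_heatFrac hlam hσ0 hσ1, fun φ hφ => ?_, fun φ hφ => ?_, fun φ hφ => ?_⟩
  · have hi := hφ.integrable_prod hlam hσ0 hσ1 h
    exact (hi.integral_prod_right.const_mul (Real.Gamma (-σ))⁻¹).congr
      (ae_Ioi_of_forall fun x hx => (hfrac φ hφ x hx).symm)
  · have hi := h.integrable_prod hlam hσ0 hσ1 hφ
    refine (hi.integral_prod_right.const_mul (Real.Gamma (-σ))⁻¹).congr
      (Eventually.of_forall fun x => ?_)
    simp only
    rw [heatFrac, integral_mul_const, mul_assoc]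
  · have hi1 : Integrable (Function.uncurry fun t x =>
        u x * ((besselHeat lam t φ x - φ x) / t ^ (1 + σ)))
        ((volume.restrict (Ioi 0)).prod (volume.restrict (Ioi 0))) :=
      hφ.integrable_prod hlam hσ0 hσ1 h
    have hi2 : Integrable (Function.uncurry fun t x =>
        (besselHeat lam t u x - u x) / t ^ (1 + σ) * φ x)
        ((volume.restrict (Ioi 0)).prod (volume.restrict (Ioi 0))) :=
      h.integrable_prod hlam hσ0 hσ1 hφ
    rw [fracBesselFunctional, setIntegral_congr_fun measurableSet_Ioi (hfrac φ hφ),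
      integral_const_mul, ← integral_integral_swap hi1]
    have e : ∫ x in Ioi (0 : ℝ), heatFrac lam σ u x * φ x = (Real.Gamma (-σ))⁻¹ *
        ∫ x in Ioi (0 : ℝ), ∫ t in Ioi (0 : ℝ),
          (besselHeat lam t u x - u x) / t ^ (1 + σ) * φ x := by
      rw [← integral_const_mul]
      refine integral_congr_ae (Eventually.of_forall fun x => ?_)
      simp only
      rw [heatFrac, integral_mul_const, mul_assoc]
    -- With t outermost on both sides, the identity reduces to symmetry of the semigroup at each
    -- fixed t.
    rw [e, ← integral_integral_swap hi2]
    congr 1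
    refine setIntegral_congr_fun measurableSet_Ioi fun t ht => ?_
    have := h.integral_symm hlam hσ0 hφ ht
    have e1 : ∀ x, u x * ((besselHeat lam t φ x - φ x) / t ^ (1 + σ))
        = (u x * (besselHeat lam t φ x - φ x)) / t ^ (1 + σ) := fun x => by ring
    have e2 : ∀ x, (besselHeat lam t u x - u x) / t ^ (1 + σ) * φ x
        = ((besselHeat lam t u x - u x) * φ x) / t ^ (1 + σ) := fun x => by ring
    simp only [e1, e2, integral_div]
    rw [this]

end Main

/-! ### From Hölder conditions to heat regularity -/

lemma RapidDecay.integrableOn_of_le_rpow {p f : ℝ → ℝ} (hp : RapidDecay p)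
    (hf : ContinuousOn f (Ioi 0)) {K a b : ℝ} (hK : 0 ≤ K) (ha : -1 < a)
    (h : ∀ x, 0 < x → |f x| ≤ K * (x ^ a * (1 + x) ^ b) * |p x|) : IntegrableOn f (Ioi 0) := by
  have hm := hf.aestronglyMeasurable measurableSet_Ioi (μ := volume)
  -- Near the origin only x^a matters, with a > -1; beyond 1, decay of order b + |a| + 2 leaves the
  -- integrable (1 + x)^{-2}.
  rw [← Ioc_union_Ioi_eq_Ioi zero_le_one]
  refine IntegrableOn.union ?_ ?_
  · obtain ⟨D, hD0, hD⟩ := hp b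
    refine Integrable.mono' ((integrableOn_rpow_Ioc ha).const_mul (K * D))
      (hm.mono_measure (Measure.restrict_mono Ioc_subset_Ioi_self le_rfl)) ?_
    refine (ae_restrict_iff' measurableSet_Ioc).2 (Eventually.of_forall fun x hx => ?_)
    have h1 : 0 < 1 + x := by linarith [hx.1]
    have hx0 : 0 < x := hx.1
    calc ‖f x‖ ≤ K * (x ^ a * (1 + x) ^ b) * |p x| := h x hx0
      _ ≤ K * (x ^ a * (1 + x) ^ b) * (D * (1 + x) ^ (-b)) := by gcongr; exact hD x hx0
      _ = K * D * x ^ a * ((1 + x) ^ b * (1 + x) ^ (-b)) := by ring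
      _ = K * D * x ^ a := by rw [← Real.rpow_add h1, add_neg_cancel, Real.rpow_zero, mul_one]
  · obtain ⟨D, hD0, hD⟩ := hp (b + |a| + 2)
    refine Integrable.mono' (((integrableOn_one_add_rpow one_lt_two).mono_set
      (Ioi_subset_Ioi zero_le_one)).const_mul (K * D))
      (hm.mono_measure (Measure.restrict_mono (Ioi_subset_Ioi zero_le_one) le_rfl)) ?_
    refine (ae_restrict_iff' measurableSet_Ioi).2 (Eventually.of_forall fun x hx => ?_)
    have hx1 : 1 < x := hx
    have hx0 : 0 < x := by linarith
    have h1 : 0 < 1 + x := by linarith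
    have h2 : x ^ a ≤ (1 + x) ^ |a| :=
      (Real.rpow_le_rpow_of_exponent_le hx1.le (le_abs_self a)).trans
        (Real.rpow_le_rpow hx0.le (by linarith) (abs_nonneg a))
    calc ‖f x‖ ≤ K * (x ^ a * (1 + x) ^ b) * |p x| := h x hx0
      _ ≤ K * ((1 + x) ^ |a| * (1 + x) ^ b) * (D * (1 + x) ^ (-(b + |a| + 2))) := by
        gcongr; exact hD x hx0
      _ = K * D * ((1 + x) ^ |a| * (1 + x) ^ b * (1 + x) ^ (-(b + |a| + 2))) := by ring
      _ = K * D * (1 + x) ^ (-2 : ℝ) := by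
        rw [← Real.rpow_add h1, ← Real.rpow_add h1]; ring_nf

/-- A function with a first-order expansion of order `β > 2σ` at every point, with uniform
remainder and controlled growth at the origin and at infinity, is regular for the semigroup. -/
lemma HeatRegular.of_expansion {lam σ β : ℝ} {u d : ℝ → ℝ} (hlam : 1 ≤ lam) (hσ0 : 0 < σ)
    (huc : ContinuousOn u (Ioi 0)) (huL : MemLWeight σ u) (hdc : ContinuousOn d (Ioi 0))
    (hβ : 2 * σ < β) {H : ℝ}
    (hexp : ∀ x y, 0 < x → 0 < y → |u y - u x - d x * (y - x)| ≤ H * |x - y| ^ β)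
    {K c b : ℝ} (hK : 0 ≤ K) (hc : -1 < c + lam)
    (hgrowth : ∀ x, 0 < x → |d x| / x + |u x| / x ^ 2 ≤ K * (x ^ c * (1 + x) ^ b)) :
    ∃ A, HeatRegular lam σ β u A := by
  obtain ⟨C, hC0, hC⟩ := exists_besselHeat_sub_le (lam := lam) (β := β) hlam (by linarith)
  have hum := huc.aestronglyMeasurable measurableSet_Ioi (μ := volume)
  -- G is the coefficient of t in the small-time error. Near 0 it may blow up like x^c, and φ = x^λ
  -- p compensates since c + λ > -1.
  set G : ℝ → ℝ := fun x => |d x| / x + |u x| / x ^ 2 with hG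
  have hGc : ContinuousOn G (Ioi 0) :=
    (hdc.abs.div continuousOn_id fun x hx => ne_of_gt hx).add
      (huc.abs.div (continuousOn_id.pow 2) fun x hx => pow_ne_zero 2 (ne_of_gt hx))
  have hH : 0 ≤ H := by
    have := (abs_nonneg _).trans (hexp 1 2 one_pos two_pos)
    norm_num at this
    exact this
  refine ⟨fun x => C * (H + G x), huc, huL, hβ, continuousOn_const.mul (continuousOn_const.add hGc),
    fun t x ht ht1 hx => ?_, fun t x ht hx => (hC u t x (d x) H hum ht hx fun y hy =>
      hexp x y hx hy).1, fun φ hφ => ?_, fun φ hφ => ?_⟩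
  · refine ((hC u t x (d x) H hum ht hx fun y hy => hexp x y hx hy).2).trans ?_
    have h0 : 0 ≤ G x := by positivity
    have h1 : 0 ≤ t ^ (β / 2) := by positivity
    have e : H * t ^ (β / 2) + |d x| * (t / x) + |u x| * (t / x ^ 2) = H * t ^ (β / 2) + G x * t := by
      rw [hG]; ring
    rw [e, mul_assoc]
    refine mul_le_mul_of_nonneg_left ?_ hC0
    nlinarith [mul_nonneg h0 h1, mul_nonneg hH ht.le]
  · obtain ⟨p, hp, he⟩ := hφ.exists_rapidEven
    have i1 : IntegrableOn (fun x => G x * φ x) (Ioi 0) := by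
      refine hp.rapidDecay.integrableOn_of_le_rpow (hGc.mul hφ.continuousOn) (b := b) hK hc
        fun x hx => ?_
      rw [he x hx, abs_mul, abs_mul, abs_of_nonneg (Real.rpow_nonneg hx.le _),
        abs_of_nonneg (by positivity : 0 ≤ G x), Real.rpow_add hx]
      calc G x * (x ^ lam * |p x|) ≤ K * (x ^ c * (1 + x) ^ b) * (x ^ lam * |p x|) := by
            gcongr; exact hgrowth x hx
        _ = _ := by ring
    have i2 := (hφ.rapidDecay (by linarith)).integrableOn hφ.continuousOn
    refine (((i2.const_mul H).add i1).const_mul C).congr (Eventually.of_forall fun x => ?_)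
    simp only [Pi.add_apply]; ring
  · obtain ⟨p, hp, he⟩ := hφ.exists_rapidEven
    refine hp.rapidDecay.integrableOn_of_le_rpow (huc.mul hφ.continuousOn) (b := b)
      (a := c + lam + 2) hK (by linarith) fun x hx => ?_
    have h1 : |u x| ≤ x ^ 2 * (K * (x ^ c * (1 + x) ^ b)) := by
      have h2 : |u x| / x ^ 2 ≤ K * (x ^ c * (1 + x) ^ b) :=
        (le_add_of_nonneg_left (by positivity)).trans (hgrowth x hx)
      rwa [div_le_iff₀' (by positivity)] at h2
    rw [he x hx, abs_mul, abs_mul, abs_of_nonneg (Real.rpow_nonneg hx.le _),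
      Real.rpow_add hx, Real.rpow_add hx, Real.rpow_two]
    calc |u x| * (x ^ lam * |p x|)
        ≤ x ^ 2 * (K * (x ^ c * (1 + x) ^ b)) * (x ^ lam * |p x|) := by gcongr
      _ = _ := by ring

namespace IsHolderPlus

variable {α : ℝ} {f : ℝ → ℝ}

lemma exists_abs_sub_le (hf : IsHolderPlus α f) (hα : 0 < α) : ∃ H, 0 ≤ H ∧
    ∀ x y, 0 < x → 0 < y → |f x - f y| ≤ H * |x - y| ^ α := by
  obtain ⟨C, hC⟩ := hf.holder
  refine ⟨|C|, abs_nonneg C, fun x y hx hy => ?_⟩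
  rcases eq_or_ne x y with rfl | hxy
  · simp [Real.zero_rpow hα.ne']
  · have h0 : 0 < |x - y| := abs_pos.2 (sub_ne_zero.2 hxy)
    rw [← div_le_iff₀ (by positivity)]
    exact (hC x y hx hy hxy).trans (le_abs_self C)

lemma exists_abs_le (hf : IsHolderPlus α f) : ∃ K, 0 ≤ K ∧ ∀ x, 0 < x → |f x| ≤ K * x ^ α := by
  obtain ⟨C, hC⟩ := hf.growth
  refine ⟨|C|, abs_nonneg C, fun x hx => ?_⟩
  have := (hC x hx).trans (le_abs_self C)
  rwa [Real.rpow_neg hx.le, ← div_eq_inv_mul, div_le_iff₀ (by positivity)] at this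

end IsHolderPlus

/-- The mean value inequality for z ↦ u(z) - u'(x) z on the segment between x and y. -/
lemma abs_sub_sub_deriv_mul_le {u : ℝ → ℝ} {α H : ℝ} (hα : 0 ≤ α) (hH : 0 ≤ H)
    (hu : DifferentiableOn ℝ u (Ioi 0))
    (h : ∀ x y, 0 < x → 0 < y → |deriv u x - deriv u y| ≤ H * |x - y| ^ α)
    {x y : ℝ} (hx : 0 < x) (hy : 0 < y) :
    |u y - u x - deriv u x * (y - x)| ≤ H * |x - y| ^ (1 + α) := by
  have hpos : ∀ z ∈ uIcc x y, 0 < z := fun z hz => (lt_min hx hy).trans_le hz.1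
  have hd : ∀ z ∈ uIcc x y, HasDerivWithinAt (fun z => u z - deriv u x * z)
      (deriv u z - deriv u x) (uIcc x y) z := fun z hz => by
    have h1 := ((hu z (hpos z hz)).differentiableAt (Ioi_mem_nhds (hpos z hz))).hasDerivAt
    have h2 := (hasDerivAt_id z).const_mul (deriv u x)
    rw [mul_one] at h2
    exact (h1.sub h2).hasDerivWithinAt
  have hb : ∀ z ∈ uIcc x y, ‖deriv u z - deriv u x‖ ≤ H * |x - y| ^ α := fun z hz => by
    refine (h z x (hpos z hz) hx).trans ?_
    have : |z - x| ≤ |x - y| := by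
      rw [abs_sub_comm x y]; exact abs_sub_left_of_mem_uIcc hz
    gcongr
  have := (convex_uIcc x y).norm_image_sub_le_of_norm_hasDerivWithin_le hd hb
    left_mem_uIcc right_mem_uIcc
  rw [Real.norm_eq_abs, Real.norm_eq_abs] at this
  calc |u y - u x - deriv u x * (y - x)| = |u y - deriv u x * y - (u x - deriv u x * x)| := by
        congr 1; ring
    _ ≤ _ := this
    _ = H * |x - y| ^ (1 + α) := by
      rw [Real.rpow_one_add' (abs_nonneg _) (by linarith), abs_sub_comm y x]; ring

/-- An expansion of order zero (d = 0). The growth condition gives |u|/x² ≤ K x^{α-2}, and α - 2 + λ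
> -1 because α > 0 and λ ≥ 1. -/
lemma IsHolderPlus.exists_heatRegular {lam σ α : ℝ} {u : ℝ → ℝ} (hlam : 1 ≤ lam) (hσ0 : 0 < σ)
    (hα : 2 * σ < α) (huL : MemLWeight σ u) (hu : IsHolderPlus α u) :
    ∃ A, HeatRegular lam σ α u A := by
  obtain ⟨H, -, hH⟩ := hu.exists_abs_sub_le (by linarith)
  obtain ⟨K, hK0, hK⟩ := hu.exists_abs_le
  refine HeatRegular.of_expansion (d := fun _ => 0) (H := H) (c := α - 2) (b := 0) hlam hσ0 hu.cont
    huL continuousOn_const hα (fun x y hx hy => ?_) hK0 (by linarith) fun x hx => ?_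
  · rw [zero_mul, sub_zero, abs_sub_comm]; exact hH x y hx hy
  · rw [abs_zero, zero_div, zero_add, Real.rpow_zero, mul_one, Real.rpow_sub hx, Real.rpow_two,
      ← mul_div_assoc]
    gcongr
    exact hK x hx

/-- A first-order expansion with d = u' and remainder of order 1 + α > 2σ. Near the origin u is
merely bounded, so |u|/x² may be as large as x^{-2}; pairing with x^λ needs λ > 1, which λ ≥ 2
provides. -/
lemma IsHolderPlus.exists_heatRegular_of_deriv {lam σ α : ℝ} {u : ℝ → ℝ} (hlam : 2 ≤ lam)
    (hσ0 : 0 < σ) (hα0 : 0 < α) (hα1 : α ≤ 1) (hα : 2 * σ - 1 < α) (huL : MemLWeight σ u)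
    (hud : DifferentiableOn ℝ u (Ioi 0)) (hu : IsHolderPlus α (deriv u)) :
    ∃ A, HeatRegular lam σ (1 + α) u A := by
  obtain ⟨H, hH0, hH⟩ := hu.exists_abs_sub_le hα0
  obtain ⟨K, hK0, hK⟩ := hu.exists_abs_le
  have hexp : ∀ x y, 0 < x → 0 < y →
      |u y - u x - deriv u x * (y - x)| ≤ H * |x - y| ^ (1 + α) := fun x y hx hy =>
    abs_sub_sub_deriv_mul_le hα0.le hH0 hud hH hx hy
  have hpow : ∀ x : ℝ, 0 ≤ x → ∀ z, 0 ≤ z → z ≤ 1 + x → z ^ (1 + α) ≤ (1 + x) ^ (2 : ℝ) :=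
    fun x hx z hz hzx => (Real.rpow_le_rpow hz hzx (by linarith)).trans
      (Real.rpow_le_rpow_of_exponent_le (by linarith) (by linarith))
  -- Boundedness near 0 and quadratic growth both come from the expansion at the point 1, since 1 +
  -- α ≤ 2.
  have hgu : ∀ x, 0 < x → |u x| ≤ (|u 1| + |deriv u 1| + H) * (1 + x) ^ (2 : ℝ) := by
    intro x hx
    have h1 := hexp 1 x one_pos hx
    have h2 : |1 - x| ≤ 1 + x := abs_le.2 ⟨by linarith, by linarith⟩
    have h3 := hpow x hx.le _ (abs_nonneg (1 - x)) h2
    have h4 : (1 : ℝ) ≤ (1 + x) ^ (2 : ℝ) := Real.one_le_rpow (by linarith) (by norm_num)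
    have h5 : |x - 1| ≤ (1 + x) ^ (2 : ℝ) := by
      rw [abs_sub_comm, Real.rpow_two]; nlinarith
    calc |u x| = |u 1 + deriv u 1 * (x - 1) + (u x - u 1 - deriv u 1 * (x - 1))| := by
          congr 1; ring
      _ ≤ |u 1| + |deriv u 1| * |x - 1| + H * |1 - x| ^ (1 + α) := by
        refine (abs_add_le _ _).trans (add_le_add ((abs_add_le _ _).trans_eq ?_) h1)
        rw [abs_mul]
      _ ≤ |u 1| * (1 + x) ^ (2 : ℝ) + |deriv u 1| * (1 + x) ^ (2 : ℝ) + H * (1 + x) ^ (2 : ℝ) := by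
        gcongr; exact le_mul_of_one_le_right (abs_nonneg _) h4
      _ = _ := by ring
  refine HeatRegular.of_expansion (H := H) (c := -2) (b := 2)
    (K := K + (|u 1| + |deriv u 1| + H)) (by linarith) hσ0 hud.continuousOn
    huL hu.cont (by linarith) hexp (by positivity) (by linarith) fun x hx => ?_
  have h1 : |deriv u x| / x ≤ K * (1 + x) ^ (2 : ℝ) / x ^ 2 := by
    rw [div_le_div_iff₀ hx (by positivity)]
    have := hpow x hx.le x hx.le (by linarith)
    rw [Real.rpow_add hx, Real.rpow_one] at this
    calc |deriv u x| * x ^ 2 ≤ K * x ^ α * x ^ 2 := by gcongr; exact hK x hx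
      _ = K * (x * x ^ α) * x := by ring
      _ ≤ _ := by gcongr
  have h2 : |u x| / x ^ 2 ≤ (|u 1| + |deriv u 1| + H) * (1 + x) ^ (2 : ℝ) / x ^ 2 := by
    gcongr; exact hgu x hx
  refine (add_le_add h1 h2).trans_eq ?_
  rw [Real.rpow_neg hx.le, Real.rpow_two x]
  ring

/-! ### Uniqueness and conclusion -/

/-- Smooth functions with compact support in `(0,∞)`. -/
structure IsBumpIoi (φ : ℝ → ℝ) : Prop where
  smooth : ContDiff ℝ (⊤ : ℕ∞) φ
  compact : HasCompactSupport φ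
  support : tsupport φ ⊆ Ioi 0

namespace IsBumpIoi

variable {φ : ℝ → ℝ}

/-- Smoothness of f on (0,∞) alone is enough, since φ vanishes near every point outside its support;
powers and 1/x are thus allowed. -/
lemma contDiffOn_mul (hφ : IsBumpIoi φ) {f : ℝ → ℝ} (hf : ContDiffOn ℝ (⊤ : ℕ∞) f (Ioi 0)) :
    IsBumpIoi fun x => f x * φ x where
  smooth := by
    refine contDiff_iff_contDiffAt.2 fun x => ?_
    by_cases hx : x ∈ tsupport φ
    · exact (hf.contDiffAt (isOpen_Ioi.mem_nhds (hφ.support hx))).mul hφ.smooth.contDiffAt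
    · refine (contDiffAt_const (c := (0 : ℝ))).congr_of_eventuallyEq ?_
      filter_upwards [(isClosed_tsupport φ).isOpen_compl.mem_nhds hx] with y hy
      rw [image_eq_zero_of_notMem_tsupport hy, mul_zero]
  compact := hφ.compact.mul_left
  support := (tsupport_mul_subset_right (f := f)).trans hφ.support

lemma invDeriv (hφ : IsBumpIoi φ) : IsBumpIoi (invDeriv φ) :=
  contDiffOn_mul (φ := deriv φ)
    ⟨(contDiff_infty_iff_deriv.1 hφ.smooth).2, hφ.compact.deriv,
      (tsupport_deriv_subset).trans hφ.support⟩
    (contDiffOn_id.inv fun _ hx => ne_of_gt hx)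

lemma iterate_invDeriv (hφ : IsBumpIoi φ) (k : ℕ) : IsBumpIoi (_root_.invDeriv^[k] φ) := by
  induction k with
  | zero => exact hφ
  | succ k ih => rw [Function.iterate_succ_apply']; exact ih.invDeriv

lemma isBesselTest (hφ : IsBumpIoi φ) (lam : ℝ) : IsBesselTest lam φ where
  smooth := hφ.smooth.contDiffOn
  decay m k := by
    have h := (hφ.contDiffOn_mul (f := fun y => y ^ (-lam))
      (contDiffOn_id.rpow_const_of_ne fun x hx => ne_of_gt hx)).iterate_invDeriv k
    obtain ⟨C, hC⟩ := (h.compact.mul_left (f := fun x : ℝ => (1 + x) ^ m)).exists_bound_of_continuous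
      (Continuous.mul (by fun_prop) h.smooth.continuous)
    refine ⟨C, fun x hx => ?_⟩
    have := hC x
    rwa [Pi.mul_apply, norm_mul, Real.norm_eq_abs, Real.norm_eq_abs,
      abs_of_nonneg (by positivity)] at this

end IsBumpIoi

/-- The continuous representative of `Δ_lam^σ u` is unique. -/
lemma IsFracBessel.eqOn {lam σ : ℝ} {u g₁ g₂ : ℝ → ℝ} (h₁ : IsFracBessel lam σ u g₁)
    (h₂ : IsFracBessel lam σ u g₂) : EqOn g₁ g₂ (Ioi 0) := by
  refine Measure.eqOn_open_of_ae_eq (μ := volume) ?_ isOpen_Ioi h₁.cont h₂.cont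
  -- The fundamental lemma of the calculus of variations: g₁ - g₂ vanishes against every bump, hence
  -- almost everywhere, hence everywhere by continuity.
  have h := isOpen_Ioi.ae_eq_zero_of_integral_contDiff_smul_eq_zero (μ := volume)
    ((h₁.cont.sub h₂.cont).locallyIntegrableOn measurableSet_Ioi) fun φ hs hc ht => ?_
  · refine (ae_restrict_iff' measurableSet_Ioi).2 (h.mono fun x hx hx0 => ?_)
    exact sub_eq_zero.1 (hx hx0)
  · have hφ : IsBesselTest lam φ := IsBumpIoi.isBesselTest ⟨hs, hc, ht⟩ lam
    have hz : ∀ x ∉ Ioi (0 : ℝ), φ x • (g₁ - g₂) x = 0 := fun x hx => by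
      rw [image_eq_zero_of_notMem_tsupport fun h => hx (ht h), zero_smul]
    have e := (h₁.eq φ hφ).symm.trans (h₂.eq φ hφ)
    rw [← sub_eq_zero, ← integral_sub (h₁.integrable φ hφ) (h₂.integrable φ hφ)] at e
    refine (setIntegral_eq_integral_of_forall_compl_eq_zero (μ := volume) hz).symm.trans
      (Eq.trans ?_ e)
    refine integral_congr_ae (Eventually.of_forall fun x => ?_)
    simp only [smul_eq_mul, Pi.sub_apply]; ring

theorem corollary2 (lam σ α : ℝ) (u : ℝ → ℝ) (hσ0 : 0 < σ) (hσ1 : σ < 1) (hα : α ≤ 1)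
    (huL : MemLWeight σ u)
    (hu : (σ < 1 / 2 ∧ 1 ≤ lam ∧ 2 * σ < α ∧ IsHolderPlus α u) ∨
      (1 / 2 ≤ σ ∧ 2 ≤ lam ∧ 2 * σ - 1 < α ∧ ContinuousOn u (Ici 0) ∧
        DifferentiableOn ℝ u (Ioi 0) ∧ IsHolderPlus α (deriv u))) :
    (∃ g : ℝ → ℝ, IsFracBessel lam σ u g) ∧
    ∀ g : ℝ → ℝ, IsFracBessel lam σ u g → ∀ x : ℝ, 0 < x →
      (∀ t : ℝ, 0 < t → IntegrableOn (fun y => besselHeatKernel lam t x y * u y) (Ioi 0)) ∧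
      IntegrableOn (fun t => (besselHeat lam t u x - u x) / t ^ (1 + σ)) (Ioi 0) ∧
      g x = (Real.Gamma (-σ))⁻¹ *
        ∫ t in Ioi (0 : ℝ), (besselHeat lam t u x - u x) / t ^ (1 + σ) := by
  have hlam : 1 ≤ lam := by rcases hu with h | h <;> linarith [h.2.1]
  -- Here β = α in case (1) and β = 1 + α in case (2), where α > 0 follows from 1/2 ≤ σ.
  obtain ⟨β, A, h⟩ : ∃ β A, HeatRegular lam σ β u A := by
    rcases hu with ⟨_, _, h3, h4⟩ | ⟨h1, h2, h3, _, h5, h6⟩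
    · exact ⟨_, h4.exists_heatRegular hlam hσ0 h3 huL⟩
    · exact ⟨_, h6.exists_heatRegular_of_deriv h2 hσ0 (by linarith) hα h3 huL h5⟩
  have hF := h.isFracBessel hlam hσ0 hσ1
  refine ⟨⟨_, hF⟩, fun g hg x hx => ⟨fun t ht => h.integrable t x ht hx,
    h.integrableOn_time hlam hσ0 hσ1 hx, hg.eqOn hF hx⟩⟩

end
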